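/- Let $K$ be an algebraically closed field, let $Q_A,Q_B$ be finite quivers, and let $I_A\subseteq KQ_A$, $I_B\subseteq KQ_B$ be admissible ideals, i.e. two-sided ideals with $R^m\subseteq I\subseteq R^2$ for some $m$, where $R$ is the ideal generated by the arrows. Put $A=KQ_A/I_A$ and $B=KQ_B/I_B$. Let $a$ be a vertex of $Q_A$ and $b$ a vertex of $Q_B$, let $Q$ be the quiver obtained from $Q_A\sqcup Q_B$ by identifying $a$ and $b$, let $I$ be the two-sided ideal of $KQ$ generated by $I_A$ and $I_B$, and assume that $\Lambda=KQ/I$ is finite-dimensional over $K$ (then $\Lambda$ is called the simple gluing algebra of $A$ and $B$). Modules are finitely generated left modules. Let $i_\lambda=\Lambda\otimes_A-$ and $j_\lambda=\Lambda\otimes_B-$, where $A$ and $B$ act on $\Lambda$ from the right through the canonical (in general non-unital) algebra homomorphisms $A\to\Lambda$, $B\to\Lambda$; so $i_\lambda=\Lambda e_A\otimes_A-$ and $j_\lambda=\Lambda e_B\otimes_B-$, where $e_A,e_B\in\Lambda$ are the images of $1_A,1_B$. A module $M$ over a finite-dimensional algebra $C$ is Gorenstein projective if $M\cong\ker d^0$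 for an acyclic complex $P^\bullet$ of finitely generated projective $C$-modules such that $\operatorname{Hom}_C(P^\bullet,C)$ is acyclic. Let $\underline{\mathrm{Gproj}}(C)$ be the stable category: its objects are the Gorenstein projective $C$-modules, its morphisms are the $C$-linear maps modulo those which factor through a finitely generated projective module; it is a triangulated $K$-category with the structure induced by the short exact sequences of Gorenstein projective modules. The coproduct $\underline{\mathrm{Gproj}}(A)\coprod\underline{\mathrm{Gproj}}(B)$ has as objects the pairs $(X,Y)$ and as morphisms the pairs of morphisms, with the componentwise triangulated structure. Then: 1. For Gorenstein projective modules $X$ over $A$ and $Y$ over $B$, the $\Lambda$-module $i_\lambda(X)\oplus j_\lambda(Y)$ is Gorenstein projective, and $(X,Y)\mapsto i_\lambda(X)\oplus j_\lambda(Y)$ induces a $K$-linear triangle equivalence $$\underline{\mathrm{Gproj}}(A)\coprod\underline{\mathrm{Gproj}}(B)\;\simeq\;\underline{\mathrm{Gproj}}(\Lambda).$$ 2. An indecomposable $\Lambda$-module $Z$ is Gorenstein projective if and only if there is an indecomposable Gorenstein projective $A$-module $X$ with $Z\cong i_\lambda(X)$, or an indecomposable Gorenstein projective $B$-module $Y$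 with $Z\cong j_\lambda(Y)$. -/

import Mathlib

open CategoryTheory
open scoped TensorProduct

universe u

noncomputable section

namespace SimpleGluing

/-! ### Path algebras -/

section PathAlgebra

variable (K : Type u) [Field K] (V : Type u) [Quiver.{u} V]

/-- All paths of a quiver, with their source and target (including the trivial paths). -/
abbrev AnyPath : Type u := Σ i j : V, Quiver.Path i j

/-- The path algebra `KQ`: the vector space with basis the paths of the quiver. -/
def PathAlgebra : Type u := AnyPath V →₀ K

namespace PathAlgebra

instance : AddCommGroup (PathAlgebra K V) := inferInstanceAs (AddCommGroup (AnyPath V →₀ K))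

instance : Module K (PathAlgebra K V) := inferInstanceAs (Module K (AnyPath V →₀ K))

variable {V}

/-- The basis element of the path algebra given by a path. -/
def ofPath {i j : V} (p : Quiver.Path i j) : PathAlgebra K V :=
  Finsupp.single (⟨i, j, p⟩ : AnyPath V) (1 : K)

/-- The product `p q` of two paths: first `q`, then `p`, if the target of `q` is the source of `p`,
and `0` otherwise.  With this convention left modules over `KQ` are the covariant representations
of the quiver. -/
def pathMul (p q : AnyPath V) : PathAlgebra K V :=
  open Classical in
  if h : q.2.1 = p.1 then ofPath K (q.2.2.comp (p.2.2.cast h.symm rfl)) else 0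

/-- The bilinear extension of the product of paths. -/
def mulLinear : PathAlgebra K V →ₗ[K] PathAlgebra K V →ₗ[K] PathAlgebra K V :=
  Finsupp.linearCombination K (fun p : AnyPath V =>
    (Finsupp.linearCombination K (fun q : AnyPath V => pathMul K p q) :
      (AnyPath V →₀ K) →ₗ[K] PathAlgebra K V))

instance : Mul (PathAlgebra K V) := ⟨fun x y => mulLinear K x y⟩

/-- The identity is the sum of the trivial paths. -/
instance [Finite V] : One (PathAlgebra K V) :=
  ⟨letI := Fintype.ofFinite V
   ∑ i : V, ofPath K (Quiver.Path.nil : Quiver.Path i i)⟩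

variable {K}

lemma mul_def (x y : PathAlgebra K V) : x * y = mulLinear K x y := rfl

lemma one_def [Fintype V] :
    (1 : PathAlgebra K V) = ∑ i : V, ofPath K (Quiver.Path.nil : Quiver.Path i i) := by
  change (letI := Fintype.ofFinite V
    ∑ i : V, ofPath K (Quiver.Path.nil : Quiver.Path i i)) = _
  congr
  exact Subsingleton.elim _ _

lemma ofPath_mul_ofPath (p q : AnyPath V) :
    ofPath K p.2.2 * ofPath K q.2.2 = pathMul K p q := by
  rw [mul_def]
  simp only [ofPath, mulLinear]
  erw [Finsupp.linearCombination_single, one_smul, Finsupp.linearCombination_single, one_smul]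

lemma ofPath_comp {i j k : V} (q : Quiver.Path i j) (p : Quiver.Path j k) :
    ofPath K p * ofPath K q = ofPath K (q.comp p) := by
  have := ofPath_mul_ofPath (K := K) (⟨j, k, p⟩ : AnyPath V) ⟨i, j, q⟩
  simpa [pathMul] using this

lemma ofPath_mul_of_ne {i j k l : V} (p : Quiver.Path k l) (q : Quiver.Path i j) (h : j ≠ k) :
    ofPath K p * ofPath K q = 0 := by
  have := ofPath_mul_ofPath (K := K) (⟨k, l, p⟩ : AnyPath V) ⟨i, j, q⟩
  simpa [pathMul, h] using this

/-- Linear maps out of the path algebra agree if they agree on paths. -/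
lemma linearMap_ext {M : Type*} [AddCommGroup M] [Module K M] {f g : PathAlgebra K V →ₗ[K] M}
    (h : ∀ {i j : V} (p : Quiver.Path i j), f (ofPath K p) = g (ofPath K p)) : f = g :=
  Finsupp.lhom_ext' (fun p => LinearMap.ext_ring (h p.2.2))

lemma mul_assoc_path {i j k l m n : V} (p : Quiver.Path i j) (q : Quiver.Path k l)
    (r : Quiver.Path m n) :
    ofPath K p * ofPath K q * ofPath K r = ofPath K p * (ofPath K q * ofPath K r) := by
  have z1 : ∀ x : PathAlgebra K V, 0 * x = 0 := fun x => by simp [mul_def]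
  have z2 : ∀ x : PathAlgebra K V, x * 0 = 0 := fun x => by simp [mul_def]
  by_cases h1 : l = i
  · subst h1
    by_cases h2 : n = k
    · subst h2
      simp only [ofPath_comp, Quiver.Path.comp_assoc]
    · rw [ofPath_comp, ofPath_mul_of_ne _ _ h2, ofPath_mul_of_ne _ _ h2, z2]
  · rw [ofPath_mul_of_ne _ _ h1, z1]
    by_cases h2 : n = k
    · subst h2
      rw [ofPath_comp, ofPath_mul_of_ne _ _ h1]
    · rw [ofPath_mul_of_ne _ _ h2, z2]

lemma mul_assoc_aux (x y z : PathAlgebra K V) : x * y * z = x * (y * z) := by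
  have key : (LinearMap.compr₂ (mulLinear K) (mulLinear K) :
      PathAlgebra K V →ₗ[K] PathAlgebra K V →ₗ[K] PathAlgebra K V →ₗ[K] PathAlgebra K V) =
      (LinearMap.llcomp K (PathAlgebra K V) (PathAlgebra K V) (PathAlgebra K V)).compl₁₂
        (mulLinear K) (mulLinear K) :=
    linearMap_ext fun p => linearMap_ext fun q => linearMap_ext fun r => mul_assoc_path p q r
  exact congrArg (fun f => f x y z) key

lemma one_mul_aux [Finite V] (x : PathAlgebra K V) : 1 * x = x := by
  have := Fintype.ofFinite V
  have key : mulLinear K (1 : PathAlgebra K V) = LinearMap.id := by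
    refine linearMap_ext fun {i j} p => ?_
    change mulLinear K 1 (ofPath K p) = ofPath K p
    rw [one_def, map_sum, LinearMap.sum_apply, Finset.sum_eq_single j]
    · exact ofPath_comp p Quiver.Path.nil
    · intro k _ hk
      exact ofPath_mul_of_ne _ _ hk.symm
    · simp
  exact congrArg (fun f => f x) key

lemma mul_one_aux [Finite V] (x : PathAlgebra K V) : x * 1 = x := by
  have := Fintype.ofFinite V
  have key : (mulLinear K).flip (1 : PathAlgebra K V) = LinearMap.id := by
    refine linearMap_ext fun {i j} p => ?_
    change mulLinear K (ofPath K p) 1 = ofPath K p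
    rw [one_def, map_sum, Finset.sum_eq_single i]
    · exact (ofPath_comp Quiver.Path.nil p).trans (by rw [Quiver.Path.nil_comp])
    · intro k _ hk
      exact ofPath_mul_of_ne _ _ hk
    · simp
  exact congrArg (fun f => f x) key

instance [Finite V] : Ring (PathAlgebra K V) where
  __ := (inferInstance : AddCommGroup (PathAlgebra K V))
  left_distrib x y z := by simp [mul_def]
  right_distrib x y z := by simp [mul_def]
  zero_mul x := by simp [mul_def]
  mul_zero x := by simp [mul_def]
  mul_assoc := mul_assoc_aux
  one_mul := one_mul_aux
  mul_one := mul_one_aux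

instance [Finite V] : Algebra K (PathAlgebra K V) :=
  Algebra.ofModule (fun r x y => by simp [mul_def]) (fun r x y => by simp [mul_def])

variable (K)

/-- The linear map of path algebras given by a morphism of quivers. -/
def map {W : Type u} [Quiver.{u} W] (F : V ⥤q W) : PathAlgebra K V →ₗ[K] PathAlgebra K W :=
  Finsupp.lmapDomain K K (fun p : AnyPath V => (⟨F.obj p.1, F.obj p.2.1, F.mapPath p.2.2⟩ : AnyPath W))

variable {K}

lemma map_ofPath {W : Type u} [Quiver.{u} W] (F : V ⥤q W) {i j : V} (p : Quiver.Path i j) :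
    map K F (ofPath K p) = ofPath K (F.mapPath p) :=
  Finsupp.mapDomain_single

lemma map_mul {W : Type u} [Quiver.{u} W] (F : V ⥤q W) (hF : Function.Injective F.obj)
    (x y : PathAlgebra K V) : map K F (x * y) = map K F x * map K F y := by
  have key : (mulLinear K (V := V)).compr₂ (map K F) =
      (mulLinear K (V := W)).compl₁₂ (map K F) (map K F) := by
    refine linearMap_ext fun {i j} p => linearMap_ext fun {k l} q => ?_
    change map K F (ofPath K p * ofPath K q) = map K F (ofPath K p) * map K F (ofPath K q)
    rw [map_ofPath, map_ofPath]
    by_cases h : l = i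
    · subst h
      rw [ofPath_comp, ofPath_comp, map_ofPath, Prefunctor.mapPath_comp]
    · rw [ofPath_mul_of_ne _ _ h, ofPath_mul_of_ne _ _ (fun h' => h (hF h')), map_zero]
  exact congrArg (fun f => f x y) key

end PathAlgebra

variable {K V}

/-- A two-sided ideal `I` of `KQ` is admissible if `R ^ m ⊆ I ⊆ R ^ 2` for some `m`, where `R ^ l`
is the span of the paths of length at least `l`. -/
structure IsAdmissible [Finite V] (I : TwoSidedIdeal (PathAlgebra K V)) : Prop where
  exists_length : ∃ m : ℕ, ∀ {i j : V} (p : Quiver.Path i j), m ≤ p.length →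
    PathAlgebra.ofPath K p ∈ I
  le_sq : ∀ x ∈ I, x ∈ Submodule.span K
    {y : PathAlgebra K V | ∃ (i j : V) (p : Quiver.Path i j), 2 ≤ p.length ∧
      y = PathAlgebra.ofPath K p}

/-- The algebra `KQ / I`. -/
abbrev QuiverAlgebra [Finite V] (I : TwoSidedIdeal (PathAlgebra K V)) : Type u :=
  I.ringCon.Quotient

end PathAlgebra

/-! ### Simple gluing -/

section Gluing

variable {VA VB : Type u}

/-- The vertices of the simple gluing quiver: the disjoint union of the vertices of the two
quivers, with `a` and `b` identified. -/
def GlueVertex (a : VA) (b : VB) : Type u :=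
  Quot (fun x y : VA ⊕ VB => x = Sum.inl a ∧ y = Sum.inr b)

namespace GlueVertex

variable (a : VA) (b : VB)

/-- The vertex of the gluing quiver given by a vertex of the first quiver. -/
def left (i : VA) : GlueVertex a b := Quot.mk _ (Sum.inl i)

/-- The vertex of the gluing quiver given by a vertex of the second quiver. -/
def right (i : VB) : GlueVertex a b := Quot.mk _ (Sum.inr i)

lemma left_eq_right : left a b a = right a b b := Quot.sound ⟨rfl, rfl⟩

lemma left_injective : Function.Injective (left a b) :=
  Function.LeftInverse.injective (g := Quot.lift (Sum.elim id (fun _ => a))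
    (by rintro _ _ ⟨rfl, rfl⟩; rfl)) (fun _ => rfl)

lemma right_injective : Function.Injective (right a b) :=
  Function.LeftInverse.injective (g := Quot.lift (Sum.elim (fun _ => b) id)
    (by rintro _ _ ⟨rfl, rfl⟩; rfl)) (fun _ => rfl)

instance [Finite VA] [Finite VB] : Finite (GlueVertex a b) :=
  inferInstanceAs (Finite (Quot _))

/-- The arrows of the simple gluing quiver: those of the two given quivers. -/
inductive Arrow [Quiver.{u} VA] [Quiver.{u} VB] : GlueVertex a b → GlueVertex a b → Type u
  | ofLeft {i j : VA} (α : i ⟶ j) : Arrow (left a b i) (left a b j)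
  | ofRight {i j : VB} (α : i ⟶ j) : Arrow (right a b i) (right a b j)

variable [Quiver.{u} VA] [Quiver.{u} VB]

instance : Quiver.{u} (GlueVertex a b) := ⟨Arrow a b⟩

/-- The first quiver as a subquiver of the simple gluing quiver. -/
def inclLeft : VA ⥤q GlueVertex a b where
  obj := left a b
  map α := Arrow.ofLeft α

/-- The second quiver as a subquiver of the simple gluing quiver. -/
def inclRight : VB ⥤q GlueVertex a b where
  obj := right a b
  map α := Arrow.ofRight α

end GlueVertex

variable {K : Type u} [Field K] [Quiver.{u} VA] [Quiver.{u} VB] [Finite VA] [Finite VB]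
  (a : VA) (b : VB)
  (IA : TwoSidedIdeal (PathAlgebra K VA)) (IB : TwoSidedIdeal (PathAlgebra K VB))

/-- The ideal of the path algebra of the simple gluing quiver generated by `IA` and `IB`. -/
def glueIdeal : TwoSidedIdeal (PathAlgebra K (GlueVertex a b)) :=
  TwoSidedIdeal.span
    ((PathAlgebra.map K (GlueVertex.inclLeft a b) '' {x | x ∈ IA}) ∪
      (PathAlgebra.map K (GlueVertex.inclRight a b) '' {x | x ∈ IB}))

/-- The gluing `Λ = KQ / ⟨IA, IB⟩` of `KQ_A / IA` and `KQ_B / IB` at the vertices `a` and `b`. -/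
abbrev GluingAlgebra : Type u := QuiverAlgebra (glueIdeal a b IA IB)

/-- A vertex-injective morphism of quivers which maps the ideal `I` into the ideal `J` induces
a (non-unital) homomorphism of the quotient algebras. -/
def quiverAlgebraMap {V W : Type u} [Quiver.{u} V] [Quiver.{u} W] [Finite V] [Finite W]
    (I : TwoSidedIdeal (PathAlgebra K V)) (J : TwoSidedIdeal (PathAlgebra K W)) (F : V ⥤q W)
    (hF : Function.Injective F.obj) (hIJ : ∀ x ∈ I, PathAlgebra.map K F x ∈ J) :
    QuiverAlgebra I →ₙₐ[K] QuiverAlgebra J where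
  toFun := _root_.Quotient.lift (fun x => J.ringCon.mk' (PathAlgebra.map K F x)) (by
    intro x y h
    have h' : x - y ∈ I := (TwoSidedIdeal.rel_iff I x y).1 h
    refine (RingCon.eq J.ringCon).2 ((TwoSidedIdeal.rel_iff J _ _).2 ?_)
    rw [← map_sub]
    exact hIJ _ h')
  map_smul' := by
    rintro c ⟨x⟩
    exact congrArg J.ringCon.mk' (map_smul (PathAlgebra.map K F) c x)
  map_zero' := congrArg J.ringCon.mk' (map_zero (PathAlgebra.map K F))
  map_add' := by
    rintro ⟨x⟩ ⟨y⟩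
    exact congrArg J.ringCon.mk' (map_add (PathAlgebra.map K F) x y)
  map_mul' := by
    rintro ⟨x⟩ ⟨y⟩
    exact congrArg J.ringCon.mk' (PathAlgebra.map_mul F hF x y)

/-- The (non-unital) algebra homomorphism `A → Λ`, which maps `1` to the idempotent
`e_A = ∑ e_i`, the sum over the vertices `i` of `Q_A`. -/
def leftHom : QuiverAlgebra IA →ₙₐ[K] GluingAlgebra a b IA IB :=
  quiverAlgebraMap IA (glueIdeal a b IA IB) (GlueVertex.inclLeft a b)
    (GlueVertex.left_injective a b)
    (fun x hx => TwoSidedIdeal.subset_span (Or.inl ⟨x, hx, rfl⟩))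

/-- The (non-unital) algebra homomorphism `B → Λ`. -/
def rightHom : QuiverAlgebra IB →ₙₐ[K] GluingAlgebra a b IA IB :=
  quiverAlgebraMap IB (glueIdeal a b IA IB) (GlueVertex.inclRight a b)
    (GlueVertex.right_injective a b)
    (fun x hx => TwoSidedIdeal.subset_span (Or.inr ⟨x, hx, rfl⟩))

end Gluing

/-! ### Induction of modules along a non-unital homomorphism -/

section Induction

variable {A L : Type u} [Ring A] [Ring L] (f : A →ₙ+* L)

/-- The relations `f a ⊗ x = 1 ⊗ a x` (and their left multiples). -/
def inductionRel (M : Type u) [AddCommGroup M] [Module A M] : Submodule L (L ⊗[ℤ] M) :=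
  Submodule.span L {z | ∃ (a : A) (x : M), z = f a ⊗ₜ[ℤ] x - (1 : L) ⊗ₜ[ℤ] (a • x)}

/-- The tensor product `L ⊗_A M`, where `A` acts on `L` from the right through `f`; since `f` need
not be unital, this is `L e ⊗_A M` for the idempotent `e = f 1`. -/
abbrev Induced (M : Type u) [AddCommGroup M] [Module A M] : Type u :=
  (L ⊗[ℤ] M) ⧸ inductionRel f M

/-- The map `L ⊗_A M → L ⊗_A N` given by an `A`-linear map `M → N`. -/
def inducedMap {M N : Type u} [AddCommGroup M] [Module A M] [AddCommGroup N] [Module A N]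
    (g : M →ₗ[A] N) : Induced f M →ₗ[L] Induced f N :=
  Submodule.mapQ _ _ (TensorProduct.AlgebraTensorModule.map (LinearMap.id : L →ₗ[L] L)
    (g.toAddMonoidHom.toIntLinearMap)) (by
      rw [inductionRel, Submodule.span_le]
      rintro _ ⟨a, x, rfl⟩
      refine Submodule.subset_span ⟨a, g x, ?_⟩
      simp)

/-- The functor `L ⊗_A -`. -/
def inductionFunctor : ModuleCat.{u} A ⥤ ModuleCat.{u} L where
  obj M := ModuleCat.of L (Induced f M)
  map g := ModuleCat.ofHom (inducedMap f g.hom)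
  map_id M := by
    refine ModuleCat.hom_ext (LinearMap.ext fun x => ?_)
    obtain ⟨x, rfl⟩ := Submodule.Quotient.mk_surjective _ x
    induction x with
    | zero => simp
    | add x y hx hy => rw [Submodule.Quotient.mk_add, map_add, map_add, hx, hy]
    | tmul l m => rfl
  map_comp g h := by
    refine ModuleCat.hom_ext (LinearMap.ext fun x => ?_)
    obtain ⟨x, rfl⟩ := Submodule.Quotient.mk_surjective _ x
    induction x with
    | zero => simp
    | add x y hx hy => rw [Submodule.Quotient.mk_add, map_add, map_add, hx, hy]
    | tmul l m => rfl

end Induction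

/-- The direct sum of two modules, as a functor. -/
def directSumFunctor (L : Type u) [Ring L] :
    ModuleCat.{u} L × ModuleCat.{u} L ⥤ ModuleCat.{u} L where
  obj M := ModuleCat.of L (M.1 × M.2)
  map g := ModuleCat.ofHom (LinearMap.prodMap g.1.hom g.2.hom)

/-! ### Indecomposable modules -/

/-- A module is indecomposable if it is nonzero and not the direct sum of two nonzero
submodules. -/
def IsIndecomposable {A : Type u} [Ring A] (M : ModuleCat.{u} A) : Prop :=
  Nontrivial M ∧ ∀ N₁ N₂ : Submodule A M, IsCompl N₁ N₂ → N₁ = ⊥ ∨ N₂ = ⊥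

/-! ### Gorenstein projective modules and their stable category -/

section Gorenstein

variable (A : Type u) [Ring A]

/-- A totally acyclic complex of finitely generated projective modules: an acyclic complex `P` of
finitely generated projective modules such that the complex `Hom_A(P, A)` is acyclic as well. -/
structure TotallyAcyclicComplex where
  X : ℤ → ModuleCat.{u} A
  d : ∀ i, X i ⟶ X (i + 1)
  finite : ∀ i, Module.Finite A (X i)
  projective : ∀ i, Module.Projective A (X i)
  exact : ∀ i, Function.Exact (d i) (d (i + 1))
  hom_exact : ∀ i, Function.Exact
    (fun f : X (i + 1 + 1) ⟶ ModuleCat.of A A => d (i + 1) ≫ f)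
    (fun f : X (i + 1) ⟶ ModuleCat.of A A => d i ≫ f)

/-- A module is (finitely generated) Gorenstein projective if it is isomorphic to the kernel of
`d⁰` for some totally acyclic complex of finitely generated projective modules. -/
def isGorensteinProjective : ObjectProperty (ModuleCat.{u} A) := fun M =>
  ∃ P : TotallyAcyclicComplex A, Nonempty (M ≃ₗ[A] LinearMap.ker (P.d 0).hom)

/-- The category `Gproj A` of Gorenstein projective modules. -/
abbrev GProj : Type (u + 1) := (isGorensteinProjective A).FullSubcategory

variable {A}

/-- A morphism factors through a finitely generated projective module. -/
def FactorsThroughProjective {M N : ModuleCat.{u} A} (f : M ⟶ N) : Prop :=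
  ∃ (Q : ModuleCat.{u} A) (g : M ⟶ Q) (h : Q ⟶ N),
    Module.Finite A Q ∧ Module.Projective A Q ∧ f = g ≫ h

namespace FactorsThroughProjective

variable {M N L : ModuleCat.{u} A}

lemma zero : FactorsThroughProjective (0 : M ⟶ N) :=
  ⟨ModuleCat.of A PUnit, 0, 0, inferInstance, inferInstance, by simp⟩

lemma add {f g : M ⟶ N} (hf : FactorsThroughProjective f) (hg : FactorsThroughProjective g) :
    FactorsThroughProjective (f + g) := by
  obtain ⟨Q, a, b, h1, h2, rfl⟩ := hf
  obtain ⟨Q', a', b', h1', h2', rfl⟩ := hg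
  refine ⟨ModuleCat.of A (Q × Q'), ModuleCat.ofHom (LinearMap.prod a.hom a'.hom),
    ModuleCat.ofHom (LinearMap.coprod b.hom b'.hom), inferInstance, inferInstance, ?_⟩
  ext x
  simp

lemma comp_left (e : L ⟶ M) {f : M ⟶ N} (hf : FactorsThroughProjective f) :
    FactorsThroughProjective (e ≫ f) := by
  obtain ⟨Q, a, b, h1, h2, rfl⟩ := hf
  exact ⟨Q, e ≫ a, b, h1, h2, by simp⟩

lemma comp_right {f : M ⟶ N} (hf : FactorsThroughProjective f) (e : N ⟶ L) :
    FactorsThroughProjective (f ≫ e) := by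
  obtain ⟨Q, a, b, h1, h2, rfl⟩ := hf
  exact ⟨Q, a, b ≫ e, h1, h2, by simp⟩

lemma neg {f : M ⟶ N} (hf : FactorsThroughProjective f) : FactorsThroughProjective (-f) := by
  obtain ⟨Q, a, b, h1, h2, rfl⟩ := hf
  exact ⟨Q, a, -b, h1, h2, by simp⟩

lemma smul {K : Type u} [Field K] [Algebra K A] (c : K) {f : M ⟶ N}
    (hf : FactorsThroughProjective f) : FactorsThroughProjective (c • f) := by
  obtain ⟨Q, a, b, h1, h2, rfl⟩ := hf
  exact ⟨Q, a, c • b, h1, h2, by simp⟩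

end FactorsThroughProjective

variable (A)

/-- Two morphisms of Gorenstein projective modules are identified in the stable category if their
difference factors through a finitely generated projective module. -/
def stableRel : HomRel (GProj A) := fun _ _ f g => FactorsThroughProjective (f.hom - g.hom)

instance : Congruence (stableRel A) where
  comp_left f _ _ h := by
    simpa [stableRel] using FactorsThroughProjective.comp_left f.hom h
  comp_right g h := by
    simpa [stableRel] using FactorsThroughProjective.comp_right h g.hom
  equivalence :=
    { refl := fun f => by simpa [stableRel] using FactorsThroughProjective.zero
      symm := fun h => by simpa [stableRel] using FactorsThroughProjective.neg h
      trans := fun h h' => by simpa [stableRel] using FactorsThroughProjective.add h h' }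

/-- The stable category of Gorenstein projective modules. -/
abbrev StableGProj : Type (u + 1) := CategoryTheory.Quotient (stableRel A)

/-- The projection functor to the stable category. -/
abbrev toStable : GProj A ⥤ StableGProj A := Quotient.functor (stableRel A)

instance : Preadditive (StableGProj A) :=
  Quotient.preadditive (stableRel A) (fun _ _ f₁ f₂ g₁ g₂ h h' => by
    have := FactorsThroughProjective.add h h'
    simp only [stableRel] at this ⊢
    convert this using 1
    change f₁.hom + g₁.hom - (f₂.hom + g₂.hom) = _
    abel)

instance : (toStable A).Additive where
  map_add := rfl

instance (K : Type u) [Field K] [Algebra K A] : Linear K (StableGProj A) :=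
  Quotient.linear K (stableRel A) (fun c _ _ f₁ f₂ h => by
    have := FactorsThroughProjective.smul c h
    simp only [stableRel] at this ⊢
    convert this using 1
    change c • f₁.hom - c • f₂.hom = _
    rw [smul_sub])

/-! ### The triangulated structure of the stable category -/

variable {A}

lemma TotallyAcyclicComplex.extend (P : TotallyAcyclicComplex A) (i : ℤ) (Q : ModuleCat.{u} A)
    [Module.Finite A Q] [Module.Projective A Q] (f : LinearMap.ker (P.d i).hom →ₗ[A] Q) :
    ∃ g : P.X i →ₗ[A] Q, ∀ x : LinearMap.ker (P.d i).hom, g x = f x := by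
  obtain ⟨j, rfl⟩ : ∃ j : ℤ, i = j + 1 := ⟨i - 1, by ring⟩
  obtain ⟨k, rfl⟩ : ∃ k : ℤ, j = k + 1 := ⟨j - 1, by ring⟩
  obtain ⟨n, p, hp⟩ := Module.Finite.exists_fin' A Q
  obtain ⟨s, hs⟩ := Module.projective_lifting_property p LinearMap.id hp
  have hmem : ∀ x, (P.d (k + 1)).hom x ∈ LinearMap.ker (P.d (k + 1 + 1)).hom := fun x =>
    (P.exact (k + 1)).apply_apply_eq_zero x
  let c : P.X (k + 1) →ₗ[A] LinearMap.ker (P.d (k + 1 + 1)).hom :=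
    (P.d (k + 1)).hom.codRestrict _ hmem
  have key : ∀ t : Fin n, ∃ g : P.X (k + 1 + 1) ⟶ ModuleCat.of A A,
      P.d (k + 1) ≫ g = ModuleCat.ofHom ((LinearMap.proj t).comp (s.comp (f.comp c))) := by
    intro t
    refine (P.hom_exact k _).1 ?_
    ext x
    have : c ((P.d k).hom x) = 0 := Subtype.ext ((P.exact k).apply_apply_eq_zero x)
    change s (f (c ((P.d k).hom x))) t = 0
    rw [this]
    simp
  choose g hg using key
  refine ⟨p.comp (LinearMap.pi fun t => (g t).hom), ?_⟩
  rintro ⟨x, hx⟩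
  obtain ⟨y, rfl⟩ := (P.exact (k + 1) x).1 hx
  have h1 : (LinearMap.pi fun t => (g t).hom) ((P.d (k + 1)).hom y) = s (f (c y)) := by
    funext t
    exact congrArg (fun h => h.hom y) (hg t)
  change p ((LinearMap.pi fun t => (g t).hom) ((P.d (k + 1)).hom y)) = f (c y)
  rw [h1]
  exact congrArg (fun h => h (f (c y))) hs

/-- A short exact sequence `0 → X → I → T → 0` with `I` finitely generated projective and `T`
Gorenstein projective, such that morphisms from `X` to finitely generated projective modules extend
to `I`. -/
structure CosyzygySequence (X : GProj A) where
  I : ModuleCat.{u} A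
  T : GProj A
  ι : X.obj ⟶ I
  π : I ⟶ T.obj
  finite : Module.Finite A I
  projective : Module.Projective A I
  injective : Function.Injective ι
  exact : Function.Exact ι π
  surjective : Function.Surjective π
  extend : ∀ (Q : ModuleCat.{u} A) (f : X.obj ⟶ Q), Module.Finite A Q → Module.Projective A Q →
    ∃ g : I ⟶ Q, ι ≫ g = f

/-- The totally acyclic complex `P` moved by one place. -/
def TotallyAcyclicComplex.shift (P : TotallyAcyclicComplex A) : TotallyAcyclicComplex A where
  X i := P.X (i + 1)
  d i := P.d (i + 1)
  finite i := P.finite (i + 1)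
  projective i := P.projective (i + 1)
  exact i := P.exact (i + 1)
  hom_exact i := P.hom_exact (i + 1)

lemma exists_cosyzygySequence (X : GProj A) : Nonempty (CosyzygySequence X) := by
  obtain ⟨P, ⟨e⟩⟩ := X.property
  let T : GProj A :=
    ⟨ModuleCat.of A (LinearMap.ker (P.d (0 + 1)).hom), P.shift, ⟨LinearEquiv.refl A _⟩⟩
  have hmem : ∀ x, (P.d 0).hom x ∈ LinearMap.ker (P.d (0 + 1)).hom := fun x =>
    (P.exact 0).apply_apply_eq_zero x
  refine ⟨⟨P.X 0, T, ModuleCat.ofHom ((LinearMap.ker (P.d 0).hom).subtype.comp e.toLinearMap),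
    ModuleCat.ofHom ((P.d 0).hom.codRestrict _ hmem), P.finite 0, P.projective 0, ?_, ?_, ?_, ?_⟩⟩
  · exact Subtype.val_injective.comp e.injective
  · intro y
    constructor
    · intro hy
      have hy' : (P.d 0).hom y = 0 := congrArg Subtype.val hy
      exact ⟨e.symm ⟨y, hy'⟩, by simp⟩
    · rintro ⟨x, rfl⟩
      exact Subtype.ext (e x).2
  · rintro ⟨y, hy⟩
    obtain ⟨x, hx⟩ := (P.exact 0 y).1 hy
    exact ⟨x, Subtype.ext hx⟩
  · intro Q f _ _
    obtain ⟨g, hg⟩ := P.extend 0 Q (f.hom.comp e.symm.toLinearMap)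
    refine ⟨ModuleCat.ofHom g, ?_⟩
    ext x
    exact (hg (e x)).trans (by simp)

/-- A chosen sequence `0 → X → I(X) → T(X) → 0`. -/
def cosyzygy (X : GProj A) : CosyzygySequence X := (exists_cosyzygySequence X).some

namespace CosyzygySequence

variable {X Y Z : GProj A}

/-- `q : T(X) ⟶ T(Y)` is induced by `f : X ⟶ Y`, i.e. there is a commutative diagram
from `X → I(X) → T(X)` to `Y → I(Y) → T(Y)` with vertical maps `f`, some `p`, and `q`. -/
def Induces (S : CosyzygySequence X) (S' : CosyzygySequence Y) (f : X ⟶ Y) (q : S.T ⟶ S'.T) :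
    Prop :=
  ∃ p : S.I ⟶ S'.I, S.ι ≫ p = f.hom ≫ S'.ι ∧ S.π ≫ q.hom = p ≫ S'.π

lemma ι_π (S : CosyzygySequence X) : S.ι ≫ S.π = 0 := by
  ext x
  exact S.exact.apply_apply_eq_zero x

lemma descend (S : CosyzygySequence X) {N : ModuleCat.{u} A} (p : S.I ⟶ N) (h : S.ι ≫ p = 0) :
    ∃ q : S.T.obj ⟶ N, S.π ≫ q = p := by
  have hk : LinearMap.ker S.π.hom ≤ LinearMap.ker p.hom := by
    intro x hx
    obtain ⟨y, rfl⟩ := (S.exact x).1 hx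
    exact congrArg (fun f => f.hom y) h
  let e := LinearMap.quotKerEquivOfSurjective S.π.hom S.surjective
  refine ⟨ModuleCat.ofHom (((LinearMap.ker S.π.hom).liftQ p.hom hk).comp e.symm.toLinearMap), ?_⟩
  ext x
  have : e.symm (S.π.hom x) = Submodule.Quotient.mk x := by
    rw [LinearEquiv.symm_apply_eq]
    rfl
  change (LinearMap.ker S.π.hom).liftQ p.hom hk (e.symm (S.π.hom x)) = _
  rw [this]
  rfl

lemma exists_induces (S : CosyzygySequence X) (S' : CosyzygySequence Y) (f : X ⟶ Y) :
    ∃ q, Induces S S' f q := by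
  obtain ⟨p, hp⟩ := S.extend S'.I (f.hom ≫ S'.ι) S'.finite S'.projective
  obtain ⟨q, hq⟩ := S.descend (p ≫ S'.π) (by
    rw [← Category.assoc, hp, Category.assoc, ι_π, Limits.comp_zero])
  exact ⟨ObjectProperty.homMk q, p, hp, hq⟩

lemma Induces.stable_eq {S : CosyzygySequence X} {S' : CosyzygySequence Y} {f f' : X ⟶ Y}
    {q q' : S.T ⟶ S'.T} (h : Induces S S' f q) (h' : Induces S S' f' q')
    (hf : stableRel A f f') : (toStable A).map q = (toStable A).map q' := by
  obtain ⟨p, hp, hq⟩ := h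
  obtain ⟨p', hp', hq'⟩ := h'
  obtain ⟨Q, a, b, h1, h2, hab⟩ := hf
  obtain ⟨g, hg⟩ := S.extend Q a h1 h2
  obtain ⟨k, hk⟩ := S.descend (p - p' - g ≫ b ≫ S'.ι) (by
    rw [Preadditive.comp_sub, Preadditive.comp_sub, hp, hp', ← Category.assoc, hg,
      ← Category.assoc, ← hab, Preadditive.sub_comp, sub_self])
  rw [Quotient.functor_map_eq_iff]
  refine ⟨S'.I, k, S'.π, S'.finite, S'.projective, ?_⟩
  have hepi : Epi S.π := (ModuleCat.epi_iff_surjective _).2 S.surjective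
  rw [← cancel_epi S.π, Preadditive.comp_sub, hq, hq', ← Category.assoc, hk]
  simp only [Preadditive.sub_comp, Category.assoc, ι_π, Limits.comp_zero, sub_zero]

lemma Induces.id (S : CosyzygySequence X) : Induces S S (𝟙 X) (𝟙 S.T) :=
  ⟨𝟙 _, by simp, by simp⟩

lemma Induces.comp {S : CosyzygySequence X} {S' : CosyzygySequence Y} {S'' : CosyzygySequence Z}
    {f : X ⟶ Y} {g : Y ⟶ Z} {q : S.T ⟶ S'.T} {r : S'.T ⟶ S''.T} (h : Induces S S' f q)
    (h' : Induces S' S'' g r) : Induces S S'' (f ≫ g) (q ≫ r) := by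
  obtain ⟨p, hp, hq⟩ := h
  obtain ⟨p', hp', hq'⟩ := h'
  refine ⟨p ≫ p', ?_, ?_⟩
  · rw [← Category.assoc, hp, Category.assoc, hp', ← Category.assoc]
    simp
  · change S.π ≫ (q.hom ≫ r.hom) = _
    rw [← Category.assoc, hq, Category.assoc, hq', Category.assoc]

end CosyzygySequence

open CosyzygySequence

/-- A chosen morphism `T(X) ⟶ T(Y)` induced by `f : X ⟶ Y`. -/
def cosyzygyMap {X Y : GProj A} (f : X ⟶ Y) : (cosyzygy X).T ⟶ (cosyzygy Y).T :=
  (exists_induces (cosyzygy X) (cosyzygy Y) f).choose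

lemma cosyzygyMap_induces {X Y : GProj A} (f : X ⟶ Y) :
    Induces (cosyzygy X) (cosyzygy Y) f (cosyzygyMap f) :=
  (exists_induces (cosyzygy X) (cosyzygy Y) f).choose_spec

variable (A)

/-- The suspension functor of the stable category: `X ↦ T(X)`. -/
def suspension : StableGProj A ⥤ StableGProj A :=
  CategoryTheory.Quotient.lift (stableRel A)
    { obj := fun X => (toStable A).obj (cosyzygy X).T
      map := fun f => (toStable A).map (cosyzygyMap f)
      map_id := fun X => by
        rw [← (toStable A).map_id]
        exact (cosyzygyMap_induces (𝟙 X)).stable_eq (Induces.id _)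
          (Congruence.equivalence.refl _)
      map_comp := fun f g => by
        rw [← (toStable A).map_comp]
        exact (cosyzygyMap_induces (f ≫ g)).stable_eq
          ((cosyzygyMap_induces f).comp (cosyzygyMap_induces g))
          (Congruence.equivalence.refl _) }
    (fun _ _ f g h => (cosyzygyMap_induces f).stable_eq (cosyzygyMap_induces g) h)

variable {A}

/-- The distinguished triangles `X ⟶ Y ⟶ Z ⟶ ΣX` of the stable category: those isomorphic to the
triangle of a short exact sequence `0 → X' → Y' → Z' → 0` of Gorenstein projective modules.  The
latter is given by the classes of `f : X' ⟶ Y'`, `g : Y' ⟶ Z'` and `-q`, where `q : Z' ⟶ T(X')`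
is the last component of a morphism `(1, p, q)` from this sequence
to `0 → X' → I(X') → T(X') → 0`. -/
def IsDistinguished {X Y Z : StableGProj A} (u : X ⟶ Y) (v : Y ⟶ Z)
    (w : Z ⟶ (suspension A).obj X) : Prop :=
  ∃ (X' Y' Z' : GProj A) (f : X' ⟶ Y') (g : Y' ⟶ Z') (p : Y'.obj ⟶ (cosyzygy X').I)
    (q : Z' ⟶ (cosyzygy X').T)
    (eX : X ≅ (toStable A).obj X') (eY : Y ≅ (toStable A).obj Y') (eZ : Z ≅ (toStable A).obj Z'),
    Function.Injective f.hom ∧ Function.Exact f.hom g.hom ∧ Function.Surjective g.hom ∧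
    f.hom ≫ p = (cosyzygy X').ι ∧ g.hom ≫ q.hom = p ≫ (cosyzygy X').π ∧
    u ≫ eY.hom = eX.hom ≫ (toStable A).map f ∧
    v ≫ eZ.hom = eY.hom ≫ (toStable A).map g ∧
    w ≫ (suspension A).map eX.hom = eZ.hom ≫ (toStable A).map (-q)

end Gorenstein

/-! ### Triangle equivalences from a product of two stable categories -/

section TriangleEquivalence

variable {A B L : Type u} [Ring A] [Ring B] [Ring L]

/-- The functor `F` from the product of the stable categories of `A` and `B` to that of `L` is a
triangle functor: it commutes with the suspensions up to a natural isomorphism `θ` and, by means of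
`θ`, maps distinguished triangles to distinguished triangles.  The suspension and the distinguished
triangles of the product are taken componentwise. -/
def IsTriangleFunctor (F : StableGProj A × StableGProj B ⥤ StableGProj L) : Prop :=
  ∃ θ : (suspension A).prod (suspension B) ⋙ F ≅ F ⋙ suspension L,
    ∀ ⦃X Y Z : StableGProj A⦄ (u : X ⟶ Y) (v : Y ⟶ Z) (w : Z ⟶ (suspension A).obj X)
      ⦃X' Y' Z' : StableGProj B⦄ (u' : X' ⟶ Y') (v' : Y' ⟶ Z') (w' : Z' ⟶ (suspension B).obj X'),
      IsDistinguished u v w → IsDistinguished u' v' w' →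
      IsDistinguished (F.map (X := (X, X')) (Y := (Y, Y')) (u, u'))
        (F.map (X := (Y, Y')) (Y := (Z, Z')) (v, v'))
        (F.map (X := (Z, Z')) (Y := ((suspension A).obj X, (suspension B).obj X')) (w, w') ≫
          θ.hom.app (X, X'))

/-- The functor `F` from the product of the stable categories of `A` and `B` to that of `L` is
`K`-linear (on the product, addition and scalar multiplication are componentwise). -/
def IsLinearFunctor (K : Type u) [Field K] [Algebra K A] [Algebra K B] [Algebra K L]
    (F : StableGProj A × StableGProj B ⥤ StableGProj L) : Prop :=
  ∀ ⦃X Y : StableGProj A⦄ ⦃X' Y' : StableGProj B⦄ (c : K) (f g : X ⟶ Y) (f' g' : X' ⟶ Y'),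
    F.map (X := (X, X')) (Y := (Y, Y')) (c • f + g, c • f' + g') =
      c • F.map (X := (X, X')) (Y := (Y, Y')) (f, f') +
        F.map (X := (X, X')) (Y := (Y, Y')) (g, g')

end TriangleEquivalence

/-! ### The functors `i_λ` and `j_λ` -/

section Functors

variable {K : Type u} [Field K] {VA VB : Type u} [Quiver.{u} VA] [Quiver.{u} VB]
  [Finite VA] [Finite VB] (a : VA) (b : VB)
  (IA : TwoSidedIdeal (PathAlgebra K VA)) (IB : TwoSidedIdeal (PathAlgebra K VB))

/-- The functor `i_λ = Λ ⊗_A -`. -/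
def iLambda : ModuleCat.{u} (QuiverAlgebra IA) ⥤ ModuleCat.{u} (GluingAlgebra a b IA IB) :=
  inductionFunctor (leftHom a b IA IB : QuiverAlgebra IA →ₙ+* GluingAlgebra a b IA IB)

/-- The functor `j_λ = Λ ⊗_B -`. -/
def jLambda : ModuleCat.{u} (QuiverAlgebra IB) ⥤ ModuleCat.{u} (GluingAlgebra a b IA IB) :=
  inductionFunctor (rightHom a b IA IB : QuiverAlgebra IB →ₙ+* GluingAlgebra a b IA IB)

/-- The functor `(X, Y) ↦ i_λ(X) ⊕ j_λ(Y)` on pairs of Gorenstein projective modules. -/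
def glueFunctor : GProj (QuiverAlgebra IA) × GProj (QuiverAlgebra IB) ⥤
    ModuleCat.{u} (GluingAlgebra a b IA IB) :=
  ((isGorensteinProjective _).ι ⋙ iLambda a b IA IB).prod
    ((isGorensteinProjective _).ι ⋙ jLambda a b IA IB) ⋙ directSumFunctor _

end Functors

end SimpleGluing

end

open SimpleGluing

/-!
Let `f : A → Λ` and `g : B → Λ` be the two canonical maps, let `e` be the idempotent of the common
vertex, and write `i X = Λ ⊗_A X`, `j Y = Λ ⊗_B Y`.  The right adjoint of `i` is the exact functor
`Z ↦ f(1) Z` (`Corner`), and similarly for `j`.  All that is used of path algebras is contained in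
`IsGluing`: the algebra `Λ` is universal for pairs of homomorphisms which agree at the glued vertex,
and the glued vertices have characters `χA`, `χB` (`isGluing`, `QuiverAlgebra.exists_character`).

*Normal form.*  By the universal property, `Λ` acts on `X ⊕ W ⊗ aX`, where `W` is the left ideal of
`Λ` generated by the kernel of `χB` on `B b`, and this `Λ`-module is `i X` (`retr`, `word`,
`of_retr_add_word`).  Hence `i` is exact (`map_exact`).  When `Λ` is finite-dimensional, one of the
kernels of the characters on `a A a` and `b B b` vanishes (`eq_zero_or_eq_zero`): for nonzero `x`, `y`
in them, right multiplication by `f(x) g(y)` on `W` would be injective, but not surjective.  The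
normal form then shows that the unit `X → f(1) (i X)` is split with projective cokernel, that
`f(1) (j Y)` is always projective (`cornerProdEquiv`, `cornerEquiv`), and that `f(1) Q` is
projective whenever `Q` is (`projective_corner`).

*Mayer–Vietoris.*  For each `Λ`-module `Z` there is an exact sequence
`0 → Λ e ⊗_K e Z → i (f(1) Z) ⊕ j (g(1) Z) → Z → 0` whose first term is projective
(`mvLeft_injective`, `mv_exact`, `mvRight_surjective`).

*Gorenstein projectives.*  A class of modules closed under cosyzygies in both directions consists
of Gorenstein projective modules (`isGorensteinProjective_of_closed`).  As right adjoints preserve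
projectives, `i` and `j` preserve cosyzygy sequences (`glueCosyzygy`).  So does `f(1)`
(`cornerCosyzygy`): by the Mayer–Vietoris sequence, `i (f(1) Z)` inherits from `Z` the vanishing of
extensions by projectives.

*Equivalence.*  The functor on the stable categories is faithful and full because of the shape of
`f(1) (i X)` and `f(1) (j Y)`, and dense because the Mayer–Vietoris sequence of a Gorenstein
projective module splits (`stableGlue_isEquivalence`).  Glued cosyzygy sequences are cosyzygy
sequences, which gives the compatibility with the suspensions and with the triangles
(`stableGlue_isTriangle`).

*Indecomposables.*  An indecomposable Gorenstein projective `Z` is a direct summand of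
`i (f(1) Z) ⊕ j (g(1) Z)`, hence of some `i X` or `j Y` with `X` or `Y` indecomposable.  Restriction
of endomorphisms along `X → i X → X` is a ring homomorphism whose kernel consists of nilpotent
elements, because the kernels of the characters are nilpotent on the corners; so `i X` is
indecomposable and equals `Z` (`bijective_of_isRetract`).
-/

namespace SimpleGluing

/-! ### Induction along a non-unital homomorphism and its right adjoint -/

section InducedCorner

variable {A L : Type u} [Ring A] [Ring L] (f : A →ₙ+* L)
variable {X Y Z : Type u} [AddCommGroup X] [Module A X] [AddCommGroup Y] [Module A Y]
  [AddCommGroup Z] [Module A Z]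
variable {M N : Type u} [AddCommGroup M] [Module L M] [AddCommGroup N] [Module L N]

namespace Induced

/-- The unit `x ↦ 1 ⊗ x` of the induction `L ⊗_A X`. -/
noncomputable def of : X →+ Induced f X where
  toFun x := Submodule.Quotient.mk ((1 : L) ⊗ₜ[ℤ] x)
  map_zero' := by simp
  map_add' x y := by rw [TensorProduct.tmul_add, Submodule.Quotient.mk_add]

lemma map_smul_of (r : A) (x : X) : f r • of f x = of f (r • x) := by
  change Submodule.Quotient.mk _ = Submodule.Quotient.mk _
  rw [Submodule.Quotient.eq]
  refine Submodule.subset_span ⟨r, x, ?_⟩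
  simp [TensorProduct.smul_tmul']

lemma map_one_smul_of (x : X) : f 1 • of f x = of f x := by
  rw [map_smul_of, one_smul]

lemma induction {p : Induced f X → Prop} (u : Induced f X) (zero : p 0)
    (smul_of : ∀ (l : L) (x : X), p (l • of f x)) (add : ∀ u v, p u → p v → p (u + v)) :
    p u := by
  obtain ⟨t, rfl⟩ := Submodule.Quotient.mk_surjective _ u
  induction t with
  | zero => exact zero
  | add x y hx hy => exact add _ _ hx hy
  | tmul l x =>
    have : l • of f x = Submodule.Quotient.mk (l ⊗ₜ[ℤ] x) := by
      change Submodule.Quotient.mk (l • ((1 : L) ⊗ₜ[ℤ] x)) = Submodule.Quotient.mk _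
      rw [TensorProduct.smul_tmul', smul_eq_mul, mul_one]
    rw [← this]
    exact smul_of l x

variable {f}

lemma hom_ext {F G : Induced f X →ₗ[L] M} (h : ∀ x, F (of f x) = G (of f x)) : F = G := by
  refine LinearMap.ext fun u => ?_
  induction u using induction f with
  | zero => simp
  | smul_of l x => rw [map_smul, map_smul, h]
  | add u v hu hv => rw [map_add, map_add, hu, hv]

variable (f)

/-- The `L`-linear map on `L ⊗_A X` given by an additive map on `X` which is semilinear
along `f`. -/
noncomputable def lift (h : X →+ M) (hh : ∀ (r : A) (x : X), h (r • x) = f r • h x) :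
    Induced f X →ₗ[L] M :=
  Submodule.liftQ _ (TensorProduct.AlgebraTensorModule.lift
    (LinearMap.toSpanSingleton L (X →ₗ[ℤ] M) h.toIntLinearMap)) (by
      rw [inductionRel, Submodule.span_le]
      rintro _ ⟨r, x, rfl⟩
      simp [hh])

@[simp]
lemma lift_of (h : X →+ M) (hh : ∀ (r : A) (x : X), h (r • x) = f r • h x) (x : X) :
    lift f h hh (of f x) = h x := by
  change Submodule.liftQ _ _ _ (Submodule.Quotient.mk _) = _
  simp

lemma inducedMap_of (g : X →ₗ[A] Y) (x : X) : inducedMap f g (of f x) = of f (g x) := rfl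

lemma span_of_image {S : Set X} (hS : Submodule.span A S = ⊤) :
    Submodule.span L (of f '' S) = ⊤ := by
  have h1 : ∀ x : X, of f x ∈ Submodule.span L (of f '' S) := by
    intro x
    have hx : x ∈ Submodule.span A S := hS ▸ Submodule.mem_top
    induction hx using Submodule.span_induction with
    | mem x hx => exact Submodule.subset_span ⟨x, hx, rfl⟩
    | zero => rw [map_zero]; exact zero_mem _
    | add x y _ _ hx hy => rw [map_add]; exact add_mem hx hy
    | smul r x _ hx => rw [← map_smul_of]; exact Submodule.smul_mem _ _ hx
  refine (Submodule.eq_top_iff').2 fun u => ?_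
  induction u using induction f with
  | zero => exact zero_mem _
  | smul_of l x => exact Submodule.smul_mem _ _ (h1 x)
  | add u v hu hv => exact add_mem hu hv

instance finite [Module.Finite A X] : Module.Finite L (Induced f X) := by
  classical
  obtain ⟨S, hS⟩ := (Module.finite_def (R := A) (M := X)).1 inferInstance
  refine Module.finite_def.2 ⟨S.image (of f), ?_⟩
  rw [Finset.coe_image]
  exact span_of_image f hS

lemma map_surjective {g : X →ₗ[A] Y} (hg : Function.Surjective g) :
    Function.Surjective (inducedMap f g) := by
  intro u
  induction u using induction f with
  | zero => exact ⟨0, map_zero _⟩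
  | smul_of l x =>
    obtain ⟨x, rfl⟩ := hg x
    exact ⟨l • of f x, by rw [map_smul, inducedMap_of]⟩
  | add u v hu hv =>
    obtain ⟨u, rfl⟩ := hu
    obtain ⟨v, rfl⟩ := hv
    exact ⟨u + v, map_add _ _ _⟩

lemma map_comp (h : Y →ₗ[A] Z) (g : X →ₗ[A] Y) :
    inducedMap f (h ∘ₗ g) = inducedMap f h ∘ₗ inducedMap f g :=
  hom_ext fun _ => rfl

lemma map_id : inducedMap f (LinearMap.id : X →ₗ[A] X) = LinearMap.id :=
  hom_ext fun _ => rfl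

lemma map_add (g h : X →ₗ[A] Y) : inducedMap f (g + h) = inducedMap f g + inducedMap f h :=
  hom_ext fun x => by
    rw [inducedMap_of, LinearMap.add_apply, _root_.map_add, LinearMap.add_apply, inducedMap_of,
      inducedMap_of]

end Induced

/-- The additive subgroup of the elements of an `L`-module fixed by `f(1)`. -/
def cornerSubgroup (M : Type u) [AddCommGroup M] [Module L M] : AddSubgroup M :=
  (DistribSMul.toAddMonoidHom M (f 1)).eqLocus (AddMonoidHom.id M)

/-- The `A`-module `f(1) M` for an `L`-module `M`, the right adjoint of induction. -/
def Corner (M : Type u) [AddCommGroup M] [Module L M] : Type u :=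
  cornerSubgroup f M

namespace Corner

instance : AddCommGroup (Corner f M) := inferInstanceAs (AddCommGroup (cornerSubgroup f M))

variable {f}

/-- The inclusion of `f(1) M` in `M`. -/
def val : Corner f M →+ M := (cornerSubgroup f M).subtype

lemma val_injective : Function.Injective (val : Corner f M → M) := Subtype.val_injective

@[ext]
lemma ext {x y : Corner f M} (h : val x = val y) : x = y := val_injective h

@[simp]
lemma one_smul_val (x : Corner f M) : f 1 • val x = val x := x.2

variable (f) in
/-- The element of `f(1) M` given by an element of `M` fixed by `f(1)`. -/
def mk (x : M) (hx : f 1 • x = x) : Corner f M := ⟨x, hx⟩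

@[simp]
lemma val_mk (x : M) (hx : f 1 • x = x) : val (mk f x hx) = x := rfl

instance : SMul A (Corner f M) :=
  ⟨fun r x => mk f (f r • val x) (by rw [smul_smul, ← map_mul, one_mul])⟩

@[simp]
lemma val_smul (r : A) (x : Corner f M) : val (r • x) = f r • val x := rfl

instance : Module A (Corner f M) where
  one_smul x := ext (one_smul_val x)
  mul_smul r s x := ext (by simp [mul_smul])
  smul_zero r := ext (by simp)
  smul_add r x y := ext (by simp)
  add_smul r s x := ext (by simp [add_smul])
  zero_smul x := ext (by simp)

variable (f)

/-- The `A`-linear map `f(1) M → f(1) N` given by an `L`-linear map. -/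
def map (h : M →ₗ[L] N) : Corner f M →ₗ[A] Corner f N where
  toFun x := mk f (h (val x)) (by rw [← map_smul, one_smul_val])
  map_add' x y := ext (by simp)
  map_smul' r x := ext (by simp)

@[simp]
lemma val_map (h : M →ₗ[L] N) (x : Corner f M) : val (map f h x) = h (val x) := rfl

lemma map_surjective {h : M →ₗ[L] N} (hh : Function.Surjective h) :
    Function.Surjective (map f h) := by
  intro y
  obtain ⟨x, hx⟩ := hh (val y)
  have h1 : f 1 * f 1 = f 1 := by rw [← map_mul, one_mul]
  exact ⟨mk f (f 1 • x) (by rw [smul_smul, h1]), ext (by simp [hx])⟩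

lemma map_injective {h : M →ₗ[L] N} (hh : Function.Injective h) :
    Function.Injective (map f h) :=
  fun _ _ hxy => ext (hh (congrArg val hxy))

lemma map_exact {P : Type u} [AddCommGroup P] [Module L P] {h : M →ₗ[L] N} {k : N →ₗ[L] P}
    (hk : Function.Exact h k) : Function.Exact (map f h) (map f k) := by
  intro y
  constructor
  · intro hy
    obtain ⟨x, hx⟩ := (hk (val y)).1 (by simpa using congrArg val hy)
    have h1 : f 1 * f 1 = f 1 := by rw [← map_mul, one_mul]
    exact ⟨mk f (f 1 • x) (by rw [smul_smul, h1]), ext (by simp [hx])⟩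
  · rintro ⟨x, rfl⟩
    exact ext (by simpa using hk.apply_apply_eq_zero (val x))

variable (X) in
/-- The unit of the adjunction between induction and corners. -/
noncomputable def unit : X →ₗ[A] Corner f (Induced f X) where
  toFun x := mk f (Induced.of f x) (Induced.map_one_smul_of f x)
  map_add' x y := ext (by simp)
  map_smul' r x := ext (by simp [Induced.map_smul_of])

@[simp]
lemma val_unit (x : X) : val (unit f X x) = Induced.of f x := rfl

end Corner

namespace Induced

/-- The `L`-linear map adjoint to an `A`-linear map `X → f(1) M`. -/
noncomputable def adj (h : X →ₗ[A] Corner f M) : Induced f X →ₗ[L] M :=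
  lift f (Corner.val.comp h.toAddMonoidHom) (fun r x => by simp)

@[simp]
lemma adj_of (h : X →ₗ[A] Corner f M) (x : X) : adj f h (of f x) = Corner.val (h x) :=
  lift_of _ _ _ _

/-- Induction preserves projective modules, since its right adjoint preserves surjections. -/
instance projective [Module.Projective A X] : Module.Projective L (Induced f X) := by
  refine Module.Projective.of_lifting_property'' fun p hp => ?_
  obtain ⟨h, hh⟩ := Module.projective_lifting_property (Corner.map f p) (Corner.unit f X)
    (Corner.map_surjective f hp)
  refine ⟨adj f h, hom_ext fun x => ?_⟩
  have := congrArg Corner.val (LinearMap.congr_fun hh x)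
  simpa using this

end Induced

end InducedCorner

end SimpleGluing

namespace SimpleGluing

/-! ### Simple gluings of augmented algebras -/

section Gluing

variable {K : Type u} [Field K] {A B L : Type u} [Ring A] [Algebra K A] [Ring B] [Algebra K B]
  [Ring L] [Algebra K L]

/-- The algebra `L` is the simple gluing of `A` and `B` along the idempotents `a` and `b`: it is
the universal algebra with non-unital homomorphisms `f : A → L` and `g : B → L` such that
`f a = g b = e`, `f(1) g(1) = g(1) f(1) = e` and `f(1) + g(1) = 1 + e`.  The characters `χA` and
`χB` with `χA a = 1` and `χB b = 1` are part of the data; for quiver algebras they are given by the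
simple modules at the vertices `a` and `b`. -/
structure IsGluing (f : A →ₙ+* L) (g : B →ₙ+* L) (a : A) (b : B) (e : L)
    (χA : A →ₐ[K] K) (χB : B →ₐ[K] K) : Prop where
  map_smul_left : ∀ (c : K) (x : A), f (c • x) = c • f x
  map_smul_right : ∀ (c : K) (x : B), g (c • x) = c • g x
  idem_left : a * a = a
  idem_right : b * b = b
  char_left : χA a = 1
  char_right : χB b = 1
  map_left : f a = e
  map_right : g b = e
  mul_left : f 1 * g 1 = e
  mul_right : g 1 * f 1 = e
  add_one : f 1 + g 1 = 1 + e
  adjoin : Algebra.adjoin K (Set.range f ∪ Set.range g) = ⊤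
  exists_lift : ∀ (E : Type u) [Ring E] [Algebra K E] (φ : A →ₙₐ[K] E) (ψ : B →ₙₐ[K] E),
    φ a = ψ b → φ 1 * ψ 1 = φ a → ψ 1 * φ 1 = φ a → φ 1 + ψ 1 = 1 + φ a →
      ∃ ρ : L →ₐ[K] E, (∀ x, ρ (f x) = φ x) ∧ ∀ x, ρ (g x) = ψ x

variable (K) in
/-- The subspace `a X` of an `A`-module `X`, for an idempotent `a`. -/
def fixedBy (a : A) (X : Type u) [AddCommGroup X] [Module K X] [Module A X]
    [IsScalarTower K A X] : Submodule K X :=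
  LinearMap.eqLocus (Algebra.lsmul K K X a) LinearMap.id

lemma mem_fixedBy {a : A} {X : Type u} [AddCommGroup X] [Module K X] [Module A X]
    [IsScalarTower K A X] {x : X} : x ∈ fixedBy K a X ↔ a • x = x := Iff.rfl

/-- The projection `x ↦ a x` of `X` onto `a X`, for an idempotent `a`. -/
def toFixedBy {a : A} (ha : a * a = a) (X : Type u) [AddCommGroup X] [Module K X] [Module A X]
    [IsScalarTower K A X] : X →ₗ[K] fixedBy K a X :=
  (Algebra.lsmul K K X a).codRestrict _ fun x => by
    rw [mem_fixedBy, Algebra.lsmul_coe, smul_smul, ha]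

@[simp]
lemma coe_toFixedBy {a : A} (ha : a * a = a) {X : Type u} [AddCommGroup X] [Module K X]
    [Module A X] [IsScalarTower K A X] (x : X) : (toFixedBy (K := K) ha X x : X) = a • x := rfl

/-- The map `a X → a Y` given by an `A`-linear map. -/
def fixedByMap {a : A} {X Y : Type u} [AddCommGroup X] [Module K X] [Module A X]
    [IsScalarTower K A X] [AddCommGroup Y] [Module K Y] [Module A Y] [IsScalarTower K A Y]
    (h : X →ₗ[A] Y) : fixedBy K a X →ₗ[K] fixedBy K a Y :=
  (h.restrictScalars K).restrict fun x hx => by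
    rw [mem_fixedBy] at hx ⊢
    rw [LinearMap.restrictScalars_apply, ← map_smul, hx]

@[simp]
lemma coe_fixedByMap {a : A} {X Y : Type u} [AddCommGroup X] [Module K X] [Module A X]
    [IsScalarTower K A X] [AddCommGroup Y] [Module K Y] [Module A Y] [IsScalarTower K A Y]
    (h : X →ₗ[A] Y) (x : fixedBy K a X) : (fixedByMap h x : Y) = h x := rfl

/-- The kernel of the character `χ` on the left ideal `A a`. -/
def charKer (a : A) (χ : A →ₐ[K] K) : Submodule K A :=
  LinearMap.eqLocus (LinearMap.mulRight K a) LinearMap.id ⊓ LinearMap.ker χ.toLinearMap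

lemma mem_charKer {a : A} {χ : A →ₐ[K] K} {x : A} : x ∈ charKer a χ ↔ x * a = x ∧ χ x = 0 :=
  Iff.rfl

/-- The kernel of the character `χ` on the algebra `a A a`. -/
def localCharKer (a : A) (χ : A →ₐ[K] K) : Submodule K A :=
  fixedBy K a A ⊓ charKer a χ

lemma mem_localCharKer {a : A} {χ : A →ₐ[K] K} {x : A} :
    x ∈ localCharKer a χ ↔ a * x = x ∧ x * a = x ∧ χ x = 0 :=
  Iff.rfl

/-- The left ideal of `L` generated by the image of the kernel of `χ` on `B b`.  If `L` is the
gluing of `A` and `B`, then this is spanned by the alternating products of elements of `A` and `B`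
whose last factor is in the kernel of `χ` on `B b`. -/
def charIdeal (g : B →ₙ+* L) (b : B) (χ : B →ₐ[K] K) : Submodule L L :=
  Submodule.span L (g '' charKer b χ)

/-- The projection `B → ker χ ∩ B b` along the span of `b` and `B (1 - b)`. -/
def toCharKer {b : B} (hb : b * b = b) {χ : B →ₐ[K] K} (hχ : χ b = 1) : B →ₗ[K] charKer b χ :=
  LinearMap.codRestrict _ (LinearMap.mulRight K b - χ.toLinearMap.smulRight b) fun x => by
    rw [mem_charKer]
    simp [sub_mul, mul_assoc, hb, hχ]

namespace IsGluing

variable {f : A →ₙ+* L} {g : B →ₙ+* L} {a : A} {b : B} {e : L} {χA : A →ₐ[K] K} {χB : B →ₐ[K] K}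

lemma symm (H : IsGluing f g a b e χA χB) : IsGluing g f b a e χB χA where
  map_smul_left := H.map_smul_right
  map_smul_right := H.map_smul_left
  idem_left := H.idem_right
  idem_right := H.idem_left
  char_left := H.char_right
  char_right := H.char_left
  map_left := H.map_right
  map_right := H.map_left
  mul_left := H.mul_right
  mul_right := H.mul_left
  add_one := by rw [add_comm]; exact H.add_one
  adjoin := by rw [Set.union_comm]; exact H.adjoin
  exists_lift := fun E _ _ φ ψ h1 h2 h3 h4 => by
    obtain ⟨ρ, h5, h6⟩ := H.exists_lift E ψ φ h1.symm (h3.trans h1) (h2.trans h1)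
      (by rw [add_comm, h4, h1])
    exact ⟨ρ, h6, h5⟩

variable (H : IsGluing f g a b e χA χB)
include H

/-- Every element of a gluing is a sum of products of elements of the images of the two
algebras. -/
lemma induction {p : L → Prop} (left : ∀ x, p (f x)) (right : ∀ x, p (g x))
    (add : ∀ x y, p x → p y → p (x + y)) (mul : ∀ x y, p x → p y → p (x * y)) (l : L) : p l := by
  have hl : l ∈ Algebra.adjoin K (Set.range f ∪ Set.range g) := H.adjoin ▸ Algebra.mem_top
  induction hl using Algebra.adjoin_induction with
  | mem x hx =>
    obtain ⟨x, rfl⟩ | ⟨x, rfl⟩ := hx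
    · exact left x
    · exact right x
  | algebraMap c =>
    have : algebraMap K L c = f (c • (1 - a)) + g (c • 1) := by
      rw [H.map_smul_left, H.map_smul_right, ← smul_add, map_sub, H.map_left,
        Algebra.algebraMap_eq_smul_one, eq_sub_of_add_eq H.add_one.symm]
      congr 1
      abel
    rw [this]
    exact add _ _ (left _) (right _)
  | add x y _ _ hx hy => exact add _ _ hx hy
  | mul x y _ _ hx hy => exact mul _ _ hx hy

lemma map_mul_e (x : A) : f x * e = f (x * a) := by rw [map_mul, H.map_left]

lemma e_mul_map (x : A) : e * f x = f (a * x) := by rw [map_mul, H.map_left]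

lemma e_mul_e : e * e = e := by rw [← H.map_left, ← map_mul, H.idem_left]

/-- The product of elements of `A` and `B` passes through the common idempotent. -/
lemma map_mul_map (x : A) (y : B) : f x * g y = f (x * a) * g (b * y) := by
  rw [map_mul, map_mul, mul_assoc, H.map_left, H.map_right, ← mul_assoc e, H.e_mul_e,
    ← H.mul_left, ← mul_assoc, ← mul_assoc, ← map_mul, mul_one, mul_assoc, ← map_mul, one_mul]

/-- The underlying type of the module `X ⊕ W ⊗ aX`, where `W` is the left ideal `charIdeal`. -/
@[nolint unusedArguments]
def Extension (_ : IsGluing f g a b e χA χB) (X : Type u) [AddCommGroup X] [Module K X]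
    [Module A X] [IsScalarTower K A X] : Type u :=
  X × (charIdeal g b χB ⊗[K] fixedBy K a X)

section Extension

variable (X : Type u) [AddCommGroup X] [Module K X] [Module A X] [IsScalarTower K A X]

omit H in
instance (H : IsGluing f g a b e χA χB) : AddCommGroup (H.Extension X) :=
  inferInstanceAs (AddCommGroup (X × (charIdeal g b χB ⊗[K] fixedBy K a X)))

/-- The `K`-linear map `B → W` given by the projection `B → ker χ ∩ B b`. -/
def toCharIdeal : B →ₗ[K] charIdeal g b χB where
  toFun x := ⟨g (toCharKer H.idem_right H.char_right x),
    Submodule.subset_span ⟨_, SetLike.coe_mem _, rfl⟩⟩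
  map_add' x y := Subtype.ext
    ((congrArg (fun z : charKer b χB => g z) (map_add _ x y)).trans (map_add g _ _))
  map_smul' c x := Subtype.ext
    ((congrArg (fun z : charKer b χB => g z) (map_smul _ c x)).trans (H.map_smul_right _ _))

lemma coe_toCharIdeal (x : B) : (H.toCharIdeal x : L) = g (x * b) - χB x • e :=
  (map_sub g (x * b) (χB x • b)).trans (by rw [H.map_smul_right, H.map_right])

/-- The action of `A` on `X ⊕ W ⊗ aX`. -/
def actLeft : A →ₙₐ[K] Module.End K (X × (charIdeal g b χB ⊗[K] fixedBy K a X)) where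
  toFun x := LinearMap.prodMap (Algebra.lsmul K K X x) (Algebra.lsmul K K _ (f x))
  map_zero' := by ext <;> simp
  map_add' x y := LinearMap.ext fun v => by simp
  map_mul' x y := LinearMap.ext fun v => by simp
  map_smul' c x := LinearMap.ext fun v => by simp [H.map_smul_left]

/-- The action of an element of `B` on `X ⊕ W ⊗ aX`. -/
def actRightMap (y : B) : Module.End K (X × (charIdeal g b χB ⊗[K] fixedBy K a X)) :=
  LinearMap.prod
    (χB y • (Algebra.lsmul K K X a ∘ₗ LinearMap.fst K _ _))
    (TensorProduct.mk K _ _ (H.toCharIdeal y) ∘ₗ toFixedBy H.idem_left X ∘ₗ LinearMap.fst K _ _ +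
      Algebra.lsmul K K _ (g y) ∘ₗ LinearMap.snd K _ _)

lemma actRightMap_apply (y : B) (v : X × (charIdeal g b χB ⊗[K] fixedBy K a X)) :
    H.actRightMap X y v =
      (χB y • a • v.1, H.toCharIdeal y ⊗ₜ toFixedBy H.idem_left X v.1 + g y • v.2) := rfl

/-- The action of `B` on `X ⊕ W ⊗ aX`. -/
def actRight : B →ₙₐ[K] Module.End K (X × (charIdeal g b χB ⊗[K] fixedBy K a X)) where
  toFun := H.actRightMap X
  map_zero' := LinearMap.ext fun v => by simp [actRightMap_apply]
  map_add' x y := LinearMap.ext fun v => by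
    simp [actRightMap_apply, add_smul, TensorProduct.add_tmul, add_add_add_comm]
  map_mul' x y := LinearMap.ext fun v => by
    have h1 : toFixedBy (K := K) H.idem_left X (a • v.1) = toFixedBy H.idem_left X v.1 :=
      Subtype.ext (by simp [smul_smul, H.idem_left])
    have h2 : H.toCharIdeal (x * y) = χB y • H.toCharIdeal x + g x • H.toCharIdeal y := by
      refine Subtype.ext ?_
      simp only [Submodule.coe_add, Submodule.coe_smul_of_tower, H.coe_toCharIdeal, smul_eq_mul,
        map_mul, mul_sub, smul_sub, mul_smul, H.map_right, mul_assoc]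
      rw [mul_smul_comm, smul_comm]
      abel
    simp only [Module.End.mul_apply, actRightMap_apply, h2, map_mul, mul_smul, map_smul, h1,
      TensorProduct.add_tmul, TensorProduct.tmul_smul, smul_add, TensorProduct.smul_tmul',
      add_assoc]
    simp only [smul_comm a, smul_smul a, H.idem_left]
  map_smul' c x := LinearMap.ext fun v => by
    simp [actRightMap_apply, H.map_smul_right, smul_smul, TensorProduct.smul_tmul']

lemma exists_act : ∃ ρ : L →ₐ[K] Module.End K (X × (charIdeal g b χB ⊗[K] fixedBy K a X)),
    (∀ x, ρ (f x) = H.actLeft X x) ∧ ∀ x, ρ (g x) = H.actRight X x := by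
  have h0 : H.toCharIdeal b = 0 := by
    refine Subtype.ext ?_
    rw [H.coe_toCharIdeal, H.idem_right, H.char_right, one_smul, H.map_right, sub_self]
    rfl
  have h1 : H.toCharIdeal 1 = 0 := by
    refine Subtype.ext ?_
    rw [H.coe_toCharIdeal, one_mul, map_one, one_smul, H.map_right, sub_self]
    rfl
  refine H.exists_lift _ (H.actLeft X) (H.actRight X) ?_ ?_ ?_ ?_ <;>
    refine LinearMap.ext fun v => Prod.ext ?_ ?_
  · simp [actLeft, actRight, actRightMap_apply, H.char_right]
  · simp [actLeft, actRight, actRightMap_apply, h0, H.map_left, H.map_right]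
  · simp [actLeft, actRight, actRightMap_apply]
  · simp [actLeft, actRight, actRightMap_apply, h1, smul_smul, H.mul_left, H.map_left]
  · simp [actLeft, actRight, actRightMap_apply]
  · simp [actLeft, actRight, actRightMap_apply, h1, smul_smul, H.mul_right, H.map_left]
  · simp [actLeft, actRight, actRightMap_apply]
  · change f 1 • v.2 + (H.toCharIdeal 1 ⊗ₜ toFixedBy H.idem_left X v.1 + g 1 • v.2) =
      v.2 + f a • v.2
    rw [h1, TensorProduct.zero_tmul, zero_add, ← add_smul, H.add_one, add_smul, one_smul,
      H.map_left]

/-- The action of `L` on `X ⊕ W ⊗ aX`. -/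
noncomputable def act : L →ₐ[K] Module.End K (X × (charIdeal g b χB ⊗[K] fixedBy K a X)) :=
  (H.exists_act X).choose

omit H in
noncomputable instance (H : IsGluing f g a b e χA χB) : Module L (H.Extension X) :=
  Module.compHom (X × (charIdeal g b χB ⊗[K] fixedBy K a X)) (H.act X).toRingHom

variable {X}

/-- The element of `X ⊕ W ⊗ aX` with the given components. -/
def pair (x : X) (t : charIdeal g b χB ⊗[K] fixedBy K a X) : H.Extension X := (x, t)

lemma pair_add (x y : X) (t s : charIdeal g b χB ⊗[K] fixedBy K a X) :
    H.pair (x + y) (t + s) = H.pair x t + H.pair y s := rfl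

lemma pair_zero : H.pair (0 : X) 0 = 0 := rfl

lemma left_smul (r : A) (x : X) (t : charIdeal g b χB ⊗[K] fixedBy K a X) :
    f r • H.pair x t = H.pair (r • x) (f r • t) :=
  LinearMap.congr_fun ((H.exists_act X).choose_spec.1 r) (x, t)

lemma right_smul (r : B) (x : X) (t : charIdeal g b χB ⊗[K] fixedBy K a X) :
    g r • H.pair x t = H.pair (χB r • (a • x))
      (H.toCharIdeal r ⊗ₜ toFixedBy H.idem_left X x + g r • t) :=
  LinearMap.congr_fun ((H.exists_act X).choose_spec.2 r) (x, t)

end Extension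

end IsGluing

end Gluing

end SimpleGluing

namespace SimpleGluing

namespace IsGluing

/-! ### The structure of induced modules -/

section InducedStructure

variable {K : Type u} [Field K] {A B L : Type u} [Ring A] [Algebra K A] [Ring B] [Algebra K B]
  [Ring L] [Algebra K L]
variable {f : A →ₙ+* L} {g : B →ₙ+* L} {a : A} {b : B} {e : L} {χA : A →ₐ[K] K} {χB : B →ₐ[K] K}
variable (H : IsGluing f g a b e χA χB)
variable {X Y : Type u} [AddCommGroup X] [Module K X] [Module A X] [IsScalarTower K A X]
  [AddCommGroup Y] [Module K Y] [Module A Y] [IsScalarTower K A Y]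

include H in
lemma of_smul (c : K) (x : X) : Induced.of f (c • x) = c • Induced.of f x := by
  have h : c • x = (c • (1 : A)) • x := by simp
  rw [h, ← Induced.map_smul_of, H.map_smul_left, smul_assoc, Induced.map_one_smul_of]

lemma smul_zero_pair (l : L) (t : charIdeal g b χB ⊗[K] fixedBy K a X) :
    l • H.pair (0 : X) t = H.pair 0 (l • t) := by
  induction l using H.induction generalizing t with
  | left x => rw [H.left_smul, smul_zero]
  | right x => rw [H.right_smul]; simp
  | add x y hx hy => rw [add_smul, hx, hy, add_smul, ← pair_add, add_zero]
  | mul x y hx hy => rw [mul_smul, hy, hx, mul_smul]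

/-- On a pair `(z, 0)` with `z ∈ aX`, the left ideal `W` acts through `w ↦ w ⊗ z`. -/
lemma charIdeal_smul (w : charIdeal g b χB) (z : fixedBy K a X) :
    (w : L) • H.pair (z : X) 0 = H.pair 0 (w ⊗ₜ z) := by
  obtain ⟨w, hw⟩ := w
  induction hw using Submodule.span_induction with
  | mem w hw =>
    obtain ⟨y, hy, rfl⟩ := hw
    have h1 := hy
    rw [SetLike.mem_coe, mem_charKer] at h1
    have h2 : H.toCharIdeal y = ⟨g y, Submodule.subset_span ⟨y, hy, rfl⟩⟩ :=
      Subtype.ext (by rw [H.coe_toCharIdeal, h1.1, h1.2, zero_smul, sub_zero])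
    have h3 : toFixedBy H.idem_left X (z : X) = z := Subtype.ext z.2
    rw [H.right_smul, h1.2, h2, h3, zero_smul, smul_zero, add_zero]
  | zero =>
    refine (zero_smul L _).trans ?_
    rw [← pair_zero]
    exact congrArg _ (TensorProduct.zero_tmul _ _).symm
  | add x y hx hy h1 h2 =>
    refine (add_smul x y _).trans ?_
    rw [h1, h2, ← pair_add, add_zero]
    exact congrArg _ (TensorProduct.add_tmul _ _ _).symm
  | smul l x hx h1 =>
    refine (mul_smul l x _).trans ?_
    rw [h1, H.smul_zero_pair]
    rfl

variable (X) in
/-- The canonical map from the induced module to `X ⊕ W ⊗ aX`. -/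
noncomputable def toExtension : Induced f X →ₗ[L] H.Extension X :=
  Induced.lift f
    { toFun := fun x => H.pair x 0
      map_zero' := rfl
      map_add' := fun x y => by rw [← pair_add, add_zero] } fun r x =>
    ((H.left_smul r x 0).trans (by rw [smul_zero]; rfl)).symm

lemma toExtension_of (x : X) : H.toExtension X (Induced.of f x) = H.pair x 0 :=
  Induced.lift_of _ _ _ _

variable (X) in
/-- The map `W ⊗ aX → L ⊗_A X`. -/
noncomputable def word : charIdeal g b χB ⊗[K] fixedBy K a X →ₗ[L] Induced f X :=
  TensorProduct.AlgebraTensorModule.lift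
    { toFun := fun w =>
        { toFun := fun z => (w : L) • Induced.of f (z : X)
          map_add' := fun x y => by simp
          map_smul' := fun c x => by
            rw [Submodule.coe_smul, H.of_smul, RingHom.id_apply, smul_algebra_smul_comm] }
      map_add' := fun x y => LinearMap.ext fun z => by simp [add_smul]
      map_smul' := fun l x => LinearMap.ext fun z => by simp [mul_smul] }

@[simp]
lemma word_tmul (w : charIdeal g b χB) (z : fixedBy K a X) :
    H.word X (w ⊗ₜ z) = (w : L) • Induced.of f (z : X) := rfl

lemma toExtension_word (t : charIdeal g b χB ⊗[K] fixedBy K a X) :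
    H.toExtension X (H.word X t) = H.pair 0 t := by
  induction t with
  | zero => rw [map_zero, map_zero, pair_zero]
  | add x y hx hy => rw [map_add, map_add, hx, hy, ← pair_add, add_zero]
  | tmul w z => rw [H.word_tmul, map_smul, H.toExtension_of, H.charIdeal_smul]

/-- The inverse of the canonical map from the induced module to `X ⊕ W ⊗ aX`. -/
noncomputable def ofExtension (v : H.Extension X) : Induced f X :=
  Induced.of f v.1 + H.word X v.2

lemma ofExtension_pair (x : X) (t : charIdeal g b χB ⊗[K] fixedBy K a X) :
    H.ofExtension (H.pair x t) = Induced.of f x + H.word X t := rfl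

omit [Module K X] [IsScalarTower K A X] in
include H in
lemma e_smul_of (x : X) : e • Induced.of f x = Induced.of f (a • x) := by
  rw [← H.map_left, Induced.map_smul_of]

omit [Module K X] [IsScalarTower K A X] in
include H in
lemma right_smul_of (y : B) (x : X) :
    g y • Induced.of f x = g (y * b) • Induced.of f (a • x) := by
  rw [map_mul, H.map_right, mul_smul, H.e_smul_of, smul_smul, H.idem_left, ← H.e_smul_of,
    ← H.mul_right, mul_smul, Induced.map_one_smul_of, smul_smul, ← map_mul, mul_one]

lemma ofExtension_add (v w : H.Extension X) :
    H.ofExtension (v + w) = H.ofExtension v + H.ofExtension w := by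
  obtain ⟨x, t⟩ := v
  obtain ⟨y, s⟩ := w
  change H.ofExtension (H.pair (x + y) (t + s)) =
    H.ofExtension (H.pair x t) + H.ofExtension (H.pair y s)
  rw [ofExtension_pair, map_add, map_add, add_add_add_comm]
  rfl

lemma ofExtension_smul (l : L) (v : H.Extension X) :
    H.ofExtension (l • v) = l • H.ofExtension v := by
  induction l using H.induction generalizing v with
  | left r =>
    obtain ⟨x, t⟩ := v
    change H.ofExtension (f r • H.pair x t) = f r • H.ofExtension (H.pair x t)
    rw [H.left_smul, ofExtension_pair, ofExtension_pair, smul_add, Induced.map_smul_of,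
      map_smul (H.word X)]
  | right r =>
    obtain ⟨x, t⟩ := v
    change H.ofExtension (g r • H.pair x t) = g r • H.ofExtension (H.pair x t)
    rw [H.right_smul, ofExtension_pair, ofExtension_pair, smul_add, map_add,
      map_smul (H.word X), ← add_assoc, word_tmul, coe_toCharIdeal, coe_toFixedBy, H.of_smul, sub_smul, H.right_smul_of r x,
      smul_assoc, H.e_smul_of, smul_smul a, H.idem_left]
    abel
  | add x y hx hy => rw [add_smul, H.ofExtension_add, hx, hy, add_smul]
  | mul x y hx hy => rw [mul_smul, hx, hy, mul_smul]

lemma ofExtension_toExtension (u : Induced f X) : H.ofExtension (H.toExtension X u) = u := by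
  induction u using Induced.induction f with
  | zero => rw [map_zero, ← pair_zero, ofExtension_pair, map_zero, map_zero, add_zero]
  | smul_of l x =>
    rw [map_smul, H.ofExtension_smul, H.toExtension_of, ofExtension_pair, map_zero, add_zero]
  | add u v hu hv => rw [map_add, H.ofExtension_add, hu, hv]

variable (X) in
/-- The retraction of the unit `X → L ⊗_A X` with kernel `W ⊗ aX`. -/
noncomputable def retr (u : Induced f X) : X := (H.toExtension X u).1

variable (X) in
/-- The component in `W ⊗ aX` of an element of `L ⊗_A X`. -/
noncomputable def wordPart (u : Induced f X) : charIdeal g b χB ⊗[K] fixedBy K a X :=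
  (H.toExtension X u).2

lemma of_retr_add_word (u : Induced f X) :
    Induced.of f (H.retr X u) + H.word X (H.wordPart X u) = u :=
  H.ofExtension_toExtension u

@[simp]
lemma retr_add (u v : Induced f X) : H.retr X (u + v) = H.retr X u + H.retr X v :=
  congrArg Prod.fst (map_add (H.toExtension X) u v)

@[simp]
lemma wordPart_add (u v : Induced f X) :
    H.wordPart X (u + v) = H.wordPart X u + H.wordPart X v :=
  congrArg Prod.snd (map_add (H.toExtension X) u v)

@[simp]
lemma retr_of (x : X) : H.retr X (Induced.of f x) = x :=
  congrArg Prod.fst (H.toExtension_of x)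

@[simp]
lemma wordPart_of (x : X) : H.wordPart X (Induced.of f x) = 0 :=
  congrArg Prod.snd (H.toExtension_of x)

@[simp]
lemma retr_word (t : charIdeal g b χB ⊗[K] fixedBy K a X) : H.retr X (H.word X t) = 0 :=
  congrArg Prod.fst (H.toExtension_word t)

@[simp]
lemma wordPart_word (t : charIdeal g b χB ⊗[K] fixedBy K a X) : H.wordPart X (H.word X t) = t :=
  congrArg Prod.snd (H.toExtension_word t)

lemma retr_smul (r : A) (u : Induced f X) : H.retr X (f r • u) = r • H.retr X u := by
  conv_lhs => rw [← H.of_retr_add_word u, smul_add, Induced.map_smul_of,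
    ← map_smul (H.word X)]
  rw [retr_add, retr_of, retr_word, add_zero]

lemma word_injective : Function.Injective (H.word X) :=
  Function.LeftInverse.injective H.wordPart_word

lemma map_word (h : X →ₗ[A] Y) (t : charIdeal g b χB ⊗[K] fixedBy K a X) :
    inducedMap f h (H.word X t) = H.word Y ((fixedByMap h).lTensor _ t) := by
  induction t with
  | zero => simp
  | add x y hx hy => simp only [map_add, hx, hy]
  | tmul w z =>
    rw [word_tmul, map_smul, Induced.inducedMap_of]
    rfl

lemma retr_map (h : X →ₗ[A] Y) (u : Induced f X) :
    H.retr Y (inducedMap f h u) = h (H.retr X u) := by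
  conv_lhs => rw [← H.of_retr_add_word u, map_add, Induced.inducedMap_of, H.map_word]
  simp

lemma wordPart_map (h : X →ₗ[A] Y) (u : Induced f X) :
    H.wordPart Y (inducedMap f h u) = (fixedByMap h).lTensor _ (H.wordPart X u) := by
  conv_lhs => rw [← H.of_retr_add_word u, map_add, Induced.inducedMap_of, H.map_word]
  simp

include H in
lemma map_exact {Z : Type u} [AddCommGroup Z] [Module K Z] [Module A Z] [IsScalarTower K A Z]
    {h : X →ₗ[A] Y} {k : Y →ₗ[A] Z} (hk : Function.Exact h k) :
    Function.Exact (inducedMap f h) (inducedMap f k) := by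
  have h1 : Function.Exact (fixedByMap (K := K) (a := a) h) (fixedByMap k) := by
    intro y
    constructor
    · intro hy
      obtain ⟨x, hx⟩ := (hk (y : Y)).1 (congrArg Subtype.val hy)
      refine ⟨toFixedBy H.idem_left X x, Subtype.ext ?_⟩
      rw [coe_fixedByMap, coe_toFixedBy, map_smul, hx]
      exact y.2
    · rintro ⟨x, rfl⟩
      exact Subtype.ext (hk.apply_apply_eq_zero (x : X))
  have h2 := Module.Flat.lTensor_exact (charIdeal g b χB) h1
  intro u
  constructor
  · intro hu
    obtain ⟨x, hx⟩ := (hk (H.retr Y u)).1 (by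
      rw [← H.retr_map, hu]; exact congrArg Prod.fst (map_zero (H.toExtension Z)))
    obtain ⟨t, ht⟩ := (h2 (H.wordPart Y u)).1 (by
      rw [← H.wordPart_map, hu]; exact congrArg Prod.snd (map_zero (H.toExtension Z)))
    refine ⟨Induced.of f x + H.word X t, ?_⟩
    rw [map_add, Induced.inducedMap_of, H.map_word, hx, ht, H.of_retr_add_word]
  · rintro ⟨u, rfl⟩
    have : k ∘ₗ h = 0 := LinearMap.ext hk.apply_apply_eq_zero
    rw [← LinearMap.comp_apply, ← Induced.map_comp, this]
    induction u using Induced.induction f with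
    | zero => simp
    | smul_of l x => rw [map_smul, Induced.inducedMap_of]; simp
    | add u v hu hv => rw [map_add, hu, hv, add_zero]

include H in
lemma map_injective {h : X →ₗ[A] Y} (hh : Function.Injective h) :
    Function.Injective (inducedMap f h) := by
  have h0 : Function.Exact (0 : PUnit.{u + 1} →ₗ[A] X) h :=
    (LinearMap.exact_zero_iff_injective _ _).2 hh
  have := H.map_exact h0
  rw [← LinearMap.ker_eq_bot, LinearMap.exact_iff.1 this, LinearMap.range_eq_bot]
  exact Induced.hom_ext fun x => by rw [Induced.inducedMap_of]; simp

end InducedStructure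

end IsGluing

end SimpleGluing

namespace SimpleGluing

/-! ### Consequences of finite dimensionality -/

/-- A pure tensor over a field vanishes only if one of its factors does. -/
lemma eq_zero_of_tmul_eq_zero {K : Type*} [Field K] {M N : Type*} [AddCommGroup M] [Module K M]
    [AddCommGroup N] [Module K N] {m : M} {n : N} (h : m ⊗ₜ[K] n = 0) (hn : n ≠ 0) : m = 0 := by
  obtain ⟨φ, hφ⟩ : ∃ φ : Module.Dual K N, φ n ≠ 0 := by
    by_contra! h
    exact hn ((Module.forall_dual_apply_eq_zero_iff K n).1 h)
  have h1 := congrArg (fun t => TensorProduct.rid K M (φ.lTensor M t)) h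
  simpa [hφ] using h1

namespace IsGluing

section Finite

variable {K : Type u} [Field K] {A B L : Type u} [Ring A] [Algebra K A] [Ring B] [Algebra K B]
  [Ring L] [Algebra K L]
variable {f : A →ₙ+* L} {g : B →ₙ+* L} {a : A} {b : B} {e : L} {χA : A →ₐ[K] K} {χB : B →ₐ[K] K}
variable (H : IsGluing f g a b e χA χB)
include H

lemma injective : Function.Injective f := by
  refine (injective_iff_map_eq_zero f).2 fun x hx => ?_
  have h1 : Induced.of f x = 0 := by
    rw [← mul_one x, ← smul_eq_mul, ← Induced.map_smul_of, hx, zero_smul]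
  rw [← H.retr_of x, h1]
  exact congrArg Prod.fst (map_zero (H.toExtension A))

lemma mul_map_eq_zero {w : L} (hw : w ∈ charIdeal g b χB) {x : A} (hx : x ∈ localCharKer a χA)
    (hx0 : x ≠ 0) (h : w * f x = 0) : w = 0 := by
  have h1 : H.word A ((⟨w, hw⟩ : charIdeal g b χB) ⊗ₜ[K] (⟨x, hx.1⟩ : fixedBy K a A)) = 0 := by
    rw [H.word_tmul]
    change w • Induced.of f x = 0
    rw [← mul_one x, ← smul_eq_mul, ← Induced.map_smul_of, smul_smul, h, zero_smul]
  have h2 := H.word_injective (h1.trans (map_zero _).symm)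
  exact congrArg Subtype.val (eq_zero_of_tmul_eq_zero h2 (fun h => hx0 (congrArg Subtype.val h)))

/-- If the gluing is finite dimensional, then the kernel of the character on `aAa` or that on `bBb`
vanishes: for nonzero elements `x`, `y` of these, right multiplication by `f x * g y` would be
injective, hence surjective, on the left ideal `W`; but `g y` is not in its image. -/
lemma eq_zero_or_eq_zero [Module.Finite K L] {x : A} (hx : x ∈ localCharKer a χA) {y : B}
    (hy : y ∈ localCharKer b χB) : x = 0 ∨ y = 0 := by
  by_contra! h
  obtain ⟨hx0, hy0⟩ := h
  have hxW : ∀ l : L, l * f x ∈ charIdeal f a χA := fun l =>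
    Submodule.smul_mem _ l (Submodule.subset_span ⟨x, hx.2, rfl⟩)
  have hyW : ∀ l : L, l * g y ∈ charIdeal g b χB := fun l =>
    Submodule.smul_mem _ l (Submodule.subset_span ⟨y, hy.2, rfl⟩)
  let T : charIdeal g b χB →ₗ[K] charIdeal g b χB :=
    { toFun := fun w => ⟨(w : L) * f x * g y, hyW _⟩
      map_add' := fun v w => Subtype.ext (by simp [add_mul])
      map_smul' := fun c w => Subtype.ext (by simp) }
  have hT : Function.Injective T := by
    refine (injective_iff_map_eq_zero T).2 fun w hw => Subtype.ext ?_
    exact H.mul_map_eq_zero w.2 hx hx0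
      (H.symm.mul_map_eq_zero (hxW _) hy hy0 (congrArg Subtype.val hw))
  have : Module.Finite K (charIdeal g b χB) :=
    Module.Finite.of_injective ((charIdeal g b χB).subtype.restrictScalars K)
      Subtype.val_injective
  obtain ⟨w, hw⟩ := LinearMap.injective_iff_surjective.1 hT
    ⟨g y, Submodule.subset_span ⟨y, hy.2, rfl⟩⟩
  have hw' : (w : L) * f x * g y = g y := congrArg Subtype.val hw
  have h1 : Induced.of g y = H.symm.word B
      ((⟨(w : L) * f x, hxW _⟩ : charIdeal f a χA) ⊗ₜ[K] (⟨y, hy.1⟩ : fixedBy K b B)) := by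
    rw [H.symm.word_tmul]
    change Induced.of g y = ((w : L) * f x) • Induced.of g y
    rw [← mul_one y, ← smul_eq_mul, ← Induced.map_smul_of, smul_smul, hw']
  apply hy0
  rw [← H.symm.retr_of y, h1, H.symm.retr_word]

/-- The component of `a x a` in the kernel of the character. -/
lemma corner_eq (x : A) : ∃ r ∈ localCharKer a χA, a * x * a = χA x • a + r := by
  refine ⟨a * x * a - χA x • a, ?_, by simp⟩
  rw [mem_localCharKer]
  simp [mul_sub, sub_mul, mul_assoc, H.idem_left, H.char_left, ← mul_assoc a a]

lemma map_mul_map_eq_zero [Module.Finite K L] {x : A} (hx : x ∈ localCharKer a χA) {y : B}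
    (hy : y ∈ localCharKer b χB) : f x * g y = 0 := by
  obtain rfl | rfl := H.eq_zero_or_eq_zero hx hy <;> simp

lemma map_mul_map_mem (x x' : A) (y y' : B) [Module.Finite K L] :
    f x * g y * f x' * g y' ∈ Submodule.span K {z | ∃ (x : A) (y : B), z = f x * g y} := by
  obtain ⟨r, hr, hr'⟩ := H.corner_eq x'
  obtain ⟨s, hs, hs'⟩ := H.symm.corner_eq y
  have h0 : g s * f r = 0 := H.symm.map_mul_map_eq_zero hs hr
  have h1 : f x * g y * f x' * g y' = f x * g (b * y * b) * f (a * x' * a) * g y' := by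
    simp only [map_mul, H.map_left, H.map_right]
    have h2 : ∀ x y, f x * g y = f x * e * g y := fun x y => by
      rw [H.map_mul_map, map_mul, map_mul, H.map_left, H.map_right, ← mul_assoc, mul_assoc (f x),
        H.e_mul_e]
    have h3 : ∀ x y, g y * f x = g y * e * f x := fun x y => by
      rw [H.symm.map_mul_map, map_mul, map_mul, H.map_left, H.map_right, ← mul_assoc,
        mul_assoc (g y), H.e_mul_e]
    rw [mul_assoc _ (f x') (g y'), h2 x' y', h2 x y, mul_assoc (f x * e) (g y), ← mul_assoc (g y),
      ← mul_assoc (g y), h3 x' y]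
    simp only [mul_assoc]
    rw [← mul_assoc e e, H.e_mul_e]
  have h2 : f x * g y * f x' * g y' = χB y • (f (x * (a * x' * a)) * g y') +
      χA x' • (f x * g (s * y')) := by
    have h3 : e * f r = f r := by rw [H.e_mul_map, (mem_localCharKer.1 hr).1]
    have h4 : g s * e = g s := by rw [H.symm.map_mul_e, (mem_localCharKer.1 hs).2.1]
    have h5 : ∀ z, g s * (f r * z) = 0 := fun z => by rw [← mul_assoc, h0, zero_mul]
    have h6 : ∀ z, e * (e * z) = e * z := fun z => by rw [← mul_assoc, H.e_mul_e]
    have h7 : ∀ z, g s * (e * z) = g s * z := fun z => by rw [← mul_assoc, h4]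
    have h8 : ∀ z, e * (f r * z) = f r * z := fun z => by rw [← mul_assoc, h3]
    rw [h1, hs', hr']
    simp only [map_add, map_mul, H.map_smul_right, H.map_smul_left, H.map_right, H.map_left,
      mul_add, add_mul, mul_assoc, smul_mul_assoc, mul_smul_comm, smul_add, h5, h6, h7, h8,
      mul_zero, add_zero]
    rw [add_right_comm, smul_comm]
  rw [h2]
  exact add_mem (Submodule.smul_mem _ _ (Submodule.subset_span ⟨_, _, rfl⟩))
    (Submodule.smul_mem _ _ (Submodule.subset_span ⟨_, _, rfl⟩))

/-- The subspace `f(1) L g(1)` of the gluing is spanned by the products of an element of `A` and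
one of `B`, as longer alternating products vanish. -/
lemma mul_mem_span [Module.Finite K L] (l : L) :
    f 1 * l * g 1 ∈ Submodule.span K {z | ∃ (x : A) (y : B), z = f x * g y} := by
  set T := Submodule.span K {z | ∃ (x : A) (y : B), z = f x * g y} with hT
  let U : Set L := {z | (∃ (x : A) (y : B), z = f x * g y) ∨ (∃ y : B, z = g y) ∨
    ∃ (y : B) (x : A) (y' : B), z = g y * f x * g y'}
  have hU : ∀ (l z : L), z ∈ Submodule.span K U → l * z ∈ Submodule.span K U := by
    intro l
    have red : ∀ l : L, (∀ z ∈ U, l * z ∈ Submodule.span K U) →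
        ∀ z ∈ Submodule.span K U, l * z ∈ Submodule.span K U := by
      intro l h z hz
      induction hz using Submodule.span_induction with
      | mem z hz => exact h z hz
      | zero => simp
      | add x y _ _ hx hy => rw [mul_add]; exact add_mem hx hy
      | smul c x _ hx => rw [mul_smul_comm]; exact Submodule.smul_mem _ _ hx
    have hTU : T ≤ Submodule.span K U := Submodule.span_mono fun z hz => Or.inl hz
    induction l using H.induction with
    | left x =>
      refine red _ ?_
      rintro z (⟨x', y, rfl⟩ | ⟨y, rfl⟩ | ⟨y, x', y', rfl⟩)
      · rw [← mul_assoc, ← map_mul]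
        exact Submodule.subset_span (Or.inl ⟨_, _, rfl⟩)
      · exact Submodule.subset_span (Or.inl ⟨_, _, rfl⟩)
      · rw [← mul_assoc, ← mul_assoc]
        exact hTU (H.map_mul_map_mem _ _ _ _)
    | right y₀ =>
      refine red _ ?_
      rintro z (⟨x, y, rfl⟩ | ⟨y, rfl⟩ | ⟨y, x, y', rfl⟩)
      · rw [← mul_assoc]
        exact Submodule.subset_span (Or.inr (Or.inr ⟨_, _, _, rfl⟩))
      · rw [← map_mul]
        exact Submodule.subset_span (Or.inr (Or.inl ⟨_, rfl⟩))
      · rw [← mul_assoc, ← mul_assoc, ← map_mul]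
        exact Submodule.subset_span (Or.inr (Or.inr ⟨_, _, _, rfl⟩))
    | add x y hx hy => exact fun z hz => by rw [add_mul]; exact add_mem (hx z hz) (hy z hz)
    | mul x y hx hy => exact fun z hz => by rw [mul_assoc]; exact hx _ (hy z hz)
  have h1 : ∀ z ∈ Submodule.span K U, f 1 * z ∈ T := by
    intro z hz
    induction hz using Submodule.span_induction with
    | mem z hz =>
      obtain ⟨x', y, rfl⟩ | ⟨y, rfl⟩ | ⟨y, x', y', rfl⟩ := hz
      · rw [← mul_assoc, ← map_mul]
        exact Submodule.subset_span ⟨_, _, rfl⟩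
      · exact Submodule.subset_span ⟨_, _, rfl⟩
      · rw [← mul_assoc, ← mul_assoc]
        exact H.map_mul_map_mem _ _ _ _
    | zero => simp
    | add x y _ _ hx hy => rw [mul_add]; exact add_mem hx hy
    | smul c x _ hx => rw [mul_smul_comm]; exact Submodule.smul_mem _ _ hx
  rw [mul_assoc]
  exact h1 _ (hU l _ (Submodule.subset_span (Or.inr (Or.inl ⟨1, rfl⟩))))

/-- The subspace `f(1) W` is spanned by the products of an element of `A a` and one of the kernel
of the character on `b B b`. -/
lemma mul_charIdeal_mem_span [Module.Finite K L] {w : L} (hw : w ∈ charIdeal g b χB) :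
    f 1 * w ∈ Submodule.span K
      {z | ∃ x y, x * a = x ∧ y ∈ localCharKer b χB ∧ z = f x * g y} := by
  have key : ∀ (l : L) (y : B), y ∈ charKer b χB → f 1 * (l * g y) ∈ Submodule.span K
      {z | ∃ x y, x * a = x ∧ y ∈ localCharKer b χB ∧ z = f x * g y} := by
    intro l y hy
    rw [mem_charKer] at hy
    have h1 : f 1 * (l * g y) = f 1 * l * g 1 * g y := by
      rw [mul_assoc _ (g 1), ← map_mul, one_mul, mul_assoc]
    rw [h1]
    have h2 := H.mul_mem_span l
    generalize f 1 * l * g 1 = z at h2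
    induction h2 using Submodule.span_induction with
    | mem z hz =>
      obtain ⟨x, y', rfl⟩ := hz
      refine Submodule.subset_span ⟨x * a, b * (y' * y), by rw [mul_assoc, H.idem_left], ?_, ?_⟩
      · rw [mem_localCharKer]
        refine ⟨by rw [← mul_assoc, H.idem_right], by rw [mul_assoc, mul_assoc, hy.1], ?_⟩
        rw [map_mul, map_mul, hy.2, mul_zero, mul_zero]
      · rw [mul_assoc, ← map_mul, H.map_mul_map]
    | zero => simp
    | add x y _ _ hx hy => rw [add_mul]; exact add_mem hx hy
    | smul c x _ hx => rw [smul_mul_assoc]; exact Submodule.smul_mem _ _ hx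
  suffices h : ∀ l : L, f 1 * (l * w) ∈ Submodule.span K
      {z | ∃ x y, x * a = x ∧ y ∈ localCharKer b χB ∧ z = f x * g y} by
    simpa using h 1
  induction hw using Submodule.span_induction with
  | mem w hw =>
    obtain ⟨y, hy, rfl⟩ := hw
    exact fun l => key l y hy
  | zero => simp
  | add x y _ _ hx hy => exact fun l => by rw [mul_add, mul_add]; exact add_mem (hx l) (hy l)
  | smul l' x _ hx => exact fun l => by rw [smul_eq_mul, ← mul_assoc l]; exact hx _

end Finite

end IsGluing

end SimpleGluing

namespace SimpleGluing

/-! ### Corners of induced modules -/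

section LeftIdeal

variable {K : Type u} [Field K] {A : Type u} [Ring A] [Algebra K A]

/-- The left ideal `A a`, for an idempotent `a`. -/
def leftIdeal (a : A) : Submodule A A :=
  LinearMap.eqLocus (LinearMap.toSpanSingleton A A a) LinearMap.id

lemma mem_leftIdeal {a x : A} : x ∈ leftIdeal a ↔ x * a = x := Iff.rfl

/-- The projection `x ↦ x a` of `A` onto `A a`, for an idempotent `a`. -/
def toLeftIdeal {a : A} (ha : a * a = a) : A →ₗ[A] leftIdeal a :=
  (LinearMap.toSpanSingleton A A a).codRestrict _ fun x => by
    rw [mem_leftIdeal, LinearMap.toSpanSingleton_apply, smul_eq_mul, mul_assoc, ha]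

lemma toLeftIdeal_coe {a : A} (ha : a * a = a) (x : leftIdeal a) : toLeftIdeal ha (x : A) = x :=
  Subtype.ext x.2

lemma finite_leftIdeal {a : A} (ha : a * a = a) : Module.Finite A (leftIdeal a) :=
  Module.Finite.of_surjective (toLeftIdeal ha) fun x => ⟨x, toLeftIdeal_coe ha x⟩

lemma projective_leftIdeal {a : A} (ha : a * a = a) : Module.Projective A (leftIdeal a) :=
  Module.Projective.of_split (leftIdeal a).subtype (toLeftIdeal ha)
    (LinearMap.ext fun x => toLeftIdeal_coe ha x)

lemma finite_leftIdeal_tensor {a : A} (ha : a * a = a) (U : Type u) [AddCommMonoid U] [Module K U]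
    [Module.Finite K U] : Module.Finite A (leftIdeal a ⊗[K] U) := by
  have := finite_leftIdeal ha
  obtain ⟨S, hS⟩ := (Module.finite_def (R := K) (M := U)).1 inferInstance
  obtain ⟨T, hT⟩ := (Module.finite_def (R := A) (M := leftIdeal a)).1 inferInstance
  classical
  refine Module.finite_def.2 ⟨(T ×ˢ S).image fun p => p.1 ⊗ₜ p.2, ?_⟩
  have h1 : ∀ (x : leftIdeal a), ∀ s ∈ S, x ⊗ₜ[K] s ∈
      Submodule.span A (((T ×ˢ S).image fun p => p.1 ⊗ₜ[K] p.2 : Finset _) : Set _) := by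
    intro x s hs
    have hx : x ∈ Submodule.span A (T : Set (leftIdeal a)) := hT ▸ Submodule.mem_top
    induction hx using Submodule.span_induction with
    | mem x hx =>
      refine Submodule.subset_span ?_
      rw [Finset.coe_image]
      exact ⟨(x, s), by simpa using ⟨hx, hs⟩, rfl⟩
    | zero => rw [TensorProduct.zero_tmul]; exact zero_mem _
    | add x y _ _ hx hy => rw [TensorProduct.add_tmul]; exact add_mem hx hy
    | smul r x _ hx => rw [← TensorProduct.smul_tmul']; exact Submodule.smul_mem _ _ hx
  refine (Submodule.eq_top_iff').2 fun t => ?_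
  induction t with
  | zero => exact zero_mem _
  | add x y hx hy => exact add_mem hx hy
  | tmul x z =>
    have hz : z ∈ Submodule.span K (S : Set U) := hS ▸ Submodule.mem_top
    induction hz using Submodule.span_induction generalizing x with
    | mem z hz => exact h1 x z hz
    | zero => rw [TensorProduct.tmul_zero]; exact zero_mem _
    | add y z _ _ hx hy => rw [TensorProduct.tmul_add]; exact add_mem (hx x) (hy x)
    | smul c z _ hx => rw [← TensorProduct.smul_tmul]; exact hx _

lemma projective_leftIdeal_tensor {a : A} (ha : a * a = a) (U : Type u) [AddCommGroup U]
    [Module K U] : Module.Projective A (leftIdeal a ⊗[K] U) := by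
  have := projective_leftIdeal ha
  infer_instance

end LeftIdeal

namespace IsGluing

section Corner

variable {K : Type u} [Field K] {A B L : Type u} [Ring A] [Algebra K A] [Ring B] [Algebra K B]
  [Ring L] [Algebra K L]
variable {f : A →ₙ+* L} {g : B →ₙ+* L} {a : A} {b : B} {e : L} {χA : A →ₐ[K] K} {χB : B →ₐ[K] K}
variable (H : IsGluing f g a b e χA χB)
variable {X : Type u} [AddCommGroup X] [Module K X] [Module A X] [IsScalarTower K A X]
  {Y : Type u} [AddCommGroup Y] [Module K Y] [Module B Y] [IsScalarTower K B Y]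
  {M : Type u} [AddCommGroup M] [Module K M] [Module L M] [IsScalarTower K L M]
  {U : Type u} [AddCommMonoid U] [Module K U]

/-- The map `A a ⊗ U → M`, `x ⊗ z ↦ f(x) u(z)`. -/
def actTensor (u : U →ₗ[K] M) : leftIdeal a ⊗[K] U →ₗ[K] M :=
  TensorProduct.lift
    { toFun := fun x => (Algebra.lsmul K K M (f x)) ∘ₗ u
      map_add' := fun x y => LinearMap.ext fun z => by simp
      map_smul' := fun c x => LinearMap.ext fun z => by simp [H.map_smul_left] }

@[simp]
lemma actTensor_tmul (u : U →ₗ[K] M) (x : leftIdeal a) (z : U) :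
    H.actTensor u (x ⊗ₜ z) = f x • u z := rfl

lemma actTensor_smul (u : U →ₗ[K] M) (r : A) (t : leftIdeal a ⊗[K] U) :
    H.actTensor u (r • t) = f r • H.actTensor u t := by
  induction t with
  | zero => simp
  | add x y hx hy => rw [smul_add, map_add, map_add, hx, hy, smul_add]
  | tmul x z =>
    rw [TensorProduct.smul_tmul', actTensor_tmul, actTensor_tmul, Submodule.coe_smul, smul_eq_mul,
      map_mul, mul_smul]

/-- The map `A a ⊗ U → f(1) M`, `x ⊗ z ↦ f(x) u(z)`. -/
def cornerTensor (u : U →ₗ[K] M) : leftIdeal a ⊗[K] U →ₗ[A] Corner f M where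
  toFun t := Corner.mk f (H.actTensor u t) (by rw [← actTensor_smul, one_smul])
  map_add' x y := Corner.ext (by simp)
  map_smul' r x := Corner.ext (by simp [actTensor_smul])

@[simp]
lemma val_cornerTensor (u : U →ₗ[K] M) (t : leftIdeal a ⊗[K] U) :
    Corner.val (H.cornerTensor u t) = H.actTensor u t := rfl

variable (Y) in
/-- The unit `bY → L ⊗_B Y`. -/
noncomputable def fixedUnit : fixedBy K b Y →ₗ[K] Induced g Y where
  toFun z := Induced.of g (z : Y)
  map_add' x y := by simp
  map_smul' c x := by simp [H.symm.of_smul]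

@[simp]
lemma fixedUnit_apply (z : fixedBy K b Y) : H.fixedUnit Y z = Induced.of g (z : Y) := rfl

/-- The map `A a ⊗ bY → L ⊗_B Y` is injective: composed with a map from `L ⊗_B Y` to `L ⊗ bY` it
becomes the map induced by the injective map `f`. -/
lemma actTensor_fixedUnit_injective : Function.Injective (H.actTensor (H.fixedUnit Y)) := by
  let i : leftIdeal a →ₗ[K] L :=
    { toFun := fun x => f x
      map_add' := fun x y => by simp
      map_smul' := fun c x => H.map_smul_left c x }
  have hi : Function.Injective (i.rTensor (fixedBy K b Y)) :=
    Module.Flat.rTensor_preserves_injective_linearMap _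
      (H.injective.comp Subtype.val_injective)
  let γ : Induced g Y → L ⊗[K] fixedBy K b Y := fun v =>
    e ⊗ₜ toFixedBy H.idem_right Y (H.symm.retr Y v) +
      ((charIdeal f a χA).subtype.restrictScalars K).rTensor _ (H.symm.wordPart Y v)
  have hγ : ∀ v w, γ (v + w) = γ v + γ w := fun v w => by
    simp only [γ, retr_add, wordPart_add, map_add, TensorProduct.tmul_add]
    abel
  have key : ∀ t, γ (H.actTensor (H.fixedUnit Y) t) = i.rTensor _ t := by
    intro t
    induction t with
    | zero =>
      have : γ 0 = 0 := by simpa using hγ 0 0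
      rw [map_zero, map_zero, this]
    | add x y hx hy => rw [map_add, map_add, hγ, hx, hy]
    | tmul x z =>
      have h1 : H.symm.toExtension Y (f (x : A) • Induced.of g (z : Y)) = _ :=
        (map_smul _ _ _).trans ((congrArg _ (H.symm.toExtension_of (z : Y))).trans
          (H.symm.right_smul _ _ _))
      have h2 : toFixedBy H.idem_right Y (z : Y) = z := Subtype.ext z.2
      have h3 : toFixedBy H.idem_right Y (χA x • b • (z : Y)) = χA x • z := by
        rw [map_smul]
        exact congrArg _ (Subtype.ext (by rw [coe_toFixedBy, smul_smul, H.idem_right]; exact z.2))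
      have h4 : H.symm.retr Y (f (x : A) • Induced.of g (z : Y)) = χA x • b • (z : Y) :=
        congrArg Prod.fst h1
      have h5 : H.symm.wordPart Y (f (x : A) • Induced.of g (z : Y)) =
          H.symm.toCharIdeal (x : A) ⊗ₜ z := by
        refine (congrArg Prod.snd h1).trans ?_
        change H.symm.toCharIdeal (x : A) ⊗ₜ toFixedBy H.idem_right Y (z : Y) + f (x : A) • 0 = _
        rw [h2, smul_zero, add_zero]
      simp only [γ, actTensor_tmul, fixedUnit_apply, h4, h5, h3, LinearMap.rTensor_tmul]
      rw [TensorProduct.tmul_smul, TensorProduct.smul_tmul', ← TensorProduct.add_tmul]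
      congr 1
      change χA x • e + (H.symm.toCharIdeal (x : A) : L) = f x
      rw [coe_toCharIdeal, mem_leftIdeal.1 x.2]
      abel
  intro t s hts
  apply hi
  rw [← key, ← key, hts]

lemma exists_actTensor_fixedUnit [Module.Finite K L] {v : Induced g Y} (hv : f 1 • v = v) :
    ∃ t, H.actTensor (H.fixedUnit Y) t = v := by
  suffices h : ∀ v : Induced g Y, ∃ t, H.actTensor (H.fixedUnit Y) t = f 1 • v by
    obtain ⟨t, ht⟩ := h v
    exact ⟨t, ht.trans hv⟩
  intro v
  induction v using Induced.induction g with
  | zero => exact ⟨0, by simp⟩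
  | add u v hu hv =>
    obtain ⟨t, ht⟩ := hu
    obtain ⟨s, hs⟩ := hv
    exact ⟨t + s, by rw [map_add, ht, hs, smul_add]⟩
  | smul_of l y =>
    have h1 : f 1 • l • Induced.of g y = (f 1 * l * g 1) • Induced.of g y := by
      rw [mul_smul, mul_smul, Induced.map_one_smul_of]
    rw [h1]
    have h2 := H.mul_mem_span l
    generalize f 1 * l * g 1 = z at h2
    induction h2 using Submodule.span_induction with
    | mem z hz =>
      obtain ⟨x, y', rfl⟩ := hz
      refine ⟨toLeftIdeal H.idem_left x ⊗ₜ toFixedBy H.idem_right Y (y' • y), ?_⟩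
      rw [H.map_mul_map, mul_smul, Induced.map_smul_of, mul_smul]
      rfl
    | zero => exact ⟨0, by simp⟩
    | add u v _ _ hu hv =>
      obtain ⟨t, ht⟩ := hu
      obtain ⟨s, hs⟩ := hv
      exact ⟨t + s, by rw [map_add, ht, hs, add_smul]⟩
    | smul c u _ hu =>
      obtain ⟨t, ht⟩ := hu
      exact ⟨c • t, by rw [map_smul, ht, smul_assoc]⟩

variable (Y) in
/-- The `A`-module `f(1) (L ⊗_B Y)` is isomorphic to `A a ⊗ bY`. -/
noncomputable def cornerEquiv [Module.Finite K L] :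
    (leftIdeal a ⊗[K] fixedBy K b Y) ≃ₗ[A] Corner f (Induced g Y) :=
  LinearEquiv.ofBijective (H.cornerTensor (H.fixedUnit Y))
    ⟨fun _ _ h => H.actTensor_fixedUnit_injective (congrArg Corner.val h), fun v => by
      obtain ⟨t, ht⟩ := H.exists_actTensor_fixedUnit (Corner.one_smul_val v)
      exact ⟨t, Corner.ext ht⟩⟩

variable (X) in
/-- The map `ker χ ⊗ aX → L ⊗_A X`, where `ker χ` is the kernel of the character on `b B b`. -/
noncomputable def localWord : localCharKer b χB ⊗[K] fixedBy K a X →ₗ[K] Induced f X :=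
  TensorProduct.lift
    { toFun := fun y => Algebra.lsmul K K _ (g y) ∘ₗ H.symm.fixedUnit X
      map_add' := fun x y => LinearMap.ext fun z => by simp
      map_smul' := fun c x => LinearMap.ext fun z => by simp [H.map_smul_right] }

@[simp]
lemma localWord_tmul (y : localCharKer b χB) (z : fixedBy K a X) :
    H.localWord X (y ⊗ₜ z) = g y • Induced.of f (z : X) := rfl

/-- The map `A a ⊗ ker χ → W`, where `ker χ` is the kernel of the character on `b B b`. -/
noncomputable def mulCharIdeal : leftIdeal a ⊗[K] localCharKer b χB →ₗ[K] charIdeal g b χB :=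
  H.actTensor
    { toFun := fun y => ⟨g y, Submodule.subset_span ⟨y, y.2.2, rfl⟩⟩
      map_add' := fun x y => Subtype.ext (by simp)
      map_smul' := fun c x => Subtype.ext (H.map_smul_right c x) }

lemma coe_mulCharIdeal_tmul (x : leftIdeal a) (y : localCharKer b χB) :
    (H.mulCharIdeal (x ⊗ₜ y) : L) = f x * g y := rfl

lemma mulCharIdeal_injective : Function.Injective H.mulCharIdeal := by
  have h1 : localCharKer b χB ≤ fixedBy K b B := inf_le_left
  have h2 : Function.Injective ((Submodule.inclusion h1).lTensor (leftIdeal a)) :=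
    Module.Flat.lTensor_preserves_injective_linearMap _ (Submodule.inclusion_injective h1)
  have key : ∀ t, (H.mulCharIdeal t : L) • Induced.of g (1 : B) =
      H.actTensor (H.fixedUnit B) ((Submodule.inclusion h1).lTensor (leftIdeal a) t) := by
    intro t
    induction t with
    | zero => simp
    | add x y hx hy =>
      rw [map_add, map_add, map_add, Submodule.coe_add, add_smul, hx, hy]
    | tmul x y =>
      rw [coe_mulCharIdeal_tmul, mul_smul, Induced.map_smul_of, smul_eq_mul, mul_one]
      rfl
  intro t s hts
  apply h2
  apply H.actTensor_fixedUnit_injective (Y := B)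
  rw [← key, ← key, hts]

lemma exists_mulCharIdeal [Module.Finite K L] (w : charIdeal g b χB) :
    ∃ t, H.mulCharIdeal t = f 1 • w := by
  have h := H.mul_charIdeal_mem_span w.2
  suffices h' : ∃ t, (H.mulCharIdeal t : L) = f 1 * w by
    obtain ⟨t, ht⟩ := h'
    exact ⟨t, Subtype.ext ht⟩
  generalize f 1 * (w : L) = z at h
  induction h using Submodule.span_induction with
  | mem z hz =>
    obtain ⟨x, y, hx, hy, rfl⟩ := hz
    exact ⟨(⟨x, hx⟩ : leftIdeal a) ⊗ₜ (⟨y, hy⟩ : localCharKer b χB), rfl⟩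
  | zero => exact ⟨0, by simp⟩
  | add u v _ _ hu hv =>
    obtain ⟨t, ht⟩ := hu
    obtain ⟨s, hs⟩ := hv
    exact ⟨t + s, by rw [map_add, Submodule.coe_add, ht, hs]⟩
  | smul c u _ hu =>
    obtain ⟨t, ht⟩ := hu
    exact ⟨c • t, by rw [map_smul, Submodule.coe_smul_of_tower, ht]⟩

lemma actTensor_localWord (t : leftIdeal a ⊗[K] (localCharKer b χB ⊗[K] fixedBy K a X)) :
    H.actTensor (H.localWord X) t = H.word X
      (H.mulCharIdeal.rTensor _ ((TensorProduct.assoc K _ _ _).symm t)) := by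
  induction t with
  | zero => simp
  | add x y hx hy => simp only [map_add, hx, hy]
  | tmul x s =>
    induction s with
    | zero => simp
    | add x y hx hy => simp only [TensorProduct.tmul_add, map_add, hx, hy]
    | tmul y z =>
      rw [actTensor_tmul, localWord_tmul, TensorProduct.assoc_symm_tmul, LinearMap.rTensor_tmul,
        word_tmul, coe_mulCharIdeal_tmul, mul_smul]

lemma actTensor_localWord_injective : Function.Injective (H.actTensor (H.localWord X)) := by
  intro t s h1
  rw [actTensor_localWord, actTensor_localWord] at h1
  exact (TensorProduct.assoc K _ _ _).symm.injective
    (Module.Flat.rTensor_preserves_injective_linearMap _ H.mulCharIdeal_injective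
      (H.word_injective h1))

lemma retr_actTensor_localWord (t : leftIdeal a ⊗[K] (localCharKer b χB ⊗[K] fixedBy K a X)) :
    H.retr X (H.actTensor (H.localWord X) t) = 0 := by
  rw [actTensor_localWord, retr_word]

variable (X) in
/-- The kernel of the retraction `f(1) (L ⊗_A X) → X`. -/
noncomputable def retrKer : Submodule A (Corner f (Induced f X)) where
  carrier := {u | H.retr X (Corner.val u) = 0}
  add_mem' {u v} hu hv := by
    rw [Set.mem_ofPred_eq] at hu hv ⊢
    rw [map_add, retr_add, hu, hv, add_zero]
  zero_mem' := by
    rw [Set.mem_ofPred_eq, map_zero]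
    exact congrArg Prod.fst (map_zero (H.toExtension X))
  smul_mem' r u hu := by
    rw [Set.mem_ofPred_eq] at hu ⊢
    rw [Corner.val_smul, retr_smul, hu, smul_zero]

lemma mem_retrKer {u : Corner f (Induced f X)} :
    u ∈ H.retrKer X ↔ H.retr X (Corner.val u) = 0 := Iff.rfl

lemma exists_actTensor_localWord [Module.Finite K L] {u : Corner f (Induced f X)}
    (hu : u ∈ H.retrKer X) : ∃ t, H.cornerTensor (H.localWord X) t = u := by
  have h1 := H.of_retr_add_word (Corner.val u)
  rw [H.mem_retrKer.1 hu, map_zero, zero_add] at h1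
  generalize H.wordPart X (Corner.val u) = t at h1
  suffices h : ∃ s, H.actTensor (H.localWord X) s = f 1 • H.word X t by
    obtain ⟨s, hs⟩ := h
    exact ⟨s, Corner.ext (by rw [val_cornerTensor, hs, h1, Corner.one_smul_val])⟩
  clear h1 hu
  induction t with
  | zero => exact ⟨0, by simp⟩
  | add x y hx hy =>
    obtain ⟨t, ht⟩ := hx
    obtain ⟨s, hs⟩ := hy
    exact ⟨t + s, by rw [map_add, map_add, ht, hs, smul_add]⟩
  | tmul w z =>
    obtain ⟨t, ht⟩ := H.exists_mulCharIdeal w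
    refine ⟨TensorProduct.assoc K _ _ _ (t ⊗ₜ z), ?_⟩
    rw [actTensor_localWord, LinearEquiv.symm_apply_apply, LinearMap.rTensor_tmul, ht,
      ← map_smul (H.word X), TensorProduct.smul_tmul']

variable (X) in
/-- The kernel of the retraction `f(1) (L ⊗_A X) → X` is isomorphic to `A a ⊗ ker χ ⊗ aX`. -/
noncomputable def retrKerEquiv [Module.Finite K L] :
    (leftIdeal a ⊗[K] (localCharKer b χB ⊗[K] fixedBy K a X)) ≃ₗ[A] H.retrKer X :=
  LinearEquiv.ofBijective
    ((H.cornerTensor (H.localWord X)).codRestrict (H.retrKer X) H.retr_actTensor_localWord)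
    ⟨fun t s hts => H.actTensor_localWord_injective
      (congrArg (fun v : H.retrKer X => Corner.val (v : Corner f (Induced f X))) hts), fun u => by
      obtain ⟨t, ht⟩ := H.exists_actTensor_localWord u.2
      exact ⟨t, Subtype.ext ht⟩⟩

variable (X) in
/-- The `A`-module `f(1) (L ⊗_A X)` is the direct sum of `X` and the kernel of the retraction. -/
noncomputable def cornerProdEquiv : (X × H.retrKer X) ≃ₗ[A] Corner f (Induced f X) where
  toFun p := Corner.unit f X p.1 + p.2
  map_add' p q := by
    rw [Prod.fst_add, Prod.snd_add, map_add, Submodule.coe_add, add_add_add_comm]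
  map_smul' r p := by simp
  invFun u := (H.retr X (Corner.val u), ⟨u - Corner.unit f X (H.retr X (Corner.val u)), by
    have h := H.retr_add (Corner.val (u - Corner.unit f X (H.retr X (Corner.val u))))
      (Induced.of f (H.retr X (Corner.val u)))
    rw [map_sub, Corner.val_unit, sub_add_cancel, retr_of] at h
    rw [mem_retrKer, map_sub, Corner.val_unit]
    exact left_eq_add.1 (h.trans (add_comm _ _)).symm.symm⟩)
  left_inv p := by
    obtain ⟨x, u, hu⟩ := p
    have h : H.retr X (Corner.val (Corner.unit f X x + u)) = x := by
      rw [map_add, retr_add, Corner.val_unit, retr_of, H.mem_retrKer.1 hu, add_zero]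
    refine Prod.ext h (Subtype.ext ?_)
    simp only [h]
    abel
  right_inv u := by simp

end Corner

end IsGluing

end SimpleGluing

namespace SimpleGluing

namespace IsGluing

/-! ### The Mayer–Vietoris sequence of a module over a gluing -/

section MayerVietoris

variable {K : Type u} [Field K] {A B L : Type u} [Ring A] [Algebra K A] [Ring B] [Algebra K B]
  [Ring L] [Algebra K L]
variable {f : A →ₙ+* L} {g : B →ₙ+* L} {a : A} {b : B} {e : L} {χA : A →ₐ[K] K} {χB : B →ₐ[K] K}
variable (H : IsGluing f g a b e χA χB)
variable (Z : Type u) [AddCommGroup Z] [Module L Z]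

variable (f) in
/-- The counit `L ⊗_A f(1) Z → Z`. -/
noncomputable def _root_.SimpleGluing.counit : Induced f (Corner f Z) →ₗ[L] Z :=
  Induced.adj f LinearMap.id

lemma _root_.SimpleGluing.counit_of (x : Corner f Z) :
    counit f Z (Induced.of f x) = Corner.val x :=
  Induced.adj_of _ _ _

variable (f g) in
/-- The second map of the Mayer–Vietoris sequence. -/
noncomputable def _root_.SimpleGluing.mvRight :
    Induced f (Corner f Z) × Induced g (Corner g Z) →ₗ[L] Z :=
  LinearMap.coprod (counit f Z) (counit g Z)

include H in
lemma sub_smul_fixed {M : Type u} [AddCommGroup M] [Module L M] (m : M) :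
    g 1 • (m - f 1 • m) = m - f 1 • m := by
  rw [smul_sub, smul_smul, H.mul_right]
  nth_rw 3 [← one_smul L m]
  rw [← sub_smul, ← sub_smul]
  congr 1
  rw [sub_eq_sub_iff_add_eq_add, add_comm, H.add_one]

include H in
lemma mvRight_surjective : Function.Surjective (mvRight f g Z) := by
  intro z
  have hf : f 1 * f 1 = f 1 := by rw [← map_mul, one_mul]
  refine ⟨(Induced.of f (Corner.mk f (f 1 • z) (by rw [smul_smul, hf])),
    Induced.of g (Corner.mk g (z - f 1 • z) (H.sub_smul_fixed z))), ?_⟩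
  rw [mvRight, LinearMap.coprod_apply, counit_of, counit_of, Corner.val_mk, Corner.val_mk]
  abel

variable [Module K Z] [IsScalarTower K L Z] [Module K (Corner f Z)]
  [IsScalarTower K A (Corner f Z)]

include H in
lemma val_smul_field (c : K) (x : Corner f Z) : Corner.val (c • x) = c • Corner.val x := by
  have h : c • x = (c • (1 : A)) • x := by simp
  rw [h, Corner.val_smul, H.map_smul_left, smul_assoc, Corner.one_smul_val]

/-- The map `eZ → f(1) Z`. -/
def fixedToCorner : fixedBy K e Z →ₗ[K] Corner f Z where
  toFun z := Corner.mk f (z : Z) (by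
    have h1 : f 1 * e = e := by rw [← H.map_left, ← map_mul, one_mul]
    have h : e • (z : Z) = z := z.2
    rw [← h, smul_smul, h1])
  map_add' x y := Corner.ext (by simp)
  map_smul' c x := Corner.ext (by rw [RingHom.id_apply, H.val_smul_field]; rfl)

lemma val_fixedToCorner (z : fixedBy K e Z) : Corner.val (H.fixedToCorner Z z) = z := rfl

/-- The map `a (f(1) Z) → eZ`. -/
def cornerToFixed : fixedBy K a (Corner f Z) →ₗ[K] fixedBy K e Z where
  toFun z := ⟨Corner.val (z : Corner f Z), by
    rw [mem_fixedBy, ← H.map_left, ← Corner.val_smul]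
    exact congrArg _ z.2⟩
  map_add' x y := Subtype.ext (by simp)
  map_smul' c x := Subtype.ext (H.val_smul_field Z c x)

lemma fixedToCorner_cornerToFixed (z : fixedBy K a (Corner f Z)) :
    H.fixedToCorner Z (H.cornerToFixed Z z) = z := rfl

/-- The canonical map `L e ⊗ eZ → L ⊗_A f(1) Z`. -/
noncomputable def overlapMap :
    leftIdeal e ⊗[K] fixedBy K e Z →ₗ[L] Induced f (Corner f Z) :=
  TensorProduct.AlgebraTensorModule.lift
    { toFun := fun l =>
        { toFun := fun z => (l : L) • Induced.of f (H.fixedToCorner Z z)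
          map_add' := fun x y => by simp
          map_smul' := fun c x => by
            rw [map_smul, H.of_smul, RingHom.id_apply, smul_algebra_smul_comm] }
      map_add' := fun x y => LinearMap.ext fun z => by simp [add_smul]
      map_smul' := fun l x => LinearMap.ext fun z => by simp [mul_smul] }

lemma overlapMap_tmul (l : leftIdeal e) (z : fixedBy K e Z) :
    H.overlapMap Z (l ⊗ₜ z) = (l : L) • Induced.of f (H.fixedToCorner Z z) := rfl

lemma counit_overlapMap_tmul (l : leftIdeal e) (z : fixedBy K e Z) :
    counit f Z (H.overlapMap Z (l ⊗ₜ z)) = (l : L) • (z : Z) := by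
  rw [overlapMap_tmul, map_smul, counit_of, val_fixedToCorner]

variable [Module K (Corner g Z)] [IsScalarTower K B (Corner g Z)]

lemma counit_overlapMap (c : leftIdeal e ⊗[K] fixedBy K e Z) :
    counit f Z (H.overlapMap Z c) = counit g Z (H.symm.overlapMap Z c) := by
  induction c with
  | zero => simp
  | add x y hx hy => simp only [map_add, hx, hy]
  | tmul l z => rw [counit_overlapMap_tmul, counit_overlapMap_tmul]

/-- The map `z ↦ e ⊗ z` from `b (g(1) Z)` to `L e ⊗ eZ`. -/
noncomputable def overlapUnit :
    fixedBy K b (Corner g Z) →ₗ[K] leftIdeal e ⊗[K] fixedBy K e Z :=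
  TensorProduct.mk K _ _ ⟨e, H.e_mul_e⟩ ∘ₗ H.symm.cornerToFixed Z

/-- The map `y ⊗ z ↦ g(y) ⊗ z` from `ker χ ⊗ a (f(1) Z)` to `L e ⊗ eZ`. -/
noncomputable def overlapWord :
    localCharKer b χB ⊗[K] fixedBy K a (Corner f Z) →ₗ[K] leftIdeal e ⊗[K] fixedBy K e Z :=
  TensorProduct.map
    { toFun := fun y => ⟨g (y : B), by
        rw [mem_leftIdeal, H.symm.map_mul_e, (mem_localCharKer.1 y.2).2.1]⟩
      map_add' := fun x y => Subtype.ext (map_add g (x : B) (y : B))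
      map_smul' := fun c x => Subtype.ext (H.map_smul_right c x) }
    (H.cornerToFixed Z)

omit [Module K (Corner f Z)] [IsScalarTower K A (Corner f Z)] in
lemma overlapMap_symm_unit (t : leftIdeal a ⊗[K] fixedBy K b (Corner g Z)) :
    H.symm.overlapMap Z (H.actTensor (H.overlapUnit Z) t) =
      H.actTensor (H.fixedUnit (Corner g Z)) t := by
  induction t with
  | zero => simp
  | add x y hx hy => simp only [map_add, hx, hy]
  | tmul x z =>
    rw [actTensor_tmul, map_smul]
    change f x • H.symm.overlapMap Z (_ ⊗ₜ _) = _
    rw [overlapMap_tmul, fixedToCorner_cornerToFixed, H.symm.e_smul_of]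
    have hz : b • (z : Corner g Z) = z := z.2
    rw [hz]
    rfl

lemma overlapMap_unit (t : leftIdeal a ⊗[K] fixedBy K b (Corner g Z)) :
    ∃ x, H.overlapMap Z (H.actTensor (H.overlapUnit Z) t) = Induced.of f x := by
  induction t with
  | zero => exact ⟨0, by simp⟩
  | add x y hx hy =>
    obtain ⟨x, hx⟩ := hx
    obtain ⟨y, hy⟩ := hy
    exact ⟨x + y, by simp only [map_add, hx, hy]⟩
  | tmul x z =>
    rw [actTensor_tmul, map_smul]
    change ∃ y, f x • H.overlapMap Z (_ ⊗ₜ _) = _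
    rw [overlapMap_tmul, H.e_smul_of, Induced.map_smul_of]
    exact ⟨_, rfl⟩

omit [Module K (Corner g Z)] [IsScalarTower K B (Corner g Z)] in
lemma overlapMap_word
    (t : leftIdeal a ⊗[K] (localCharKer b χB ⊗[K] fixedBy K a (Corner f Z))) :
    H.overlapMap Z (H.actTensor (H.overlapWord Z) t) =
      H.actTensor (H.localWord (Corner f Z)) t := by
  induction t with
  | zero => simp
  | add x y hx hy => simp only [map_add, hx, hy]
  | tmul x s =>
    rw [actTensor_tmul, map_smul, actTensor_tmul]
    congr 1
    induction s with
    | zero => simp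
    | add x y hx hy => simp only [map_add, hx, hy]
    | tmul y z => rfl

/-- The corner of `L e ⊗ eZ` at `f(1)` is spanned by the elements `f(x) ⊗ z` and
`f(x) g(y) ⊗ z` with `χ y = 0`. -/
lemma exists_overlap_decomp [Module.Finite K L] (c : leftIdeal e ⊗[K] fixedBy K e Z) :
    ∃ (t : leftIdeal a ⊗[K] fixedBy K b (Corner g Z))
      (s : leftIdeal a ⊗[K] (localCharKer b χB ⊗[K] fixedBy K a (Corner f Z))),
      f 1 • c = H.actTensor (H.overlapUnit Z) t + H.actTensor (H.overlapWord Z) s := by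
  induction c with
  | zero => exact ⟨0, 0, by simp⟩
  | add x y hx hy =>
    obtain ⟨t, s, h⟩ := hx
    obtain ⟨t', s', h'⟩ := hy
    exact ⟨t + t', s + s', by rw [smul_add, h, h', map_add, map_add, add_add_add_comm]⟩
  | tmul l z =>
    let zf : fixedBy K a (Corner f Z) := ⟨H.fixedToCorner Z z, Corner.ext (by
      change f a • (z : Z) = z
      rw [H.map_left]; exact z.2)⟩
    let zg : fixedBy K b (Corner g Z) := ⟨H.symm.fixedToCorner Z z, Corner.ext (by
      change g b • (z : Z) = z
      rw [H.map_right]; exact z.2)⟩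
    have h0 : g 1 * e = e := by rw [← H.map_right, ← map_mul, one_mul]
    have h1 : f 1 * (l : L) = f 1 * l * g 1 * e := by
      rw [mul_assoc _ (g 1), h0, mul_assoc, mem_leftIdeal.1 l.2]
    have h2 := H.mul_mem_span (l : L)
    have h3 : f 1 • l = (⟨f 1 * l * g 1 * e, by
        rw [mem_leftIdeal, mul_assoc, H.e_mul_e]⟩ : leftIdeal e) := Subtype.ext h1
    rw [TensorProduct.smul_tmul', h3]
    generalize f 1 * (l : L) * g 1 = w at h2
    induction h2 using Submodule.span_induction with
    | mem w hw =>
      obtain ⟨x, y, rfl⟩ := hw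
      obtain ⟨s, hs, hs'⟩ := H.symm.corner_eq y
      refine ⟨(χB y • toLeftIdeal H.idem_left x) ⊗ₜ zg,
        toLeftIdeal H.idem_left x ⊗ₜ ((⟨s, hs⟩ : localCharKer b χB) ⊗ₜ zf), ?_⟩
      rw [actTensor_tmul, actTensor_tmul]
      change _ = f (χB y • (x * a)) • (_ ⊗ₜ z) + f (x * a) • (_ ⊗ₜ z)
      rw [TensorProduct.smul_tmul', TensorProduct.smul_tmul', ← TensorProduct.add_tmul]
      congr 1
      refine Subtype.ext ?_
      change f x * g y * e = f (χB y • (x * a)) * e + f (x * a) * g s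
      rw [mul_assoc, H.symm.map_mul_e, H.map_mul_map, ← mul_assoc b, hs', map_add,
        H.map_smul_left, H.map_smul_right, H.map_right, mul_add, mul_smul_comm, smul_mul_assoc]
    | zero =>
      refine ⟨0, 0, ?_⟩
      rw [map_zero, map_zero, add_zero]
      refine (congrArg (fun v : leftIdeal e => v ⊗ₜ z) (Subtype.ext ?_)).trans
        (TensorProduct.zero_tmul _ _)
      exact zero_mul e
    | add u v _ _ hu hv =>
      obtain ⟨t, s, h⟩ := hu
      obtain ⟨t', s', h'⟩ := hv
      refine ⟨t + t', s + s', ?_⟩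
      rw [map_add, map_add, add_add_add_comm, ← h, ← h', ← TensorProduct.add_tmul]
      congr 1
      exact Subtype.ext (add_mul _ _ _)
    | smul k u _ hu =>
      obtain ⟨t, s, h⟩ := hu
      refine ⟨k • t, k • s, ?_⟩
      rw [map_smul, map_smul, ← smul_add, ← h, TensorProduct.smul_tmul']
      congr 1
      exact Subtype.ext (smul_mul_assoc _ _ _)

lemma smul_eq_zero_of_overlapMap [Module.Finite K L] (c : leftIdeal e ⊗[K] fixedBy K e Z)
    (h1 : H.overlapMap Z c = 0) (h2 : H.symm.overlapMap Z c = 0) : f 1 • c = 0 := by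
  obtain ⟨t, s, h⟩ := H.exists_overlap_decomp Z c
  obtain ⟨x, hx⟩ := H.overlapMap_unit Z t
  have h3 : Induced.of f x + H.actTensor (H.localWord (Corner f Z)) s = 0 := by
    rw [← hx, ← overlapMap_word, ← map_add, ← h, map_smul, h1, smul_zero]
  have h4 : x = 0 := by
    have := congrArg (H.retr _) h3
    rw [retr_add, retr_of, retr_actTensor_localWord, add_zero] at this
    exact this.trans (congrArg Prod.fst (map_zero (H.toExtension _)))
  have h5 : s = 0 := by
    rw [h4, map_zero, zero_add] at h3
    exact H.actTensor_localWord_injective (h3.trans (map_zero _).symm)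
  have h6 : t = 0 := by
    refine H.actTensor_fixedUnit_injective (Y := Corner g Z) ?_
    rw [← overlapMap_symm_unit, map_zero]
    rw [h5, map_zero, add_zero] at h
    rw [← h, map_smul, h2, smul_zero]
  rw [h, h5, h6, map_zero, map_zero, add_zero]

/-- Exactness in the middle of the Mayer–Vietoris sequence, on the corner at `f(1)`. -/
lemma exists_overlap_corner [Module.Finite K L] {u : Induced f (Corner f Z)}
    {v : Induced g (Corner g Z)} (hu : f 1 • u = u) (hv : f 1 • v = v)
    (h : counit f Z u + counit g Z v = 0) :
    ∃ c, H.overlapMap Z c = u ∧ H.symm.overlapMap Z c = -v := by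
  obtain ⟨t, ht⟩ := H.exists_actTensor_fixedUnit hv
  obtain ⟨⟨x, n⟩, hx⟩ := (H.cornerProdEquiv (Corner f Z)).surjective (Corner.mk f u hu)
  obtain ⟨s, hs⟩ := H.exists_actTensor_localWord n.2
  have hu' : Induced.of f x + H.actTensor (H.localWord _) s = u := by
    rw [← val_cornerTensor, hs]
    exact congrArg Corner.val hx
  -- the second component of `overlapWord s` is corrected by an element of `A a ⊗ eZ`
  obtain ⟨t', ht'⟩ := H.exists_actTensor_fixedUnit (v := H.symm.overlapMap Z
    (H.actTensor (H.overlapWord Z) s)) (by rw [← map_smul, ← actTensor_smul, one_smul])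
  obtain ⟨y, hy⟩ := H.overlapMap_unit Z (t + t')
  let c := H.actTensor (H.overlapWord Z) s - H.actTensor (H.overlapUnit Z) (t + t')
  have h2 : H.symm.overlapMap Z c = -v := by
    rw [map_sub, overlapMap_symm_unit, map_add, ht, ht']
    abel
  have h1 : H.overlapMap Z c + Induced.of f (x + y) = u := by
    rw [map_sub, overlapMap_word, hy, ← hu', map_add]
    abel
  have h3 : Corner.val (x + y) = 0 := by
    have h4 := congrArg (counit f Z) h1
    rw [map_add, counit_overlapMap, h2, map_neg, counit_of] at h4
    rw [neg_add_eq_iff_eq_add] at h4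
    rw [h4, add_comm, h]
  refine ⟨c, ?_, h2⟩
  rw [← h1, Corner.ext (h3.trans (map_zero _).symm), map_zero, add_zero]

/-- The first map of the Mayer–Vietoris sequence
`0 → L e ⊗ eZ → (L ⊗_A f(1) Z) ⊕ (L ⊗_B g(1) Z) → Z → 0`. -/
noncomputable def mvLeft : leftIdeal e ⊗[K] fixedBy K e Z →ₗ[L]
    Induced f (Corner f Z) × Induced g (Corner g Z) :=
  LinearMap.prod (H.overlapMap Z) (-H.symm.overlapMap Z)

lemma mvLeft_injective [Module.Finite K L] : Function.Injective (H.mvLeft Z) := by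
  refine (injective_iff_map_eq_zero _).2 fun c hc => ?_
  have h1 : H.overlapMap Z c = 0 := congrArg Prod.fst hc
  have h2 : H.symm.overlapMap Z c = 0 := neg_eq_zero.1 (congrArg Prod.snd hc)
  have h3 := H.smul_eq_zero_of_overlapMap Z c h1 h2
  have h4 := H.symm.smul_eq_zero_of_overlapMap Z c h2 h1
  have h5 := H.sub_smul_fixed c
  rw [h3, sub_zero, h4] at h5
  exact h5.symm

lemma mv_exact [Module.Finite K L] : Function.Exact (H.mvLeft Z) (mvRight f g Z) := by
  rintro ⟨u, v⟩
  constructor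
  · intro h
    have h0 : counit f Z u + counit g Z v = 0 := h
    have hf : f 1 * f 1 = f 1 := by rw [← map_mul, one_mul]
    obtain ⟨c, hc1, hc2⟩ := H.exists_overlap_corner Z (u := f 1 • u) (v := f 1 • v)
      (by rw [smul_smul, hf]) (by rw [smul_smul, hf])
      (by rw [map_smul, map_smul, ← smul_add, h0, smul_zero])
    obtain ⟨d, hd1, hd2⟩ := H.symm.exists_overlap_corner Z (u := v - f 1 • v) (v := u - f 1 • u)
      (H.sub_smul_fixed _) (H.sub_smul_fixed _) (by
        rw [map_sub, map_sub, map_smul, map_smul, add_comm, sub_add_sub_comm, h0, ← smul_add, h0,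
          smul_zero, sub_zero])
    refine ⟨c - d, Prod.ext ?_ ?_⟩
    · change H.overlapMap Z (c - d) = u
      rw [map_sub, hc1, hd2]
      abel
    · change -H.symm.overlapMap Z (c - d) = v
      rw [map_sub, hc2, hd1]
      abel
  · rintro ⟨c, hc⟩
    rw [← hc]
    change counit f Z (H.overlapMap Z c) + counit g Z (-H.symm.overlapMap Z c) = 0
    rw [map_neg, counit_overlapMap, add_neg_cancel]

end MayerVietoris

end IsGluing

end SimpleGluing

namespace SimpleGluing

/-! ### Cosyzygies and Gorenstein projective modules -/

section Cosyzygy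

variable {R : Type u} [Ring R]

/-- A short exact sequence `0 → M → I → N → 0` with `I` finitely generated projective such that
the morphisms from `M` to finitely generated projective modules extend to `I`. -/
structure CosyzygyData (M N : ModuleCat.{u} R) where
  I : ModuleCat.{u} R
  ι : M ⟶ I
  π : I ⟶ N
  finite : Module.Finite R I
  projective : Module.Projective R I
  injective : Function.Injective ι
  exact : Function.Exact ι π
  surjective : Function.Surjective π
  extend : ∀ (Q : ModuleCat.{u} R) (f : M ⟶ Q), Module.Finite R Q → Module.Projective R Q →
    ∃ g : I ⟶ Q, ι ≫ g = f

/-- The first extension groups of `M` with values in finitely generated projective modules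
vanish. -/
def ExtVanishing (M : ModuleCat.{u} R) : Prop :=
  ∀ Q : ModuleCat.{u} R, Module.Finite R Q → Module.Projective R Q →
    ∀ x : Abelian.Ext M Q 1, x = 0

lemma shortExact_of_exact {M N P : ModuleCat.{u} R} {f : M ⟶ N} {g : N ⟶ P}
    (hf : Function.Injective f) (hfg : Function.Exact f g) (hg : Function.Surjective g) :
    ∃ w : f ≫ g = 0, (ShortComplex.mk f g w).ShortExact :=
  ⟨by ext x; exact hfg.apply_apply_eq_zero x,
    { exact := (ShortComplex.ShortExact.moduleCat_exact_iff_function_exact _).2 hfg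
      mono_f := (ModuleCat.mono_iff_injective f).2 hf
      epi_g := (ModuleCat.epi_iff_surjective g).2 hg }⟩

lemma projective_of_module {P : ModuleCat.{u} R} (h : Module.Projective R P) : Projective P :=
  (IsProjective.iff_projective (R := R) P).1 h

lemma CosyzygyData.extVanishing {M N : ModuleCat.{u} R} (S : CosyzygyData M N) :
    ExtVanishing N := by
  intro Q h1 h2 x
  obtain ⟨w, hS⟩ := shortExact_of_exact S.injective S.exact S.surjective
  have := projective_of_module S.projective
  obtain ⟨y, rfl⟩ := Abelian.Ext.contravariant_sequence_exact₃ hS Q x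
    (Abelian.Ext.eq_zero_of_projective (P := S.I) _) (n₀ := 0) rfl
  obtain ⟨h, rfl⟩ : ∃ h, y = Abelian.Ext.mk₀ h := ⟨_, (Abelian.Ext.mk₀_homEquiv₀_apply y).symm⟩
  obtain ⟨k, rfl⟩ := S.extend Q h h1 h2
  rw [← Abelian.Ext.mk₀_comp_mk₀, hS.extClass_comp_assoc]

lemma ExtVanishing.of_exact {M N P : ModuleCat.{u} R} {f : M ⟶ N} {g : N ⟶ P}
    (hf : Function.Injective f) (hfg : Function.Exact f g) (hg : Function.Surjective g)
    (hM : Module.Projective R M) (hP : ExtVanishing P) : ExtVanishing N := by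
  intro Q h1 h2 x
  obtain ⟨w, hS⟩ := shortExact_of_exact hf hfg hg
  have := projective_of_module hM
  obtain ⟨y, rfl⟩ := Abelian.Ext.contravariant_sequence_exact₂ hS Q x
    (Abelian.Ext.eq_zero_of_projective (P := M) _)
  rw [hP Q h1 h2 y, Abelian.Ext.comp_zero]

lemma ExtVanishing.of_retract {M N : ModuleCat.{u} R} (i : M ⟶ N) (p : N ⟶ M) (h : i ≫ p = 𝟙 M)
    (hN : ExtVanishing N) : ExtVanishing M := by
  intro Q h1 h2 x
  rw [← Abelian.Ext.mk₀_id_comp x, ← h, ← Abelian.Ext.mk₀_comp_mk₀_assoc,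
    hN Q h1 h2 ((Abelian.Ext.mk₀ p).comp x (zero_add 1)), Abelian.Ext.comp_zero]

lemma ExtVanishing.exists_extension {M N P : ModuleCat.{u} R} {f : M ⟶ N} {g : N ⟶ P}
    (hf : Function.Injective f) (hfg : Function.Exact f g) (hg : Function.Surjective g)
    (hP : ExtVanishing P) (Q : ModuleCat.{u} R) (h : M ⟶ Q) (h1 : Module.Finite R Q)
    (h2 : Module.Projective R Q) : ∃ k : N ⟶ Q, f ≫ k = h := by
  obtain ⟨w, hS⟩ := shortExact_of_exact hf hfg hg
  obtain ⟨y, hy⟩ := Abelian.Ext.contravariant_sequence_exact₁ hS Q (Abelian.Ext.mk₀ h)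
    (n₁ := 1) rfl (hP Q h1 h2 _)
  obtain ⟨k, rfl⟩ : ∃ k, y = Abelian.Ext.mk₀ k := ⟨_, (Abelian.Ext.mk₀_homEquiv₀_apply y).symm⟩
  rw [Abelian.Ext.mk₀_comp_mk₀] at hy
  exact ⟨k, (Abelian.Ext.mk₀_bijective _ _).1 hy⟩

lemma ExtVanishing.exists_section {M N P : ModuleCat.{u} R} {f : M ⟶ N} {g : N ⟶ P}
    (hf : Function.Injective f) (hfg : Function.Exact f g) (hg : Function.Surjective g)
    (hM : Module.Finite R M) (hM' : Module.Projective R M) (hP : ExtVanishing P) :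
    ∃ s : P ⟶ N, s ≫ g = 𝟙 P := by
  obtain ⟨w, hS⟩ := shortExact_of_exact hf hfg hg
  obtain ⟨y, hy⟩ := Abelian.Ext.covariant_sequence_exact₃ P hS (Abelian.Ext.mk₀ (𝟙 P))
    (n₁ := 1) rfl (hP M hM hM' _)
  obtain ⟨k, rfl⟩ : ∃ k, y = Abelian.Ext.mk₀ k := ⟨_, (Abelian.Ext.mk₀_homEquiv₀_apply y).symm⟩
  rw [Abelian.Ext.mk₀_comp_mk₀] at hy
  exact ⟨k, (Abelian.Ext.mk₀_bijective _ _).1 hy⟩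

/-- Replace the outer terms of a cosyzygy sequence by isomorphic modules. -/
def CosyzygyData.ofIso {M N M' N' : ModuleCat.{u} R} (S : CosyzygyData M N) (e : M' ≅ M)
    (e' : N ≅ N') : CosyzygyData M' N' where
  I := S.I
  ι := e.hom ≫ S.ι
  π := S.π ≫ e'.hom
  finite := S.finite
  projective := S.projective
  injective := S.injective.comp e.toLinearEquiv.injective
  exact := by
    intro x
    have h : (S.π ≫ e'.hom) x = 0 ↔ S.π x = 0 :=
      e'.toLinearEquiv.map_eq_zero_iff (x := S.π x)
    rw [h, S.exact x]
    constructor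
    · rintro ⟨y, rfl⟩
      exact ⟨e.inv y, by simp⟩
    · rintro ⟨y, rfl⟩
      exact ⟨e.hom y, rfl⟩
  surjective := e'.toLinearEquiv.surjective.comp S.surjective
  extend Q f h1 h2 := by
    obtain ⟨g, hg⟩ := S.extend Q (e.inv ≫ f) h1 h2
    exact ⟨g, by rw [Category.assoc, hg, Iso.hom_inv_id_assoc]⟩

/-- The cosyzygy sequence given by two consecutive kernels of a totally acyclic complex. -/
def TotallyAcyclicComplex.cosyzygyData (P : TotallyAcyclicComplex R) (i : ℤ) :
    CosyzygyData (ModuleCat.of R (LinearMap.ker (P.d i).hom))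
      (ModuleCat.of R (LinearMap.ker (P.d (i + 1)).hom)) where
  I := P.X i
  ι := ModuleCat.ofHom (LinearMap.ker (P.d i).hom).subtype
  π := ModuleCat.ofHom ((P.d i).hom.codRestrict _ fun x => (P.exact i).apply_apply_eq_zero x)
  finite := P.finite i
  projective := P.projective i
  injective := Subtype.val_injective
  exact y := by
    constructor
    · intro hy
      exact ⟨⟨y, congrArg Subtype.val hy⟩, rfl⟩
    · rintro ⟨x, rfl⟩
      exact Subtype.ext x.2
  surjective := by
    rintro ⟨y, hy⟩
    obtain ⟨x, hx⟩ := (P.exact i y).1 hy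
    exact ⟨x, Subtype.ext hx⟩
  extend Q f h1 h2 := by
    obtain ⟨g, hg⟩ := P.extend i Q f.hom
    exact ⟨ModuleCat.ofHom g, by ext x; exact hg x⟩

/-- A sequence of cosyzygies, indexed by the integers, gives a totally acyclic complex. -/
def TotallyAcyclicComplex.ofCosyzygyData (G : ℤ → ModuleCat.{u} R)
    (S : ∀ i, CosyzygyData (G i) (G (i + 1))) : TotallyAcyclicComplex R where
  X i := (S i).I
  d i := (S i).π ≫ (S (i + 1)).ι
  finite i := (S i).finite
  projective i := (S i).projective
  exact i y := by
    constructor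
    · intro hy
      obtain ⟨x, rfl⟩ := ((S (i + 1)).exact y).1
        ((S (i + 1 + 1)).injective (hy.trans (map_zero (S (i + 1 + 1)).ι.hom).symm))
      obtain ⟨z, rfl⟩ := (S i).surjective x
      exact ⟨z, rfl⟩
    · rintro ⟨x, rfl⟩
      have := (S (i + 1)).exact.apply_apply_eq_zero ((S i).π x)
      change (S (i + 1 + 1)).ι ((S (i + 1)).π ((S (i + 1)).ι ((S i).π x))) = 0
      rw [this, map_zero]
  hom_exact i h := by
    constructor
    · intro hh
      have h0 : (S (i + 1)).ι ≫ h = 0 := by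
        ext x
        obtain ⟨y, rfl⟩ := (S i).surjective x
        exact congrArg (fun k => k.hom y) hh
      obtain ⟨w, hS⟩ := shortExact_of_exact (S (i + 1)).injective (S (i + 1)).exact
        (S (i + 1)).surjective
      have := hS.epi_g
      obtain ⟨k, hk⟩ : ∃ k, (S (i + 1)).π ≫ k = h :=
        ⟨hS.exact.desc h h0, hS.exact.g_desc h h0⟩
      obtain ⟨l, hl⟩ := (S (i + 1 + 1)).extend (ModuleCat.of R R) k inferInstance inferInstance
      exact ⟨l, by
        change ((S (i + 1)).π ≫ (S (i + 1 + 1)).ι) ≫ l = h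
        rw [Category.assoc, hl, hk]⟩
    · rintro ⟨k, rfl⟩
      ext x
      have := (S (i + 1)).exact.apply_apply_eq_zero ((S i).π x)
      change k ((S (i + 1 + 1)).ι ((S (i + 1)).π ((S (i + 1)).ι ((S i).π x)))) = 0
      rw [this, map_zero, map_zero]

lemma isGorensteinProjective_of_cosyzygyData (G : ℤ → ModuleCat.{u} R)
    (S : ∀ i, CosyzygyData (G i) (G (i + 1))) : isGorensteinProjective R (G 0) := by
  refine ⟨TotallyAcyclicComplex.ofCosyzygyData G S, ⟨LinearEquiv.ofBijective
    ((S 0).ι.hom.codRestrict _ fun x => ?_) ⟨fun x y h => ?_, ?_⟩⟩⟩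
  · change (S (0 + 1)).ι ((S 0).π ((S 0).ι x)) = 0
    rw [(S 0).exact.apply_apply_eq_zero, map_zero]
  · exact (S 0).injective (congrArg Subtype.val h)
  · rintro ⟨y, hy⟩
    obtain ⟨x, hx⟩ := ((S 0).exact y).1
      ((S (0 + 1)).injective (hy.trans (map_zero (S (0 + 1)).ι.hom).symm))
    exact ⟨x, Subtype.ext hx⟩

/-- A class of modules, each of which has a cosyzygy and is a cosyzygy of a module of the class,
consists of Gorenstein projective modules. -/
lemma isGorensteinProjective_of_closed (C : ModuleCat.{u} R → Prop)
    (right : ∀ M, C M → ∃ N, C N ∧ Nonempty (CosyzygyData M N))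
    (left : ∀ N, C N → ∃ M, C M ∧ Nonempty (CosyzygyData M N)) (M : ModuleCat.{u} R) (hM : C M) :
    isGorensteinProjective R M := by
  choose r hr hr' using right
  choose l hl hl' using left
  let seqR : ℕ → {M // C M} := fun n => Nat.rec ⟨M, hM⟩ (fun _ N => ⟨r N.1 N.2, hr N.1 N.2⟩) n
  let seqL : ℕ → {M // C M} := fun n => Nat.rec ⟨M, hM⟩ (fun _ N => ⟨l N.1 N.2, hl N.1 N.2⟩) n
  let G : ℤ → ModuleCat.{u} R := fun i =>
    match i with
    | Int.ofNat n => (seqR n).1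
    | Int.negSucc n => (seqL (n + 1)).1
  have hG : ∀ i, Nonempty (CosyzygyData (G i) (G (i + 1))) := by
    intro i
    match i with
    | Int.ofNat n => exact hr' (seqR n).1 (seqR n).2
    | Int.negSucc 0 => exact hl' (seqL 0).1 (seqL 0).2
    | Int.negSucc (n + 1) => exact hl' (seqL (n + 1)).1 (seqL (n + 1)).2
  exact isGorensteinProjective_of_cosyzygyData G fun i => (hG i).some

lemma isGorensteinProjective_of_iso {M N : ModuleCat.{u} R} (e : M ≅ N)
    (hM : isGorensteinProjective R M) : isGorensteinProjective R N := by
  obtain ⟨P, ⟨e'⟩⟩ := hM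
  exact ⟨P, ⟨e.symm.toLinearEquiv.trans e'⟩⟩

lemma isGorensteinProjective_ker (P : TotallyAcyclicComplex R) (i : ℤ) :
    isGorensteinProjective R (ModuleCat.of R (LinearMap.ker (P.d i).hom)) := by
  refine isGorensteinProjective_of_closed
    (fun M => ∃ i, Nonempty (M ≅ ModuleCat.of R (LinearMap.ker (P.d i).hom))) ?_ ?_ _
    ⟨i, ⟨Iso.refl _⟩⟩
  · rintro M ⟨i, ⟨e⟩⟩
    exact ⟨_, ⟨i + 1, ⟨Iso.refl _⟩⟩, ⟨(P.cosyzygyData i).ofIso e (Iso.refl _)⟩⟩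
  · rintro N ⟨i, ⟨e⟩⟩
    obtain ⟨j, rfl⟩ : ∃ j : ℤ, i = j + 1 := ⟨i - 1, by ring⟩
    exact ⟨_, ⟨j, ⟨Iso.refl _⟩⟩, ⟨(P.cosyzygyData j).ofIso (Iso.refl _) e.symm⟩⟩

lemma exists_cosyzygyData {M : ModuleCat.{u} R} (hM : isGorensteinProjective R M) :
    ∃ N, isGorensteinProjective R N ∧ Nonempty (CosyzygyData M N) := by
  obtain ⟨P, ⟨e⟩⟩ := hM
  exact ⟨_, isGorensteinProjective_ker P 1,
    ⟨(P.cosyzygyData 0).ofIso e.toModuleIso (Iso.refl _)⟩⟩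

lemma exists_cosyzygyData' {N : ModuleCat.{u} R} (hN : isGorensteinProjective R N) :
    ∃ M, isGorensteinProjective R M ∧ Nonempty (CosyzygyData M N) := by
  obtain ⟨P, ⟨e⟩⟩ := hN
  exact ⟨_, isGorensteinProjective_ker P (-1),
    ⟨(P.cosyzygyData (-1)).ofIso (Iso.refl _) e.symm.toModuleIso⟩⟩

lemma extVanishing_of_isGorensteinProjective {M : ModuleCat.{u} R}
    (hM : isGorensteinProjective R M) : ExtVanishing M := by
  obtain ⟨_, _, ⟨S⟩⟩ := exists_cosyzygyData' hM
  exact S.extVanishing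

lemma finite_of_isGorensteinProjective {M : ModuleCat.{u} R}
    (hM : isGorensteinProjective R M) : Module.Finite R M := by
  obtain ⟨_, _, ⟨S⟩⟩ := exists_cosyzygyData' hM
  have := S.finite
  exact Module.Finite.of_surjective S.π.hom S.surjective

/-- A projective direct summand can be removed from a Gorenstein projective module. -/
lemma isGorensteinProjective_of_prod {M Q : Type u} [AddCommGroup M] [Module R M]
    [AddCommGroup Q] [Module R Q] [Module.Finite R Q] [Module.Projective R Q]
    (h : isGorensteinProjective R (ModuleCat.of R (M × Q))) :
    isGorensteinProjective R (ModuleCat.of R M) := by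
  refine isGorensteinProjective_of_closed (fun M => isGorensteinProjective R M ∨
    ∃ Q : ModuleCat.{u} R, Module.Finite R Q ∧ Module.Projective R Q ∧
      isGorensteinProjective R (ModuleCat.of R (M × Q))) ?_ ?_ _
      (Or.inr ⟨ModuleCat.of R Q, inferInstance, inferInstance, h⟩)
  · rintro M (hM | ⟨Q, h1, h2, hM⟩)
    · obtain ⟨N, hN, S⟩ := exists_cosyzygyData hM
      exact ⟨N, Or.inl hN, S⟩
    obtain ⟨N, hN, ⟨S⟩⟩ := exists_cosyzygyData hM
    obtain ⟨q, hq⟩ := S.extend Q (ModuleCat.ofHom (LinearMap.snd R M Q)) h1 h2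
    have hq' : ∀ p : M × Q, q (S.ι p) = p.2 := fun p => congrArg (fun k => k.hom p) hq
    -- `I` is the direct sum of the kernel of `q` and the image of `Q`
    let r : S.I →ₗ[R] LinearMap.ker q.hom :=
      (LinearMap.id - S.ι.hom ∘ₗ LinearMap.inr R M Q ∘ₗ q.hom).codRestrict _ fun x => by
        rw [LinearMap.mem_ker, LinearMap.sub_apply, map_sub]
        exact sub_eq_zero.2 (hq' (0, q x)).symm
    have hr : ∀ x : LinearMap.ker q.hom, r x = x := fun x => Subtype.ext (by
      have hx : q.hom (x : S.I) = 0 := x.2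
      simp only [r, LinearMap.codRestrict_apply, LinearMap.sub_apply, LinearMap.comp_apply, hx,
        map_zero, sub_zero, LinearMap.id_apply])
    have := S.finite
    have := S.projective
    refine ⟨N, Or.inl hN, ⟨⟨ModuleCat.of R (LinearMap.ker q.hom), ModuleCat.ofHom
      ((S.ι.hom ∘ₗ LinearMap.inl R M Q).codRestrict _ fun x => hq' (x, 0)),
      ModuleCat.ofHom (S.π.hom ∘ₗ (LinearMap.ker q.hom).subtype),
      Module.Finite.of_surjective r fun x => ⟨x, hr x⟩,
      Module.Projective.of_split (LinearMap.ker q.hom).subtype r (LinearMap.ext hr), ?_, ?_, ?_, ?_⟩⟩⟩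
    · intro x y hxy
      exact congrArg Prod.fst (S.injective (congrArg Subtype.val hxy))
    · intro y
      constructor
      · intro hy
        obtain ⟨p, hp⟩ := (S.exact (y : S.I)).1 hy
        have h3 : p.2 = 0 := by
          rw [← hq' p, hp]
          exact y.2
        exact ⟨p.1, Subtype.ext (by rw [← hp]; exact congrArg S.ι (Prod.ext rfl h3.symm))⟩
      · rintro ⟨x, rfl⟩
        exact S.exact.apply_apply_eq_zero (x, 0)
    · intro y
      obtain ⟨x, rfl⟩ := S.surjective y
      refine ⟨r x, ?_⟩
      change S.π (x - S.ι (0, q x)) = _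
      rw [map_sub, S.exact.apply_apply_eq_zero, sub_zero]
    · intro Q' k h3 h4
      obtain ⟨l, hl⟩ := S.extend Q' (ModuleCat.ofHom (k.hom ∘ₗ LinearMap.fst R M Q)) h3 h4
      refine ⟨ModuleCat.ofHom (l.hom ∘ₗ (LinearMap.ker q.hom).subtype), ?_⟩
      ext x
      exact congrArg (fun k => k.hom ((x, 0) : M × Q)) hl
  · rintro N (hN | ⟨Q, h1, h2, hN⟩)
    · obtain ⟨M, hM, S⟩ := exists_cosyzygyData' hN
      exact ⟨M, Or.inl hM, S⟩
    obtain ⟨M, hM, ⟨S⟩⟩ := exists_cosyzygyData' hN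
    let q : S.I →ₗ[R] Q := LinearMap.snd R N Q ∘ₗ S.π.hom
    have hq : Function.Surjective q := fun y => by
      obtain ⟨x, hx⟩ := S.surjective (0, y)
      exact ⟨x, congrArg Prod.snd hx⟩
    obtain ⟨s, hs⟩ := Module.projective_lifting_property q LinearMap.id hq
    have hs' : ∀ y, q (s y) = y := LinearMap.congr_fun hs
    let r : S.I →ₗ[R] LinearMap.ker q :=
      (LinearMap.id - s ∘ₗ q).codRestrict _ fun x => by simp [hs']
    have hr : ∀ x : LinearMap.ker q, r x = x := fun x => Subtype.ext (by
      have hx : q (x : S.I) = 0 := x.2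
      simp [r, hx])
    have := S.finite
    have := S.projective
    refine ⟨M, Or.inl hM, ⟨⟨ModuleCat.of R (LinearMap.ker q), ModuleCat.ofHom
      (S.ι.hom.codRestrict _ fun x => congrArg Prod.snd (S.exact.apply_apply_eq_zero x)),
      ModuleCat.ofHom (LinearMap.fst R N Q ∘ₗ S.π.hom ∘ₗ (LinearMap.ker q).subtype),
      Module.Finite.of_surjective r fun x => ⟨x, hr x⟩,
      Module.Projective.of_split (LinearMap.ker q).subtype r (LinearMap.ext hr), ?_, ?_, ?_, ?_⟩⟩⟩
    · intro x y hxy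
      exact S.injective (congrArg Subtype.val hxy)
    · intro y
      constructor
      · intro hy
        obtain ⟨x, hx⟩ := (S.exact (y : S.I)).1 (Prod.ext hy y.2)
        exact ⟨x, Subtype.ext hx⟩
      · rintro ⟨x, rfl⟩
        exact congrArg Prod.fst (S.exact.apply_apply_eq_zero x)
    · intro y
      obtain ⟨x, hx⟩ := S.surjective (y, 0)
      exact ⟨⟨x, congrArg Prod.snd hx⟩, congrArg Prod.fst hx⟩
    · intro Q' k h3 h4
      obtain ⟨l, hl⟩ := S.extend Q' k h3 h4
      refine ⟨ModuleCat.ofHom (l.hom ∘ₗ (LinearMap.ker q).subtype), ?_⟩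
      ext x
      exact congrArg (fun k => k.hom x) hl

end Cosyzygy

end SimpleGluing

namespace SimpleGluing

namespace IsGluing

/-! ### Gorenstein projective modules over a gluing -/

section GorensteinProjective

variable {K : Type u} [Field K] {A B L : Type u} [Ring A] [Algebra K A] [Ring B] [Algebra K B]
  [Ring L] [Algebra K L]
variable {f : A →ₙ+* L} {g : B →ₙ+* L} {a : A} {b : B} {e : L} {χA : A →ₐ[K] K} {χB : B →ₐ[K] K}
variable (H : IsGluing f g a b e χA χB)

variable (K A) in
/-- The vector space underlying a module over a `K`-algebra. -/
abbrev _root_.SimpleGluing.fieldModule (X : Type u) [AddCommGroup X] [Module A X] : Module K X :=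
  Module.compHom X (algebraMap K A)

variable (K A) in
lemma _root_.SimpleGluing.fieldModule_tower (X : Type u) [AddCommGroup X] [Module A X] :
    letI := fieldModule K A X
    IsScalarTower K A X :=
  letI := fieldModule K A X
  IsScalarTower.of_algebraMap_smul fun _ _ => rfl

section Unbundled

variable {X X' X'' : Type u} [AddCommGroup X] [Module A X] [AddCommGroup X'] [Module A X']
  [AddCommGroup X''] [Module A X''] {Y : Type u} [AddCommGroup Y] [Module B Y]

include H

lemma induced_exact {h : X →ₗ[A] X'} {k : X' →ₗ[A] X''} (hk : Function.Exact h k) :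
    Function.Exact (inducedMap f h) (inducedMap f k) :=
  letI := fieldModule K A X
  letI := fieldModule K A X'
  letI := fieldModule K A X''
  haveI := fieldModule_tower K A X
  haveI := fieldModule_tower K A X'
  haveI := fieldModule_tower K A X''
  H.map_exact hk

lemma induced_injective {h : X →ₗ[A] X'} (hh : Function.Injective h) :
    Function.Injective (inducedMap f h) :=
  letI := fieldModule K A X
  letI := fieldModule K A X'
  haveI := fieldModule_tower K A X
  haveI := fieldModule_tower K A X'
  H.map_injective hh

lemma finite_left [Module.Finite K L] : Module.Finite K A :=
  Module.Finite.of_injective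
    ({ toFun := f, map_add' := map_add f, map_smul' := H.map_smul_left } : A →ₗ[K] L) H.injective

variable (X) in
/-- The `A`-linear retraction of the unit `X → f(1) (L ⊗_A X)`. -/
noncomputable def cornerRetr : Corner f (Induced f X) →ₗ[A] X :=
  letI := fieldModule K A X
  haveI := fieldModule_tower K A X
  { toFun := fun u => H.retr X (Corner.val u)
    map_add' := fun u v => by rw [map_add, retr_add]
    map_smul' := fun r u => by rw [Corner.val_smul, retr_smul, RingHom.id_apply] }

lemma cornerRetr_unit (x : X) : H.cornerRetr X (Corner.unit f X x) = x :=
  letI := fieldModule K A X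
  haveI := fieldModule_tower K A X
  H.retr_of x

lemma finite_field [Module.Finite K L] [Module.Finite A X] :
    letI := fieldModule K A X
    Module.Finite K X :=
  letI := fieldModule K A X
  haveI := fieldModule_tower K A X
  haveI := H.finite_left
  Module.Finite.trans A X

variable (X) in
lemma finite_projective_ker_cornerRetr [Module.Finite K L] [Module.Finite A X] :
    Module.Finite A (LinearMap.ker (H.cornerRetr X)) ∧
      Module.Projective A (LinearMap.ker (H.cornerRetr X)) := by
  let _ := fieldModule K A X
  have := fieldModule_tower K A X
  have := H.finite_field (X := X)
  have := H.symm.finite_left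
  have h1 : Module.Finite A (leftIdeal a ⊗[K] (localCharKer b χB ⊗[K] fixedBy K a X)) :=
    finite_leftIdeal_tensor H.idem_left _
  have h2 : Module.Projective A (leftIdeal a ⊗[K] (localCharKer b χB ⊗[K] fixedBy K a X)) :=
    projective_leftIdeal_tensor H.idem_left (localCharKer b χB ⊗[K] fixedBy K a X)
  have h3 : LinearMap.ker (H.cornerRetr X) = H.retrKer X := rfl
  rw [h3]
  exact ⟨Module.Finite.equiv (H.retrKerEquiv X), Module.Projective.of_equiv (H.retrKerEquiv X)⟩

variable (Y) in
lemma projective_corner_right [Module.Finite K L] :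
    Module.Projective A (Corner f (Induced g Y)) := by
  let _ := fieldModule K B Y
  have := fieldModule_tower K B Y
  have h2 : Module.Projective A (leftIdeal a ⊗[K] fixedBy K b Y) :=
    projective_leftIdeal_tensor H.idem_left _
  exact Module.Projective.of_equiv (H.cornerEquiv Y)

variable (X) in
lemma projective_corner_left [Module.Finite K L] [Module.Finite A X] [Module.Projective A X] :
    Module.Projective A (Corner f (Induced f X)) := by
  let _ := fieldModule K A X
  have := fieldModule_tower K A X
  have := (H.finite_projective_ker_cornerRetr X).2
  have : Module.Projective A (H.retrKer X) := this
  exact Module.Projective.of_equiv (H.cornerProdEquiv X)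

lemma finite_corner [Module.Finite K L] {Z : Type u} [AddCommGroup Z] [Module L Z]
    [Module.Finite L Z] : Module.Finite A (Corner f Z) := by
  let _ := fieldModule K L Z
  have := fieldModule_tower K L Z
  let _ := fieldModule K A (Corner f Z)
  have := fieldModule_tower K A (Corner f Z)
  have : Module.Finite K Z := Module.Finite.trans L Z
  have : Module.Finite K (Corner f Z) := Module.Finite.of_injective
    ({ toFun := Corner.val, map_add' := map_add _, map_smul' := H.val_smul_field Z } :
      Corner f Z →ₗ[K] Z) Corner.val_injective
  exact Module.Finite.of_restrictScalars_finite K A _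

/-- Multiplication by `f(1)` maps projective `L`-modules to projective `A`-modules. -/
lemma projective_corner [Module.Finite K L] (Q : Type u) [AddCommGroup Q] [Module L Q]
    [Module.Finite L Q] [Module.Projective L Q] : Module.Projective A (Corner f Q) := by
  have := H.finite_corner (Z := Q)
  have := H.symm.finite_corner (Z := Q)
  obtain ⟨n, p, hp⟩ := Module.Finite.exists_fin' A (Corner f Q)
  obtain ⟨m, q, hq⟩ := Module.Finite.exists_fin' B (Corner g Q)
  let π : Induced f (Fin n → A) × Induced g (Fin m → B) →ₗ[L] Q :=
    mvRight f g Q ∘ₗ LinearMap.prodMap (inducedMap f p) (inducedMap g q)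
  have hπ : Function.Surjective π := (H.mvRight_surjective Q).comp
    (Function.Surjective.prodMap (Induced.map_surjective f hp) (Induced.map_surjective g hq))
  obtain ⟨s, hs⟩ := Module.projective_lifting_property π LinearMap.id hπ
  -- `f(1) Q` is a direct summand of `f(1) (L ⊗_A A ^ n) ⊕ f(1) (L ⊗_B B ^ m)`
  have := H.projective_corner_left (Fin n → A)
  have := H.projective_corner_right (Fin m → B)
  refine Module.Projective.of_split
    (LinearMap.prod (Corner.map f (LinearMap.fst L _ _ ∘ₗ s))
      (Corner.map f (LinearMap.snd L _ _ ∘ₗ s)))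
    (LinearMap.coprod (Corner.map f (π ∘ₗ LinearMap.inl L _ _))
      (Corner.map f (π ∘ₗ LinearMap.inr L _ _))) (LinearMap.ext fun x => Corner.ext ?_)
  have h1 : π (s (Corner.val x)) = Corner.val x := LinearMap.congr_fun hs _
  have h2 : π ((s (Corner.val x)).1, 0) + π (0, (s (Corner.val x)).2) = Corner.val x := by
    rw [← map_add, Prod.mk_add_mk, add_zero, zero_add]
    exact h1
  exact h2

/-- Every module `Z` over the gluing is, up to a projective kernel, the direct sum of the modules
induced from `f(1) Z` and `g(1) Z`. -/
lemma exists_mayerVietoris [Module.Finite K L] (Z : Type u) [AddCommGroup Z] [Module L Z]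
    [Module.Finite L Z] : ∃ (C : ModuleCat.{u} L)
      (ι : C →ₗ[L] Induced f (Corner f Z) × Induced g (Corner g Z)),
      Module.Finite L C ∧ Module.Projective L C ∧ Function.Injective ι ∧
        Function.Exact ι (mvRight f g Z) := by
  let _ := fieldModule K L Z
  have := fieldModule_tower K L Z
  let _ := fieldModule K A (Corner f Z)
  have := fieldModule_tower K A (Corner f Z)
  let _ := fieldModule K B (Corner g Z)
  have := fieldModule_tower K B (Corner g Z)
  have : Module.Finite K Z := Module.Finite.trans L Z
  exact ⟨ModuleCat.of L (leftIdeal e ⊗[K] fixedBy K e Z), H.mvLeft Z,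
    finite_leftIdeal_tensor H.e_mul_e _, projective_leftIdeal_tensor H.e_mul_e _,
    H.mvLeft_injective Z, H.mv_exact Z⟩

end Unbundled

section Bundled

variable [Module.Finite K L]

include H

/-- The direct sum of the sequences induced from cosyzygy sequences over `A` and `B`. -/
noncomputable def glueCosyzygy {X X' : ModuleCat.{u} A} {Y Y' : ModuleCat.{u} B}
    (S : CosyzygyData X X') (T : CosyzygyData Y Y') :
    CosyzygyData (ModuleCat.of L (Induced f X × Induced g Y))
      (ModuleCat.of L (Induced f X' × Induced g Y')) where
  I := ModuleCat.of L (Induced f S.I × Induced g T.I)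
  ι := ModuleCat.ofHom (LinearMap.prodMap (inducedMap f S.ι.hom) (inducedMap g T.ι.hom))
  π := ModuleCat.ofHom (LinearMap.prodMap (inducedMap f S.π.hom) (inducedMap g T.π.hom))
  finite := by
    have := S.finite
    have := T.finite
    infer_instance
  projective := by
    have := S.projective
    have := T.projective
    infer_instance
  injective := Function.Injective.prodMap (H.induced_injective S.injective)
    (H.symm.induced_injective T.injective)
  exact := by
    rintro ⟨y, z⟩
    have h1 := H.induced_exact S.exact y
    have h2 := H.symm.induced_exact T.exact z
    constructor
    · intro h
      obtain ⟨y', hy⟩ := h1.1 (congrArg Prod.fst h)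
      obtain ⟨z', hz⟩ := h2.1 (congrArg Prod.snd h)
      exact ⟨(y', z'), Prod.ext hy hz⟩
    · rintro ⟨⟨y', z'⟩, h⟩
      exact Prod.ext (h1.2 ⟨y', congrArg Prod.fst h⟩) (h2.2 ⟨z', congrArg Prod.snd h⟩)
  surjective := Function.Surjective.prodMap (Induced.map_surjective f S.surjective)
    (Induced.map_surjective g T.surjective)
  extend Q h h1 h2 := by
    have := H.finite_corner (Z := Q)
    have := H.symm.finite_corner (Z := Q)
    obtain ⟨k, hk⟩ := S.extend (ModuleCat.of A (Corner f Q)) (ModuleCat.ofHom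
      (Corner.map f (h.hom ∘ₗ LinearMap.inl L _ _) ∘ₗ Corner.unit f X)) inferInstance
      (H.projective_corner Q)
    obtain ⟨l, hl⟩ := T.extend (ModuleCat.of B (Corner g Q)) (ModuleCat.ofHom
      (Corner.map g (h.hom ∘ₗ LinearMap.inr L _ _) ∘ₗ Corner.unit g Y)) inferInstance
      (H.symm.projective_corner Q)
    refine ⟨ModuleCat.ofHom (LinearMap.coprod (Induced.adj f k.hom) (Induced.adj g l.hom)), ?_⟩
    refine ModuleCat.hom_ext (LinearMap.prod_ext (Induced.hom_ext fun x => ?_)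
      (Induced.hom_ext fun y => ?_))
    · have := congrArg (fun m => Corner.val (m.hom x)) hk
      simpa [Induced.inducedMap_of] using this
    · have := congrArg (fun m => Corner.val (m.hom y)) hl
      simpa [Induced.inducedMap_of] using this

lemma isGorensteinProjective_glue {X : ModuleCat.{u} A} {Y : ModuleCat.{u} B}
    (hX : isGorensteinProjective A X) (hY : isGorensteinProjective B Y) :
    isGorensteinProjective L (ModuleCat.of L (Induced f X × Induced g Y)) := by
  refine isGorensteinProjective_of_closed (fun M => ∃ (X : ModuleCat.{u} A) (Y : ModuleCat.{u} B),
    isGorensteinProjective A X ∧ isGorensteinProjective B Y ∧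
      M = ModuleCat.of L (Induced f X × Induced g Y)) ?_ ?_ _ ⟨X, Y, hX, hY, rfl⟩
  · rintro _ ⟨X, Y, hX, hY, rfl⟩
    obtain ⟨X', hX', ⟨S⟩⟩ := exists_cosyzygyData hX
    obtain ⟨Y', hY', ⟨T⟩⟩ := exists_cosyzygyData hY
    exact ⟨_, ⟨X', Y', hX', hY', rfl⟩, ⟨H.glueCosyzygy S T⟩⟩
  · rintro _ ⟨X, Y, hX, hY, rfl⟩
    obtain ⟨X', hX', ⟨S⟩⟩ := exists_cosyzygyData' hX
    obtain ⟨Y', hY', ⟨T⟩⟩ := exists_cosyzygyData' hY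
    exact ⟨_, ⟨X', Y', hX', hY', rfl⟩, ⟨H.glueCosyzygy S T⟩⟩

/-- The module `L ⊗_A f(1) Z` is, up to a projective kernel, a direct summand of `Z`, so that it
inherits the vanishing of extensions by projective modules. -/
lemma extVanishing_induced_corner {Z : ModuleCat.{u} L} [Module.Finite L Z]
    (hZ : ExtVanishing Z) : ExtVanishing (ModuleCat.of L (Induced f (Corner f Z))) := by
  obtain ⟨C, ι, h1, h2, h3, h4⟩ := H.exists_mayerVietoris Z
  have h5 : ExtVanishing (ModuleCat.of L (Induced f (Corner f Z) × Induced g (Corner g Z))) :=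
    ExtVanishing.of_exact (f := ModuleCat.ofHom ι) (g := ModuleCat.ofHom (mvRight f g Z)) h3 h4
      (H.mvRight_surjective Z) h2 hZ
  exact h5.of_retract (ModuleCat.ofHom (LinearMap.inl L _ _)) (ModuleCat.ofHom (LinearMap.fst L _ _))
    (by ext; rfl)

/-- Multiplication by `f(1)` maps cosyzygy sequences to cosyzygy sequences. -/
noncomputable def cornerCosyzygy {Z Z' : ModuleCat.{u} L} [Module.Finite L Z']
    (S : CosyzygyData Z Z') :
    CosyzygyData (ModuleCat.of A (Corner f Z)) (ModuleCat.of A (Corner f Z')) where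
  I := ModuleCat.of A (Corner f S.I)
  ι := ModuleCat.ofHom (Corner.map f S.ι.hom)
  π := ModuleCat.ofHom (Corner.map f S.π.hom)
  finite := by
    have := S.finite
    exact H.finite_corner
  projective := by
    have := S.finite
    have := S.projective
    exact H.projective_corner S.I
  injective := Corner.map_injective f S.injective
  exact := Corner.map_exact f S.exact
  surjective := Corner.map_surjective f S.surjective
  extend Q h h1 h2 := by
    obtain ⟨k, hk⟩ := (H.extVanishing_induced_corner S.extVanishing).exists_extension
      (f := ModuleCat.ofHom (inducedMap f (Corner.map f S.ι.hom)))
      (g := ModuleCat.ofHom (inducedMap f (Corner.map f S.π.hom)))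
      (H.induced_injective (Corner.map_injective f S.injective))
      (H.induced_exact (Corner.map_exact f S.exact))
      (Induced.map_surjective f (Corner.map_surjective f S.surjective))
      (ModuleCat.of L (Induced f Q)) (ModuleCat.ofHom (inducedMap f h.hom)) inferInstance
      inferInstance
    refine ⟨ModuleCat.ofHom (H.cornerRetr Q ∘ₗ Corner.map f k.hom ∘ₗ Corner.unit f _), ?_⟩
    ext x
    have h3 : Corner.map f k.hom (Corner.unit f _ (Corner.map f S.ι.hom x)) =
        Corner.unit f Q (h x) :=
      Corner.ext (congrArg (fun m => m.hom (Induced.of f x)) hk)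
    change H.cornerRetr Q (Corner.map f k.hom (Corner.unit f _ (Corner.map f S.ι.hom x))) = h x
    rw [h3, cornerRetr_unit]

lemma isGorensteinProjective_corner {Z : ModuleCat.{u} L} (hZ : isGorensteinProjective L Z) :
    isGorensteinProjective A (ModuleCat.of A (Corner f Z)) := by
  refine isGorensteinProjective_of_closed (fun M => ∃ Z : ModuleCat.{u} L,
    isGorensteinProjective L Z ∧ M = ModuleCat.of A (Corner f Z)) ?_ ?_ _ ⟨Z, hZ, rfl⟩
  · rintro _ ⟨Z, hZ, rfl⟩
    obtain ⟨Z', hZ', ⟨S⟩⟩ := exists_cosyzygyData hZ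
    have := finite_of_isGorensteinProjective hZ'
    exact ⟨_, ⟨Z', hZ', rfl⟩, ⟨H.cornerCosyzygy S⟩⟩
  · rintro _ ⟨Z', hZ', rfl⟩
    obtain ⟨Z, hZ, ⟨S⟩⟩ := exists_cosyzygyData' hZ'
    have := finite_of_isGorensteinProjective hZ'
    exact ⟨_, ⟨Z, hZ, rfl⟩, ⟨H.cornerCosyzygy S⟩⟩

/-- A Gorenstein projective module over the gluing is a direct summand of the sum of the modules
induced from its restrictions, with projective complement. -/
lemma exists_mayerVietoris_section {Z : ModuleCat.{u} L} (hZ : isGorensteinProjective L Z) :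
    ∃ s : Z →ₗ[L] Induced f (Corner f Z) × Induced g (Corner g Z),
      mvRight f g Z ∘ₗ s = LinearMap.id ∧ ∃ (C : ModuleCat.{u} L)
      (ι : C →ₗ[L] Induced f (Corner f Z) × Induced g (Corner g Z)),
      Module.Finite L C ∧ Module.Projective L C ∧ Function.Injective ι ∧
        Function.Exact ι (mvRight f g Z) := by
  have := finite_of_isGorensteinProjective hZ
  obtain ⟨C, ι, h1, h2, h3, h4⟩ := H.exists_mayerVietoris Z
  obtain ⟨s, hs⟩ := (extVanishing_of_isGorensteinProjective hZ).exists_section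
    (f := ModuleCat.ofHom ι) (g := ModuleCat.ofHom (mvRight f g Z)) h3 h4
    (H.mvRight_surjective Z) h1 h2
  exact ⟨s.hom, congrArg ModuleCat.Hom.hom hs, C, ι, h1, h2, h3, h4⟩

end Bundled

end GorensteinProjective

end IsGluing

end SimpleGluing

namespace SimpleGluing

/-! ### Comparison of cosyzygy sequences -/

section Comparison

variable {R : Type u} [Ring R] {X : GProj R}

/-- A cosyzygy sequence, without the Gorenstein projectivity of its terms. -/
def CosyzygySequence.toData (S : CosyzygySequence X) : CosyzygyData X.obj S.T.obj where
  I := S.I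
  ι := S.ι
  π := S.π
  finite := S.finite
  projective := S.projective
  injective := S.injective
  exact := S.exact
  surjective := S.surjective
  extend := S.extend

/-- A chosen morphism between the last terms of two cosyzygy sequences which is induced by the
identity. -/
noncomputable def CosyzygySequence.compare (S S' : CosyzygySequence X) : S.T ⟶ S'.T :=
  (exists_induces S S' (𝟙 X)).choose

lemma CosyzygySequence.induces_compare (S S' : CosyzygySequence X) :
    Induces S S' (𝟙 X) (S.compare S') :=
  (exists_induces S S' (𝟙 X)).choose_spec

/-- The last terms of two cosyzygy sequences of `X` are isomorphic in the stable category. -/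
noncomputable def CosyzygySequence.compareIso (S S' : CosyzygySequence X) :
    (toStable R).obj S.T ≅ (toStable R).obj S'.T where
  hom := (toStable R).map (S.compare S')
  inv := (toStable R).map (S'.compare S)
  hom_inv_id := by
    rw [← Functor.map_comp, ← (toStable R).map_id]
    exact ((S.induces_compare S').comp (S'.induces_compare S)).stable_eq (Induces.id S)
      (by rw [Category.comp_id]; exact Congruence.equivalence.refl _)
  inv_hom_id := by
    rw [← Functor.map_comp, ← (toStable R).map_id]
    exact ((S'.induces_compare S).comp (S.induces_compare S')).stable_eq (Induces.id S')
      (by rw [Category.comp_id]; exact Congruence.equivalence.refl _)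

lemma toStable_map_eq_iff {X Y : GProj R} (h k : X ⟶ Y) :
    (toStable R).map h = (toStable R).map k ↔ FactorsThroughProjective (h.hom - k.hom) :=
  Quotient.functor_map_eq_iff (stableRel R) h k

end Comparison

/-! ### The functor on stable categories -/

section StableFunctor

variable {K : Type u} [Field K] {A B L : Type u} [Ring A] [Algebra K A] [Ring B] [Algebra K B]
  [Ring L] [Algebra K L]

/-- The functor `(X, Y) ↦ (L ⊗_A X) ⊕ (L ⊗_B Y)` on pairs of Gorenstein projective modules. -/
noncomputable def pairFunctor (f : A →ₙ+* L) (g : B →ₙ+* L) :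
    GProj A × GProj B ⥤ ModuleCat.{u} L :=
  ((isGorensteinProjective A).ι ⋙ inductionFunctor f).prod
    ((isGorensteinProjective B).ι ⋙ inductionFunctor g) ⋙ directSumFunctor L

variable {f : A →ₙ+* L} {g : B →ₙ+* L} {a : A} {b : B} {e : L} {χA : A →ₐ[K] K} {χB : B →ₐ[K] K}

lemma Induced.map_sub {X Y : Type u} [AddCommGroup X] [Module A X] [AddCommGroup Y] [Module A Y]
    (h k : X →ₗ[A] Y) : inducedMap f (h - k) = inducedMap f h - inducedMap f k :=
  Induced.hom_ext fun x => by
    rw [Induced.inducedMap_of, LinearMap.sub_apply, _root_.map_sub, LinearMap.sub_apply,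
      Induced.inducedMap_of, Induced.inducedMap_of]

namespace IsGluing

variable (H : IsGluing f g a b e χA χB) [Module.Finite K L]

/-- The functor `(X, Y) ↦ (L ⊗_A X) ⊕ (L ⊗_B Y)` between categories of Gorenstein projective
modules. -/
noncomputable def glue : GProj A × GProj B ⥤ GProj L :=
  (isGorensteinProjective L).lift (pairFunctor f g)
    fun P => H.isGorensteinProjective_glue P.1.property P.2.property

omit [Module.Finite K L] in
variable (f g) in
lemma factorsThroughProjective_prodMap {X X' : ModuleCat.{u} A} {Y Y' : ModuleCat.{u} B}
    {h : X ⟶ X'} {k : Y ⟶ Y'} (hh : FactorsThroughProjective h)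
    (hk : FactorsThroughProjective k) : FactorsThroughProjective (ModuleCat.ofHom
      (LinearMap.prodMap (inducedMap f h.hom) (inducedMap g k.hom))) := by
  obtain ⟨Q, p, q, hQ, hQ', rfl⟩ := hh
  obtain ⟨Q', p', q', hQ1, hQ1', rfl⟩ := hk
  refine ⟨ModuleCat.of L (Induced f Q × Induced g Q'),
    ModuleCat.ofHom (LinearMap.prodMap (inducedMap f p.hom) (inducedMap g p'.hom)),
    ModuleCat.ofHom (LinearMap.prodMap (inducedMap f q.hom) (inducedMap g q'.hom)),
    inferInstance, inferInstance, ?_⟩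
  rw [ModuleCat.hom_comp, ModuleCat.hom_comp, Induced.map_comp, Induced.map_comp,
    ← LinearMap.prodMap_comp, ModuleCat.ofHom_comp]

lemma toStable_map_glue_eq {P P' : GProj A × GProj B} {h k : P ⟶ P'}
    (h1 : (toStable A).map h.1 = (toStable A).map k.1)
    (h2 : (toStable B).map h.2 = (toStable B).map k.2) :
    (toStable L).map (H.glue.map h) = (toStable L).map (H.glue.map k) := by
  have h3 := factorsThroughProjective_prodMap f g ((toStable_map_eq_iff _ _).1 h1)
    ((toStable_map_eq_iff _ _).1 h2)
  rw [ModuleCat.hom_sub, ModuleCat.hom_sub, Induced.map_sub, Induced.map_sub] at h3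
  exact (toStable_map_eq_iff _ _).2 h3

/-- The functor between stable categories induced by `(X, Y) ↦ (L ⊗_A X) ⊕ (L ⊗_B Y)`. -/
noncomputable def stableGlue : StableGProj A × StableGProj B ⥤ StableGProj L where
  obj P := (toStable L).obj (H.glue.obj (P.1.as, P.2.as))
  map {P P'} h := (toStable L).map (H.glue.map (X := (P.1.as, P.2.as)) (Y := (P'.1.as, P'.2.as))
    ((toStable A).preimage h.1, (toStable B).preimage h.2))
  map_id P := by
    rw [← (toStable L).map_id, ← H.glue.map_id]
    exact H.toStable_map_glue_eq
      (((toStable A).map_preimage _).trans ((toStable A).map_id P.1.as).symm)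
      (((toStable B).map_preimage _).trans ((toStable B).map_id P.2.as).symm)
  map_comp {P P' P''} h k := by
    rw [← (toStable L).map_comp, ← H.glue.map_comp]
    refine H.toStable_map_glue_eq (((toStable A).map_preimage _).trans ?_)
      (((toStable B).map_preimage _).trans ?_)
    · rw [prod_comp_fst, prod_comp_fst, Functor.map_comp, Functor.map_preimage,
        Functor.map_preimage]
    · rw [prod_comp_snd, prod_comp_snd, Functor.map_comp, Functor.map_preimage,
        Functor.map_preimage]

lemma stableGlue_map {P P' : GProj A × GProj B} (h : P ⟶ P') :
    H.stableGlue.map (X := ((toStable A).obj P.1, (toStable B).obj P.2))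
      (Y := ((toStable A).obj P'.1, (toStable B).obj P'.2))
      ((toStable A).map h.1, (toStable B).map h.2) = (toStable L).map (H.glue.map h) :=
  H.toStable_map_glue_eq ((toStable A).map_preimage _) ((toStable B).map_preimage _)

/-- The functor between stable categories extends the one between the categories of
Gorenstein projective modules. -/
noncomputable def toStableCompStableGlue :
    (toStable A).prod (toStable B) ⋙ H.stableGlue ≅ H.glue ⋙ toStable L :=
  NatIso.ofComponents (fun _ => Iso.refl _) fun {P P'} h => by
    rw [Iso.refl_hom, Iso.refl_hom]
    exact (Category.comp_id _).trans ((H.stableGlue_map h).trans (Category.id_comp _).symm)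

/-! ### The equivalence of stable categories -/

section Components

variable {X X' : Type u} [AddCommGroup X] [Module A X] [AddCommGroup X'] [Module A X']
  {Y : Type u} [AddCommGroup Y] [Module B Y]

/-- The `A`-linear map `X → X'` underlying an `L`-linear map of induced modules. -/
noncomputable def restrict (φ : Induced f X →ₗ[L] Induced f X') : X →ₗ[A] X' :=
  H.cornerRetr X' ∘ₗ Corner.map f φ ∘ₗ Corner.unit f X

omit [Module.Finite K L] in
lemma restrict_inducedMap (h : X →ₗ[A] X') : H.restrict (inducedMap f h) = h :=
  LinearMap.ext fun x => by
    have h1 : Corner.map f (inducedMap f h) (Corner.unit f X x) = Corner.unit f X' (h x) :=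
      Corner.ext rfl
    rw [restrict, LinearMap.comp_apply, LinearMap.comp_apply, h1, cornerRetr_unit]

lemma factorsThroughProjective_restrict {φ : Induced f X →ₗ[L] Induced f X'}
    (hφ : FactorsThroughProjective (ModuleCat.ofHom φ)) :
    FactorsThroughProjective (ModuleCat.ofHom (H.restrict φ)) := by
  obtain ⟨Q, p, q, h1, h2, h⟩ := hφ
  have h3 : φ = q.hom ∘ₗ p.hom := congrArg ModuleCat.Hom.hom h
  subst h3
  exact ⟨ModuleCat.of A (Corner f Q), ModuleCat.ofHom (Corner.map f p.hom ∘ₗ Corner.unit f X),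
    ModuleCat.ofHom (H.cornerRetr X' ∘ₗ Corner.map f q.hom), H.finite_corner,
    H.projective_corner Q, rfl⟩

/-- Maps between modules induced from `A` are stably induced from `A`, since the unit of the
adjunction has a projective complement. -/
lemma factorsThroughProjective_sub_restrict [Module.Finite A X']
    (φ : Induced f X →ₗ[L] Induced f X') :
    FactorsThroughProjective (ModuleCat.ofHom (φ - inducedMap f (H.restrict φ))) := by
  obtain ⟨h1, h2⟩ := H.finite_projective_ker_cornerRetr X'
  let d : X →ₗ[A] LinearMap.ker (H.cornerRetr X') :=
    (Corner.map f φ ∘ₗ Corner.unit f X - Corner.unit f X' ∘ₗ H.restrict φ).codRestrict _ fun x => by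
      rw [LinearMap.mem_ker, LinearMap.sub_apply, map_sub, LinearMap.comp_apply (Corner.unit f X'),
        cornerRetr_unit, sub_eq_zero]
      rfl
  refine ⟨ModuleCat.of L (Induced f (LinearMap.ker (H.cornerRetr X'))),
    ModuleCat.ofHom (inducedMap f d),
    ModuleCat.ofHom (Induced.adj f (LinearMap.ker (H.cornerRetr X')).subtype),
    inferInstance, inferInstance, ModuleCat.hom_ext (Induced.hom_ext fun x => ?_)⟩
  have h3 : Induced.adj f (LinearMap.ker (H.cornerRetr X')).subtype (inducedMap f d (.of f x)) =
      φ (.of f x) - .of f (H.restrict φ x) := by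
    rw [Induced.inducedMap_of, Induced.adj_of]
    change Corner.val (Corner.map f φ (Corner.unit f X x) - Corner.unit f X' (H.restrict φ x)) = _
    rw [map_sub, Corner.val_map, Corner.val_unit, Corner.val_unit]
  exact h3.symm

include H in
/-- Maps from modules induced from `A` to modules induced from `B` are stably zero. -/
lemma factorsThroughProjective_left_right [Module.Finite B Y] (φ : Induced f X →ₗ[L] Induced g Y) :
    FactorsThroughProjective (ModuleCat.ofHom φ) := by
  have := H.projective_corner_right Y
  have : Module.Finite A (Corner f (Induced g Y)) := H.finite_corner
  exact ⟨ModuleCat.of L (Induced f (Corner f (Induced g Y))),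
    ModuleCat.ofHom (inducedMap f (Corner.map f φ ∘ₗ Corner.unit f X)),
    ModuleCat.ofHom (counit f (Induced g Y)), inferInstance, inferInstance,
    ModuleCat.hom_ext (Induced.hom_ext fun x =>
      (counit_of (Induced g Y) (Corner.map f φ (Corner.unit f X x))).symm)⟩

end Components

lemma exists_toStable_map {P P' : GProj A × GProj B}
    (h : ((toStable A).obj P.1, (toStable B).obj P.2) ⟶
      ((toStable A).obj P'.1, (toStable B).obj P'.2)) :
    ∃ k : P ⟶ P', h = ((toStable A).map k.1, (toStable B).map k.2) :=
  ⟨((toStable A).preimage h.1, (toStable B).preimage h.2),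
    Prod.ext ((toStable A).map_preimage _).symm ((toStable B).map_preimage _).symm⟩

lemma stableGlue_faithful : H.stableGlue.Faithful where
  map_injective {P P'} h k hhk := by
    obtain ⟨⟨X⟩, ⟨Y⟩⟩ := P
    obtain ⟨⟨X'⟩, ⟨Y'⟩⟩ := P'
    obtain ⟨h, rfl⟩ := exists_toStable_map (P := (X, Y)) (P' := (X', Y')) h
    obtain ⟨k, rfl⟩ := exists_toStable_map (P := (X, Y)) (P' := (X', Y')) k
    have h3 := (H.stableGlue_map h).symm.trans (hhk.trans (H.stableGlue_map k))
    have h4 : FactorsThroughProjective (ModuleCat.ofHom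
        (LinearMap.prodMap (inducedMap f (h.1.hom.hom - k.1.hom.hom))
          (inducedMap g (h.2.hom.hom - k.2.hom.hom)))) := by
      rw [Induced.map_sub, Induced.map_sub]
      exact (toStable_map_eq_iff _ _).1 h3
    refine Prod.ext ((toStable_map_eq_iff _ _).2 ?_) ((toStable_map_eq_iff _ _).2 ?_)
    · have h5 : FactorsThroughProjective (ModuleCat.ofHom
          (inducedMap f (h.1.hom.hom - k.1.hom.hom))) := by
        convert FactorsThroughProjective.comp_right
          (FactorsThroughProjective.comp_left (ModuleCat.ofHom (LinearMap.inl L _ _)) h4)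
          (ModuleCat.ofHom (LinearMap.fst L _ _)) using 1
        exact ModuleCat.hom_ext (LinearMap.ext fun _ => rfl)
      have h6 := H.factorsThroughProjective_restrict h5
      rw [restrict_inducedMap] at h6
      exact h6
    · have h5 : FactorsThroughProjective (ModuleCat.ofHom
          (inducedMap g (h.2.hom.hom - k.2.hom.hom))) := by
        convert FactorsThroughProjective.comp_right
          (FactorsThroughProjective.comp_left (ModuleCat.ofHom (LinearMap.inr L _ _)) h4)
          (ModuleCat.ofHom (LinearMap.snd L _ _)) using 1
        exact ModuleCat.hom_ext (LinearMap.ext fun _ => rfl)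
      have h6 := H.symm.factorsThroughProjective_restrict h5
      rw [restrict_inducedMap] at h6
      exact h6

lemma factorsThroughProjective_sub_prodMap {X X' : Type u} [AddCommGroup X] [Module A X]
    [AddCommGroup X'] [Module A X'] {Y Y' : Type u} [AddCommGroup Y] [Module B Y]
    [AddCommGroup Y'] [Module B Y'] [Module.Finite A X'] [Module.Finite B Y']
    (φ : Induced f X × Induced g Y →ₗ[L] Induced f X' × Induced g Y') :
    FactorsThroughProjective (ModuleCat.ofHom (φ - LinearMap.prodMap
      (inducedMap f (H.restrict (LinearMap.fst L _ _ ∘ₗ φ ∘ₗ LinearMap.inl L _ _)))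
      (inducedMap g (H.symm.restrict (LinearMap.snd L _ _ ∘ₗ φ ∘ₗ LinearMap.inr L _ _))))) := by
  have h11 := H.factorsThroughProjective_sub_restrict
    (LinearMap.fst L _ _ ∘ₗ φ ∘ₗ LinearMap.inl L _ _)
  have h22 := H.symm.factorsThroughProjective_sub_restrict
    (LinearMap.snd L _ _ ∘ₗ φ ∘ₗ LinearMap.inr L _ _)
  have h12 := H.factorsThroughProjective_left_right
    (LinearMap.snd L _ _ ∘ₗ φ ∘ₗ LinearMap.inl L _ _)
  have h21 := H.symm.factorsThroughProjective_left_right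
    (LinearMap.fst L _ _ ∘ₗ φ ∘ₗ LinearMap.inr L _ _)
  have key := (((h11.comp_left (ModuleCat.ofHom (LinearMap.fst L (Induced f X) (Induced g Y)))).comp_right
    (ModuleCat.ofHom (LinearMap.inl L (Induced f X') (Induced g Y')))).add
    ((h22.comp_left (ModuleCat.ofHom (LinearMap.snd L (Induced f X) (Induced g Y)))).comp_right
    (ModuleCat.ofHom (LinearMap.inr L (Induced f X') (Induced g Y'))))).add
    (((h12.comp_left (ModuleCat.ofHom (LinearMap.fst L (Induced f X) (Induced g Y)))).comp_right
    (ModuleCat.ofHom (LinearMap.inr L (Induced f X') (Induced g Y')))).add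
    ((h21.comp_left (ModuleCat.ofHom (LinearMap.snd L (Induced f X) (Induced g Y)))).comp_right
    (ModuleCat.ofHom (LinearMap.inl L (Induced f X') (Induced g Y')))))
  have h0 : φ (0, 0) = 0 := map_zero φ
  convert key using 1
  refine ModuleCat.hom_ext (LinearMap.prod_ext (LinearMap.ext fun x => Prod.ext ?_ ?_)
    (LinearMap.ext fun x => Prod.ext ?_ ?_)) <;> simp [h0]

lemma stableGlue_full : H.stableGlue.Full where
  map_surjective {P P'} φ := by
    obtain ⟨⟨X⟩, ⟨Y⟩⟩ := P
    obtain ⟨⟨X'⟩, ⟨Y'⟩⟩ := P'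
    obtain ⟨φ, rfl⟩ := (toStable L).map_surjective (X := H.glue.obj (X, Y))
      (Y := H.glue.obj (X', Y')) φ
    have := finite_of_isGorensteinProjective X'.property
    have := finite_of_isGorensteinProjective Y'.property
    let ψ : Induced f X.obj × Induced g Y.obj →ₗ[L] Induced f X'.obj × Induced g Y'.obj :=
      φ.hom.hom
    let h : (X, Y) ⟶ (X', Y') := (ObjectProperty.homMk (ModuleCat.ofHom
      (H.restrict (LinearMap.fst L _ _ ∘ₗ ψ ∘ₗ LinearMap.inl L _ _))),
      ObjectProperty.homMk (ModuleCat.ofHom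
      (H.symm.restrict (LinearMap.snd L _ _ ∘ₗ ψ ∘ₗ LinearMap.inr L _ _))))
    refine ⟨((toStable A).map h.1, (toStable B).map h.2), ?_⟩
    refine (H.stableGlue_map h).trans ((toStable_map_eq_iff _ _).2 ?_).symm
    exact H.factorsThroughProjective_sub_prodMap ψ

lemma stableGlue_essSurj : H.stableGlue.EssSurj where
  mem_essImage Z := by
    obtain ⟨Z⟩ := Z
    obtain ⟨s, hs, C, ι, h1, h2, h3, h4⟩ := H.exists_mayerVietoris_section Z.property
    let P : GProj A × GProj B :=
      (⟨ModuleCat.of A (Corner f Z.obj), H.isGorensteinProjective_corner Z.property⟩,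
        ⟨ModuleCat.of B (Corner g Z.obj), H.symm.isGorensteinProjective_corner Z.property⟩)
    let p : H.glue.obj P ⟶ Z := ObjectProperty.homMk (ModuleCat.ofHom (mvRight f g Z.obj))
    let i : Z ⟶ H.glue.obj P := ObjectProperty.homMk (ModuleCat.ofHom s)
    have hs' : ∀ z, mvRight f g Z.obj (s z) = z := LinearMap.congr_fun hs
    have hip : i ≫ p = 𝟙 Z := by
      ext z
      exact hs' z
    refine ⟨((toStable A).obj P.1, (toStable B).obj P.2), ⟨(show
      (toStable L).obj (H.glue.obj P) ≅ (toStable L).obj Z from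
      { hom := (toStable L).map p
        inv := (toStable L).map i
        hom_inv_id := ?_
        inv_hom_id := ?_ })⟩⟩
    · rw [← Functor.map_comp, ← (toStable L).map_id]
      refine ((toStable_map_eq_iff _ _).2 ?_).symm
      -- `x - s (p x)` lies in the image of the projective kernel
      let eq := LinearEquiv.ofInjective ι h3
      let ρ : Induced f (Corner f Z.obj) × Induced g (Corner g Z.obj) →ₗ[L] C :=
        eq.symm.toLinearMap ∘ₗ (LinearMap.id - s ∘ₗ mvRight f g Z.obj).codRestrict
          (LinearMap.range ι) fun x => (h4 _).1 (by simp [hs'])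
      have hρ : ∀ x, ι (ρ x) = x - s (mvRight f g Z.obj x) := fun x =>
        congrArg Subtype.val (eq.apply_symm_apply _)
      exact ⟨C, ModuleCat.ofHom ρ, ModuleCat.ofHom ι, h1, h2,
        ModuleCat.hom_ext (LinearMap.ext fun x => (hρ x).symm)⟩
    · rw [← Functor.map_comp, hip]
      rfl

lemma stableGlue_isEquivalence : H.stableGlue.IsEquivalence where
  faithful := H.stableGlue_faithful
  full := H.stableGlue_full
  essSurj := H.stableGlue_essSurj

end IsGluing

end StableFunctor

end SimpleGluing

namespace SimpleGluing

/-! ### Linearity and compatibility with triangles -/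

namespace IsGluing

section Triangles

variable {K : Type u} [Field K] {A B L : Type u} [Ring A] [Algebra K A] [Ring B] [Algebra K B]
  [Ring L] [Algebra K L]
variable {f : A →ₙ+* L} {g : B →ₙ+* L} {a : A} {b : B} {e : L} {χA : A →ₐ[K] K} {χB : B →ₐ[K] K}
variable (H : IsGluing f g a b e χA χB)

include H in
lemma inducedMap_smul_apply {X X' : ModuleCat.{u} A} (c : K) (h : X ⟶ X') (u : Induced f X) :
    inducedMap f (c • h).hom u = algebraMap K L c • inducedMap f h.hom u := by
  induction u using Induced.induction f with
  | zero => rw [map_zero, map_zero, smul_zero]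
  | smul_of l x =>
    have h1 : (c • h).hom x = algebraMap K A c • h x := rfl
    have h2 : f (algebraMap K A c) = algebraMap K L c * f 1 := by
      rw [Algebra.algebraMap_eq_smul_one, H.map_smul_left, Algebra.smul_def]
    rw [map_smul, map_smul, Induced.inducedMap_of, Induced.inducedMap_of, h1,
      ← Induced.map_smul_of, h2, mul_smul, Induced.map_one_smul_of, smul_smul, smul_smul,
      Algebra.commutes]
  | add u v hu hv => rw [map_add, map_add, smul_add, hu, hv]

variable [Module.Finite K L]

lemma stableGlue_isLinear : IsLinearFunctor K H.stableGlue := by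
  rintro ⟨X⟩ ⟨X'⟩ ⟨Y⟩ ⟨Y'⟩ c h k h' k'
  obtain ⟨h, rfl⟩ := (toStable A).map_surjective (X := X) (Y := X') h
  obtain ⟨k, rfl⟩ := (toStable A).map_surjective (X := X) (Y := X') k
  obtain ⟨h', rfl⟩ := (toStable B).map_surjective (X := Y) (Y := Y') h'
  obtain ⟨k', rfl⟩ := (toStable B).map_surjective (X := Y) (Y := Y') k'
  have e1 := H.stableGlue_map (P := (X, Y)) (P' := (X', Y')) (h, h')
  have e2 := H.stableGlue_map (P := (X, Y)) (P' := (X', Y')) (k, k')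
  have e3 := H.stableGlue_map (P := (X, Y)) (P' := (X', Y')) (c • h + k, c • h' + k')
  refine e3.trans (Eq.trans ?_ (congrArg₂ (fun p q : H.stableGlue.obj (⟨X⟩, ⟨Y⟩) ⟶
    H.stableGlue.obj (⟨X'⟩, ⟨Y'⟩) => c • p + q) e1 e2).symm)
  have key : H.glue.map (X := (X, Y)) (Y := (X', Y')) (c • h + k, c • h' + k') =
      c • H.glue.map (X := (X, Y)) (Y := (X', Y')) (h, h') +
        H.glue.map (X := (X, Y)) (Y := (X', Y')) (k, k') := by
    refine ObjectProperty.hom_ext _ (ModuleCat.hom_ext (LinearMap.ext ?_))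
    rintro ⟨u, v⟩
    refine Prod.ext ?_ ?_
    · have h1 : ∀ u, inducedMap f (c • h.hom + k.hom).hom u =
          algebraMap K L c • inducedMap f h.hom.hom u + inducedMap f k.hom.hom u := fun u => by
        rw [ModuleCat.hom_add, Induced.map_add, LinearMap.add_apply, H.inducedMap_smul_apply]
      exact h1 u
    · have h1 : ∀ v, inducedMap g (c • h'.hom + k'.hom).hom v =
          algebraMap K L c • inducedMap g h'.hom.hom v + inducedMap g k'.hom.hom v := fun v => by
        rw [ModuleCat.hom_add, Induced.map_add, LinearMap.add_apply, H.symm.inducedMap_smul_apply]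
      exact h1 v
  rw [key]
  rfl

/-- The direct sum of the sequences induced from cosyzygy sequences of `X` and `Y` is a cosyzygy
sequence. -/
noncomputable def glueSequence {P : GProj A × GProj B} (S : CosyzygySequence P.1)
    (T : CosyzygySequence P.2) : CosyzygySequence (H.glue.obj P) where
  I := (H.glueCosyzygy S.toData T.toData).I
  T := H.glue.obj (S.T, T.T)
  ι := (H.glueCosyzygy S.toData T.toData).ι
  π := (H.glueCosyzygy S.toData T.toData).π
  finite := (H.glueCosyzygy S.toData T.toData).finite
  projective := (H.glueCosyzygy S.toData T.toData).projective
  injective := (H.glueCosyzygy S.toData T.toData).injective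
  exact := (H.glueCosyzygy S.toData T.toData).exact
  surjective := (H.glueCosyzygy S.toData T.toData).surjective
  extend := (H.glueCosyzygy S.toData T.toData).extend

open CosyzygySequence

omit [Module.Finite K L] in
lemma prodMap_square {X₁ X₂ X₃ X₄ : ModuleCat.{u} A} {Y₁ Y₂ Y₃ Y₄ : ModuleCat.{u} B}
    {h₁ : X₁ ⟶ X₂} {h₂ : X₂ ⟶ X₄} {h₃ : X₁ ⟶ X₃} {h₄ : X₃ ⟶ X₄} (h : h₁ ≫ h₂ = h₃ ≫ h₄)
    {k₁ : Y₁ ⟶ Y₂} {k₂ : Y₂ ⟶ Y₄} {k₃ : Y₁ ⟶ Y₃} {k₄ : Y₃ ⟶ Y₄} (k : k₁ ≫ k₂ = k₃ ≫ k₄) :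
    ModuleCat.ofHom (LinearMap.prodMap (inducedMap f h₁.hom) (inducedMap g k₁.hom)) ≫
      ModuleCat.ofHom (LinearMap.prodMap (inducedMap f h₂.hom) (inducedMap g k₂.hom)) =
    ModuleCat.ofHom (LinearMap.prodMap (inducedMap f h₃.hom) (inducedMap g k₃.hom)) ≫
      ModuleCat.ofHom (LinearMap.prodMap (inducedMap f h₄.hom) (inducedMap g k₄.hom)) := by
  rw [← ModuleCat.ofHom_comp, ← ModuleCat.ofHom_comp, LinearMap.prodMap_comp,
    LinearMap.prodMap_comp, ← Induced.map_comp, ← Induced.map_comp, ← Induced.map_comp,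
    ← Induced.map_comp, ← ModuleCat.hom_comp, ← ModuleCat.hom_comp, ← ModuleCat.hom_comp,
    ← ModuleCat.hom_comp, h, k]

lemma glueSequence_induces {P P' : GProj A × GProj B} {S : CosyzygySequence P.1}
    {T : CosyzygySequence P.2} {S' : CosyzygySequence P'.1} {T' : CosyzygySequence P'.2}
    {h : P ⟶ P'} {q : S.T ⟶ S'.T} {r : T.T ⟶ T'.T} (h1 : Induces S S' h.1 q)
    (h2 : Induces T T' h.2 r) :
    Induces (H.glueSequence S T) (H.glueSequence S' T') (H.glue.map h)
      (H.glue.map (X := (S.T, T.T)) (Y := (S'.T, T'.T)) (q, r)) := by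
  obtain ⟨p, hp, hp'⟩ := h1
  obtain ⟨p', hq, hq'⟩ := h2
  exact ⟨ModuleCat.ofHom (LinearMap.prodMap (inducedMap f p.hom) (inducedMap g p'.hom)),
    prodMap_square hp hq, prodMap_square hp' hq'⟩

/-- The chosen isomorphism between the glued cosyzygies and the cosyzygy of a glued module. -/
noncomputable def cosyzygyIso (P : GProj A × GProj B) :
    (toStable L).obj (H.glue.obj ((cosyzygy P.1).T, (cosyzygy P.2).T)) ≅
      (toStable L).obj (cosyzygy (H.glue.obj P)).T :=
  (H.glueSequence (cosyzygy P.1) (cosyzygy P.2)).compareIso (cosyzygy (H.glue.obj P))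

lemma cosyzygyIso_naturality {P P' : GProj A × GProj B} (h : P ⟶ P') :
    (toStable L).map (H.glue.map (X := ((cosyzygy P.1).T, (cosyzygy P.2).T))
      (Y := ((cosyzygy P'.1).T, (cosyzygy P'.2).T)) (cosyzygyMap h.1, cosyzygyMap h.2)) ≫
        (H.cosyzygyIso P').hom =
      (H.cosyzygyIso P).hom ≫ (toStable L).map (cosyzygyMap (H.glue.map h)) := by
  have i1 := (H.glueSequence_induces (cosyzygyMap_induces h.1) (cosyzygyMap_induces h.2)).comp
    ((H.glueSequence (cosyzygy P'.1) (cosyzygy P'.2)).induces_compare (cosyzygy (H.glue.obj P')))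
  have i2 := ((H.glueSequence (cosyzygy P.1) (cosyzygy P.2)).induces_compare
    (cosyzygy (H.glue.obj P))).comp (cosyzygyMap_induces (H.glue.map h))
  exact i1.stable_eq i2
    (by rw [Category.comp_id, Category.id_comp]; exact Congruence.equivalence.refl _)

/-- The functor between stable categories commutes with the suspensions. -/
noncomputable def suspensionIso :
    (suspension A).prod (suspension B) ⋙ H.stableGlue ≅ H.stableGlue ⋙ suspension L :=
  NatIso.ofComponents (fun P => H.cosyzygyIso (P.1.as, P.2.as)) (by
    rintro ⟨⟨X⟩, ⟨Y⟩⟩ ⟨⟨X'⟩, ⟨Y'⟩⟩ h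
    obtain ⟨h, rfl⟩ := exists_toStable_map (P := (X, Y)) (P' := (X', Y')) h
    have e1 : H.stableGlue.map (X := ((suspension A).obj ⟨X⟩, (suspension B).obj ⟨Y⟩))
        (Y := ((suspension A).obj ⟨X'⟩, (suspension B).obj ⟨Y'⟩))
        ((toStable A).map (cosyzygyMap h.1), (toStable B).map (cosyzygyMap h.2)) =
        (toStable L).map (H.glue.map
          (X := ((cosyzygy X).T, (cosyzygy Y).T)) (Y := ((cosyzygy X').T, (cosyzygy Y').T))
          (cosyzygyMap h.1, cosyzygyMap h.2)) :=
      H.stableGlue_map (P := ((cosyzygy X).T, (cosyzygy Y).T))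
        (P' := ((cosyzygy X').T, (cosyzygy Y').T)) (cosyzygyMap h.1, cosyzygyMap h.2)
    have e2 := congrArg (suspension L).map (H.stableGlue_map h)
    refine (congrArg (fun m => m ≫ (H.cosyzygyIso (X', Y')).hom) e1).trans ?_
    refine (H.cosyzygyIso_naturality h).trans ?_
    exact congrArg (fun m => (H.cosyzygyIso (X, Y)).hom ≫ m) e2.symm)

lemma _root_.SimpleGluing.functor_map_prod_square {C D E : Type*} [Category* C] [Category* D]
    [Category* E] (F : C × D ⥤ E) {X₁ X₂ X₃ X₄ : C} {Y₁ Y₂ Y₃ Y₄ : D}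
    {h₁ : X₁ ⟶ X₂} {h₂ : X₂ ⟶ X₄} {h₃ : X₁ ⟶ X₃} {h₄ : X₃ ⟶ X₄} (h : h₁ ≫ h₂ = h₃ ≫ h₄)
    {k₁ : Y₁ ⟶ Y₂} {k₂ : Y₂ ⟶ Y₄} {k₃ : Y₁ ⟶ Y₃} {k₄ : Y₃ ⟶ Y₄} (k : k₁ ≫ k₂ = k₃ ≫ k₄) :
    F.map (X := (X₁, Y₁)) (Y := (X₂, Y₂)) (h₁, k₁) ≫
        F.map (X := (X₂, Y₂)) (Y := (X₄, Y₄)) (h₂, k₂) =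
      F.map (X := (X₁, Y₁)) (Y := (X₃, Y₃)) (h₃, k₃) ≫
        F.map (X := (X₃, Y₃)) (Y := (X₄, Y₄)) (h₄, k₄) := by
  rw [← F.map_comp, ← F.map_comp, prod_comp, prod_comp, h, k]

omit [Module.Finite K L] in
lemma _root_.SimpleGluing.Induced.map_neg {X X' : Type u} [AddCommGroup X] [Module A X]
    [AddCommGroup X'] [Module A X'] (h : X →ₗ[A] X') :
    inducedMap f (-h) = -inducedMap f h :=
  Induced.hom_ext fun x => by
    rw [LinearMap.neg_apply, Induced.inducedMap_of, Induced.inducedMap_of, LinearMap.neg_apply,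
      _root_.map_neg]

lemma glue_map_neg {P P' : GProj A × GProj B} (h : P ⟶ P') :
    H.glue.map (X := P) (Y := P') (-h.1, -h.2) = -H.glue.map h := by
  refine ObjectProperty.hom_ext _ (ModuleCat.hom_ext (LinearMap.ext ?_))
  rintro ⟨u, v⟩
  have h1 : inducedMap f (-h.1.hom).hom = -inducedMap f h.1.hom.hom := Induced.map_neg _
  have h2 : inducedMap g (-h.2.hom).hom = -inducedMap g h.2.hom.hom := Induced.map_neg _
  exact Prod.ext (LinearMap.congr_fun h1 u) (LinearMap.congr_fun h2 v)

lemma glue_exact {X Y Z : GProj A × GProj B} {h : X ⟶ Y} {k : Y ⟶ Z}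
    (h1 : Function.Exact h.1.hom k.1.hom) (h2 : Function.Exact h.2.hom k.2.hom) :
    Function.Exact (H.glue.map h).hom (H.glue.map k).hom := by
  rintro ⟨y, z⟩
  have e1 := H.induced_exact h1 y
  have e2 := H.symm.induced_exact h2 z
  constructor
  · intro h0
    obtain ⟨y', hy⟩ := e1.1 (congrArg Prod.fst h0)
    obtain ⟨z', hz⟩ := e2.1 (congrArg Prod.snd h0)
    exact ⟨(y', z'), Prod.ext hy hz⟩
  · rintro ⟨⟨y', z'⟩, h0⟩
    exact Prod.ext (e1.2 ⟨y', congrArg Prod.fst h0⟩) (e2.2 ⟨z', congrArg Prod.snd h0⟩)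

/-- The map from the glued short exact sequence to the chosen cosyzygy sequence of its first term;
up to `cosyzygyIso`, its last component is the glued one. -/
lemma exists_glue_connecting {X Y Z : GProj A × GProj B} {h : X ⟶ Y} {k : Y ⟶ Z}
    {p : Y.1.obj ⟶ (cosyzygy X.1).I} {q : Z.1 ⟶ (cosyzygy X.1).T}
    {p' : Y.2.obj ⟶ (cosyzygy X.2).I} {q' : Z.2 ⟶ (cosyzygy X.2).T}
    (h1 : h.1.hom ≫ p = (cosyzygy X.1).ι) (h2 : k.1.hom ≫ q.hom = p ≫ (cosyzygy X.1).π)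
    (h1' : h.2.hom ≫ p' = (cosyzygy X.2).ι) (h2' : k.2.hom ≫ q'.hom = p' ≫ (cosyzygy X.2).π) :
    ∃ (r : (H.glue.obj Y).obj ⟶ (cosyzygy (H.glue.obj X)).I)
      (s : H.glue.obj Z ⟶ (cosyzygy (H.glue.obj X)).T),
      (H.glue.map h).hom ≫ r = (cosyzygy (H.glue.obj X)).ι ∧
      (H.glue.map k).hom ≫ s.hom = r ≫ (cosyzygy (H.glue.obj X)).π ∧
      (toStable L).map (H.glue.map (X := Z) (Y := ((cosyzygy X.1).T, (cosyzygy X.2).T)) (q, q')) ≫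
        (H.cosyzygyIso X).hom = (toStable L).map s := by
  let G := H.glueSequence (cosyzygy X.1) (cosyzygy X.2)
  obtain ⟨r, hr, hr'⟩ := G.induces_compare (cosyzygy (H.glue.obj X))
  let qq : H.glue.obj Z ⟶ G.T :=
    H.glue.map (X := Z) (Y := ((cosyzygy X.1).T, (cosyzygy X.2).T)) (q, q')
  let pp : (H.glue.obj Y).obj ⟶ G.I :=
    ModuleCat.ofHom (LinearMap.prodMap (inducedMap f p.hom) (inducedMap g p'.hom))
  have hpp : (H.glue.map h).hom ≫ pp = G.ι := by
    have := prodMap_square (f := f) (g := g) (h₃ := 𝟙 _) (k₃ := 𝟙 _)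
      (h1.trans (Category.id_comp _).symm) (h1'.trans (Category.id_comp _).symm)
    rw [ModuleCat.hom_id, ModuleCat.hom_id, Induced.map_id, Induced.map_id] at this
    exact this
  have hqq : (H.glue.map k).hom ≫ qq.hom = pp ≫ G.π := prodMap_square h2 h2'
  refine ⟨pp ≫ r, qq ≫ G.compare _, ?_, ?_, ((toStable L).map_comp _ _).symm⟩
  · rw [← Category.assoc, hpp, hr]
    exact Category.id_comp _
  · change (H.glue.map k).hom ≫ qq.hom ≫ (G.compare _).hom = _
    rw [← Category.assoc, hqq, Category.assoc, hr', Category.assoc]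

lemma stableGlue_connecting {X Z : StableGProj A} {X' Z' : StableGProj B} {X₀ : GProj A}
    {X₁ : GProj B} {Z₀ : GProj A} {Z₁ : GProj B} {w : Z ⟶ (suspension A).obj X}
    {w' : Z' ⟶ (suspension B).obj X'} {q : Z₀ ⟶ (cosyzygy X₀).T} {q' : Z₁ ⟶ (cosyzygy X₁).T}
    {eX : X ⟶ (toStable A).obj X₀} {eX' : X' ⟶ (toStable B).obj X₁}
    {eZ : Z ⟶ (toStable A).obj Z₀} {eZ' : Z' ⟶ (toStable B).obj Z₁}
    (h : w ≫ (suspension A).map eX = eZ ≫ (toStable A).map (-q))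
    (h' : w' ≫ (suspension B).map eX' = eZ' ≫ (toStable B).map (-q')) :
    (H.stableGlue.map (X := (Z, Z')) (Y := ((suspension A).obj X, (suspension B).obj X')) (w, w') ≫
        H.suspensionIso.hom.app (X, X')) ≫
      (suspension L).map (H.stableGlue.map (X := (X, X'))
        (Y := ((toStable A).obj X₀, (toStable B).obj X₁)) (eX, eX')) =
    H.stableGlue.map (X := (Z, Z')) (Y := ((toStable A).obj Z₀, (toStable B).obj Z₁)) (eZ, eZ') ≫
      (-((toStable L).map (H.glue.map (X := (Z₀, Z₁)) (Y := ((cosyzygy X₀).T, (cosyzygy X₁).T))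
        (q, q')) ≫ (H.cosyzygyIso (X₀, X₁)).hom)) := by
  have e1 := (H.stableGlue_map (P := (Z₀, Z₁)) (P' := ((cosyzygy X₀).T, (cosyzygy X₁).T))
    (-q, -q')).trans (congrArg (toStable L).map
      (H.glue_map_neg (P := (Z₀, Z₁)) (P' := ((cosyzygy X₀).T, (cosyzygy X₁).T)) (q, q')))
  have e3 := (H.suspensionIso.hom.naturality (X := (X, X'))
    (Y := ((toStable A).obj X₀, (toStable B).obj X₁)) (eX, eX')).symm
  have e4 := functor_map_prod_square H.stableGlue h h'
  refine (Category.assoc _ _ _).trans ?_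
  refine (congrArg (fun m => H.stableGlue.map (X := (Z, Z'))
    (Y := ((suspension A).obj X, (suspension B).obj X')) (w, w') ≫ m) e3).trans ?_
  refine (Category.assoc _ _ _).symm.trans ?_
  refine (congrArg (fun m => m ≫ (H.cosyzygyIso (X₀, X₁)).hom) e4).trans ?_
  refine (Category.assoc _ _ _).trans ?_
  refine congrArg (fun m => H.stableGlue.map (X := (Z, Z'))
    (Y := ((toStable A).obj Z₀, (toStable B).obj Z₁)) (eZ, eZ') ≫ m) ?_
  refine (congrArg (fun m => m ≫ (H.cosyzygyIso (X₀, X₁)).hom) e1).trans ?_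
  rw [Functor.map_neg]
  exact Preadditive.neg_comp _ _

/-- The isomorphism in the stable category of the gluing given by a pair of isomorphisms. -/
noncomputable def stableGlueIso {X : StableGProj A} {X' : StableGProj B} {X₀ : GProj A}
    {X₁ : GProj B} (eX : X ≅ (toStable A).obj X₀) (eX' : X' ≅ (toStable B).obj X₁) :
    H.stableGlue.obj (X, X') ≅ (toStable L).obj (H.glue.obj (X₀, X₁)) :=
  H.stableGlue.mapIso (X := (X, X')) (Y := ((toStable A).obj X₀, (toStable B).obj X₁))
    (eX.prod eX')

lemma stableGlue_isTriangle : IsTriangleFunctor H.stableGlue := by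
  refine ⟨H.suspensionIso, ?_⟩
  intro X Y Z u v w X' Y' Z' u' v' w' hd hd'
  obtain ⟨X₀, Y₀, Z₀, h, k, p, q, eX, eY, eZ, h1, h2, h3, h4, h5, h6, h7, h8⟩ := hd
  obtain ⟨X₁, Y₁, Z₁, h', k', p', q', eX', eY', eZ', h1', h2', h3', h4', h5', h6', h7', h8'⟩ := hd'
  obtain ⟨r, s, hr, hs, hqs⟩ := H.exists_glue_connecting (X := (X₀, X₁)) (Y := (Y₀, Y₁))
    (Z := (Z₀, Z₁)) (h := (h, h')) (k := (k, k')) h4 h5 h4' h5'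
  refine ⟨H.glue.obj (X₀, X₁), H.glue.obj (Y₀, Y₁), H.glue.obj (Z₀, Z₁),
    H.glue.map (X := (X₀, X₁)) (Y := (Y₀, Y₁)) (h, h'),
    H.glue.map (X := (Y₀, Y₁)) (Y := (Z₀, Z₁)) (k, k'), r, s,
    H.stableGlueIso eX eX', H.stableGlueIso eY eY', H.stableGlueIso eZ eZ', ?_, H.glue_exact h2 h2', ?_, hr, hs, ?_, ?_, ?_⟩
  · exact Function.Injective.prodMap (H.induced_injective h1) (H.symm.induced_injective h1')
  · exact Function.Surjective.prodMap (Induced.map_surjective f h3)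
      (Induced.map_surjective g h3')
  · have e1 := H.stableGlue_map (P := (X₀, X₁)) (P' := (Y₀, Y₁)) (h, h')
    exact (functor_map_prod_square H.stableGlue h6 h6').trans
      (congrArg (fun m => H.stableGlue.map (X := (X, X'))
        (Y := ((toStable A).obj X₀, (toStable B).obj X₁)) (eX.hom, eX'.hom) ≫ m) e1)
  · have e1 := H.stableGlue_map (P := (Y₀, Y₁)) (P' := (Z₀, Z₁)) (k, k')
    exact (functor_map_prod_square H.stableGlue h7 h7').trans
      (congrArg (fun m => H.stableGlue.map (X := (Y, Y'))
        (Y := ((toStable A).obj Y₀, (toStable B).obj Y₁)) (eY.hom, eY'.hom) ≫ m) e1)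
  · refine (H.stableGlue_connecting h8 h8').trans ?_
    rw [hqs, ← Functor.map_neg]
    rfl

end Triangles

end IsGluing

end SimpleGluing

namespace SimpleGluing

/-! ### Direct summands and indecomposable modules -/

section Indecomposable

variable {R : Type u} [Ring R]

/-- `Z` is isomorphic to a direct summand of `M`. -/
def IsRetract (R : Type u) [Ring R] (Z M : Type u) [AddCommGroup Z] [Module R Z] [AddCommGroup M]
    [Module R M] : Prop :=
  ∃ (s : Z →ₗ[R] M) (r : M →ₗ[R] Z), r ∘ₗ s = LinearMap.id

/-- Fitting's lemma for an indecomposable module of finite length. -/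
lemma IsIndecomposable.isUnit_or_isNilpotent {M : ModuleCat.{u} R} [IsArtinian R M]
    [IsNoetherian R M] (hM : IsIndecomposable M) (φ : Module.End R M) :
    IsUnit φ ∨ IsNilpotent φ := by
  obtain ⟨n, hn, h0⟩ := (φ.eventually_isCompl_ker_pow_range_pow.and
    (Filter.eventually_gt_atTop 0)).exists
  obtain h | h := hM.2 _ _ hn
  · have h1 : LinearMap.range (φ ^ n) = ⊤ := by
      rw [h] at hn
      simpa using hn.sup_eq_top
    have h2 : IsUnit (φ ^ n) := (Module.End.isUnit_iff _).2
      ⟨LinearMap.ker_eq_bot.1 h, LinearMap.range_eq_top.1 h1⟩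
    exact Or.inl ((isUnit_pow_iff h0.ne').1 h2)
  · exact Or.inr ⟨n, LinearMap.range_eq_bot.1 h⟩

lemma IsIndecomposable.isUnit_or_isUnit {M : ModuleCat.{u} R} [IsArtinian R M]
    [IsNoetherian R M] (hM : IsIndecomposable M) {φ ψ : Module.End R M} (h : φ + ψ = 1) :
    IsUnit φ ∨ IsUnit ψ := by
  refine (hM.isUnit_or_isNilpotent φ).imp_right fun h1 => ?_
  rw [eq_sub_iff_add_eq'.2 h]
  exact h1.isUnit_one_sub

lemma IsIndecomposable.eq_zero_or_eq_one {M : ModuleCat.{u} R} (hM : IsIndecomposable M)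
    {φ : Module.End R M} (h : φ * φ = φ) : φ = 0 ∨ φ = 1 := by
  have h1 : ∀ x, φ (φ x) = φ x := LinearMap.congr_fun h
  have hc : IsCompl (LinearMap.ker φ) (LinearMap.range φ) := by
    refine IsCompl.of_eq ?_ ?_
    · rw [eq_bot_iff]
      rintro _ ⟨hx, y, rfl⟩
      rw [SetLike.mem_coe, LinearMap.mem_ker, h1] at hx
      exact hx
    · rw [eq_top_iff]
      intro x _
      refine Submodule.mem_sup.2 ⟨x - φ x, ?_, φ x, ⟨x, rfl⟩, sub_add_cancel _ _⟩
      rw [LinearMap.mem_ker, map_sub, h1, sub_self]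
  obtain h2 | h2 := hM.2 _ _ hc
  · right
    ext x
    exact LinearMap.ker_eq_bot.1 h2 (h1 x)
  · exact Or.inl (LinearMap.range_eq_bot.1 h2)

lemma IsRetract.of_isUnit {Z M : Type u} [AddCommGroup Z] [Module R Z] [AddCommGroup M]
    [Module R M] {s : Z →ₗ[R] M} {r : M →ₗ[R] Z} (h : IsUnit (r ∘ₗ s : Module.End R Z)) :
    IsRetract R Z M := by
  obtain ⟨u, hu⟩ := h
  refine ⟨s, (↑u⁻¹ : Module.End R Z) ∘ₗ r, ?_⟩
  rw [LinearMap.comp_assoc, ← hu]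
  exact u.inv_mul

/-- If `f + g = 1` on `M`, an indecomposable direct summand of `M` is a direct summand of one of
the modules through which `f` and `g` factor. -/
lemma IsIndecomposable.isRetract_or_isRetract {Z : ModuleCat.{u} R} [IsArtinian R Z]
    [IsNoetherian R Z] (hZ : IsIndecomposable Z) {M M₁ M₂ : Type u} [AddCommGroup M] [Module R M]
    [AddCommGroup M₁] [Module R M₁] [AddCommGroup M₂] [Module R M₂] (h : IsRetract R Z M)
    {p₁ : M →ₗ[R] M₁} {i₁ : M₁ →ₗ[R] M} {p₂ : M →ₗ[R] M₂} {i₂ : M₂ →ₗ[R] M}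
    (hp : i₁ ∘ₗ p₁ + i₂ ∘ₗ p₂ = LinearMap.id) : IsRetract R Z M₁ ∨ IsRetract R Z M₂ := by
  obtain ⟨s, r, hrs⟩ := h
  have h1 : ((r ∘ₗ i₁) ∘ₗ (p₁ ∘ₗ s) : Module.End R Z) + (r ∘ₗ i₂) ∘ₗ (p₂ ∘ₗ s) = 1 := by
    ext z
    have h2 := LinearMap.congr_fun hp (s z)
    have h3 := LinearMap.congr_fun hrs z
    change r (i₁ (p₁ (s z))) + r (i₂ (p₂ (s z))) = z
    rw [← map_add]
    exact (congrArg r h2).trans h3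
  exact (hZ.isUnit_or_isUnit h1).imp IsRetract.of_isUnit IsRetract.of_isUnit

end Indecomposable

namespace IsGluing

/-! ### Indecomposable modules over a gluing -/

section IndecomposableGluing

variable {K : Type u} [Field K] {A B L : Type u} [Ring A] [Algebra K A] [Ring B] [Algebra K B]
  [Ring L] [Algebra K L]
variable {f : A →ₙ+* L} {g : B →ₙ+* L} {a : A} {b : B} {e : L} {χA : A →ₐ[K] K} {χB : B →ₐ[K] K}
variable (H : IsGluing f g a b e χA χB)

section Endomorphisms

variable {X X' X'' : Type u} [AddCommGroup X] [Module A X] [AddCommGroup X'] [Module A X']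
  [AddCommGroup X''] [Module A X'']

/-- Linear maps of induced modules preserve the spans of the nontrivial words, whence restriction
is compatible with compositions. -/
lemma restrict_comp (ψ : Induced f X' →ₗ[L] Induced f X'') (φ : Induced f X →ₗ[L] Induced f X') :
    H.restrict (ψ ∘ₗ φ) = H.restrict ψ ∘ₗ H.restrict φ := by
  let _ := fieldModule K A X
  have := fieldModule_tower K A X
  let _ := fieldModule K A X'
  have := fieldModule_tower K A X'
  let _ := fieldModule K A X''
  have := fieldModule_tower K A X''
  have h1 : ∀ w ∈ charIdeal g b χB, ∀ x : X'', H.retr X'' (w • Induced.of f x) = 0 := by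
    intro w hw x
    have h2 : w * e = w := by
      induction hw using Submodule.span_induction with
      | mem w hw =>
        obtain ⟨y, hy, rfl⟩ := hw
        rw [H.symm.map_mul_e, (mem_charKer.1 hy).1]
      | zero => exact zero_mul _
      | add u v _ _ hu hv => rw [add_mul, hu, hv]
      | smul l u _ hu => rw [smul_eq_mul, mul_assoc, hu]
    rw [← h2, mul_smul, H.e_smul_of]
    exact H.retr_word ((⟨w, hw⟩ : charIdeal g b χB) ⊗ₜ toFixedBy H.idem_left X'' x)
  have h3 : ∀ t, H.retr X'' (ψ (H.word X' t)) = 0 := by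
    intro t
    induction t with
    | zero => rw [map_zero, map_zero, ← map_zero (Induced.of f), retr_of]
    | add x y hx hy => rw [map_add, map_add, retr_add, hx, hy, add_zero]
    | tmul w z =>
      rw [word_tmul, map_smul, ← H.of_retr_add_word (ψ (Induced.of f (z : X'))), smul_add,
        retr_add, h1 _ w.2, ← map_smul, retr_word, add_zero]
  ext x
  change H.retr X'' (ψ (φ (Induced.of f x))) =
    H.retr X'' (ψ (Induced.of f (H.retr X' (φ (Induced.of f x)))))
  conv_lhs => rw [← H.of_retr_add_word (φ (Induced.of f x)), map_add, retr_add, h3, add_zero]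

/-- The sums of elements `f(l) g(y) (1 ⊗ z)` with `y` a product of `n` elements of the kernel of
the character on `b B b`. -/
def wordFiltration (_ : IsGluing f g a b e χA χB) (X : Type u) [AddCommGroup X] [Module A X]
    (n : ℕ) : AddSubgroup (Induced f X) :=
  AddSubgroup.closure {u | ∃ (l : A) (y : B) (z : X), l * a = l ∧ y * b = y ∧
    y ∈ localCharKer b χB ^ n ∧ a • z = z ∧ u = f l • g y • Induced.of f z}

lemma mem_wordFiltration_one [Module.Finite K L] {φ : Induced f X →ₗ[L] Induced f X'}
    (hφ : H.restrict φ = 0) (x : X) : φ (Induced.of f x) ∈ H.wordFiltration X' 1 := by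
  let _ := fieldModule K A X'
  have := fieldModule_tower K A X'
  have h1 : Corner.map f φ (Corner.unit f X x) ∈ H.retrKer X' := LinearMap.congr_fun hφ x
  obtain ⟨t, ht⟩ := H.exists_actTensor_localWord h1
  have h2 : φ (Induced.of f x) = H.actTensor (H.localWord X') t := (congrArg Corner.val ht).symm
  rw [h2]
  clear h1 h2 ht
  induction t with
  | zero => rw [map_zero]; exact zero_mem _
  | add u v hu hv => rw [map_add]; exact add_mem hu hv
  | tmul l s =>
    induction s with
    | zero => rw [TensorProduct.tmul_zero, map_zero]; exact zero_mem _
    | add u v hu hv => rw [TensorProduct.tmul_add, map_add]; exact add_mem hu hv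
    | tmul y z =>
      refine AddSubgroup.subset_closure ⟨l, y, z, l.2, y.2.2.1, ?_, z.2, rfl⟩
      rw [pow_one]
      exact y.2

lemma map_mem_wordFiltration_succ [Module.Finite K L] {φ : Induced f X →ₗ[L] Induced f X}
    (hφ : H.restrict φ = 0) {n : ℕ} {u : Induced f X} (hu : u ∈ H.wordFiltration X n) :
    φ u ∈ H.wordFiltration X (n + 1) := by
  induction hu using AddSubgroup.closure_induction with
  | zero => rw [map_zero]; exact zero_mem _
  | add u v _ _ hu hv => rw [map_add]; exact add_mem hu hv
  | neg u _ hu => rw [map_neg]; exact neg_mem hu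
  | mem u hu =>
    obtain ⟨l, y, z, hl, hy, hyn, -, rfl⟩ := hu
    rw [map_smul, map_smul]
    have h1 := H.mem_wordFiltration_one hφ z
    generalize φ (Induced.of f z) = v at h1
    induction h1 using AddSubgroup.closure_induction with
    | zero => rw [smul_zero, smul_zero]; exact zero_mem _
    | add u v _ _ hu hv => rw [smul_add, smul_add]; exact add_mem hu hv
    | neg u _ hu => rw [smul_neg, smul_neg]; exact neg_mem hu
    | mem v hv =>
      obtain ⟨l', y', z', hl', hy', hyn', hz', rfl⟩ := hv
      rw [pow_one] at hyn'
      obtain ⟨r, hr, hr'⟩ := H.corner_eq l'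
      rw [mul_assoc, hl'] at hr'
      -- `a l'` is a scalar multiple of `a` modulo the kernel of the character
      have h2 : g y * f l' * g y' = χA l' • g (y * y') := by
        rw [H.symm.map_mul_map, hy, hr', map_add, mul_add, add_mul, mul_assoc _ (f r),
          H.map_mul_map_eq_zero hr hyn', mul_zero, add_zero, H.map_smul_left, H.map_left,
          mul_smul_comm, H.symm.map_mul_e, hy, smul_mul_assoc, ← map_mul]
      refine AddSubgroup.subset_closure ⟨χA l' • l, y * y', z', by rw [smul_mul_assoc, hl],
        by rw [mul_assoc, hy'], ?_, hz', ?_⟩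
      · rw [pow_succ]
        exact Submodule.mul_mem_mul hyn hyn'
      · rw [smul_smul (g y), smul_smul (g y * f l'), h2, smul_smul, smul_smul, H.map_smul_left,
          mul_smul_comm, smul_mul_assoc]

/-- If the kernel of the character on `b B b` is nilpotent, then the endomorphisms of an induced
module which restrict to zero are nilpotent. -/
lemma isNilpotent_of_restrict_eq_zero [Module.Finite K L] {n : ℕ}
    (hn : localCharKer b χB ^ n = ⊥) {φ : Module.End L (Induced f X)} (hφ : H.restrict φ = 0) :
    IsNilpotent φ := by
  have h1 : ∀ m x, (φ ^ (m + 1)) (Induced.of f x) ∈ H.wordFiltration X (m + 1) := by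
    intro m
    induction m with
    | zero =>
      intro x
      rw [zero_add, pow_one]
      exact H.mem_wordFiltration_one hφ x
    | succ m ih =>
      intro x
      rw [pow_succ']
      exact H.map_mem_wordFiltration_succ hφ (ih x)
  have h2 : H.wordFiltration X (n + 1) = ⊥ := by
    rw [eq_bot_iff]
    refine (AddSubgroup.closure_le _).2 ?_
    rintro _ ⟨l, y, z, -, -, hy, -, rfl⟩
    rw [pow_succ, hn, Submodule.bot_mul, Submodule.mem_bot] at hy
    rw [hy, map_zero, zero_smul, smul_zero]
    exact zero_mem _
  refine ⟨n + 1, Induced.hom_ext fun x => ?_⟩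
  have h3 := h1 n x
  rw [h2] at h3
  exact h3

end Endomorphisms

lemma restrict_sub {X X' : Type u} [AddCommGroup X] [Module A X] [AddCommGroup X'] [Module A X']
    (φ ψ : Induced f X →ₗ[L] Induced f X') :
    H.restrict (φ - ψ) = H.restrict φ - H.restrict ψ := by
  ext x
  have h1 : Corner.map f (φ - ψ) (Corner.unit f X x) =
      Corner.map f φ (Corner.unit f X x) - Corner.map f ψ (Corner.unit f X x) :=
    Corner.ext (by simp)
  change H.cornerRetr X' (Corner.map f (φ - ψ) (Corner.unit f X x)) = _
  rw [h1, map_sub]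
  rfl

include H in
/-- Induction preserves indecomposability; here, in the form that a nonzero direct summand of a
module induced from an indecomposable module is the whole module. -/
lemma bijective_of_isRetract [Module.Finite K L] {n : ℕ} (hn : localCharKer b χB ^ n = ⊥)
    {X : ModuleCat.{u} A} (hX : IsIndecomposable X) {Z : Type u} [AddCommGroup Z] [Module L Z]
    [Nontrivial Z] {s : Z →ₗ[L] Induced f X} {r : Induced f X →ₗ[L] Z}
    (hrs : r ∘ₗ s = LinearMap.id) : Function.Bijective r := by
  let π : Module.End L (Induced f X) := s ∘ₗ r
  have hrs' : ∀ z, r (s z) = z := LinearMap.congr_fun hrs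
  have hπ : π * π = π := LinearMap.ext fun x => congrArg s (hrs' (r x))
  have h0 : ∀ π : Module.End L (Induced f X), π * π = π → H.restrict π = 0 → π = 0 := by
    intro π hπ h
    obtain ⟨m, hm⟩ := H.isNilpotent_of_restrict_eq_zero hn h
    have h1 : π ^ (m + 1) = π := IsIdempotentElem.pow_succ_eq m hπ
    rw [← h1, pow_succ, hm, zero_mul]
  have h1 : (H.restrict π : Module.End A X) * H.restrict π = H.restrict π := by
    conv_rhs => rw [← hπ]
    exact (H.restrict_comp π π).symm
  refine ⟨?_, fun z => ⟨s z, hrs' z⟩⟩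
  obtain h2 | h2 := hX.eq_zero_or_eq_one h1
  · obtain ⟨z, hz⟩ := exists_ne (0 : Z)
    refine absurd ?_ hz
    have h3 : s (r (s z)) = 0 := LinearMap.congr_fun (h0 π hπ h2) (s z)
    rw [hrs'] at h3
    rw [← hrs' z, h3, map_zero]
  · have h3 : H.restrict (1 - π : Module.End L (Induced f X)) = 0 := by
      have h4 : H.restrict (1 : Module.End L (Induced f X)) = LinearMap.id := by
        have h5 : (1 : Module.End L (Induced f X)) = inducedMap f LinearMap.id :=
          (Induced.map_id f).symm
        rw [h5, restrict_inducedMap]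
      rw [restrict_sub, h4, h2]
      exact sub_self _
    have h4 := h0 (1 - π) (IsIdempotentElem.one_sub hπ) h3
    intro x y hxy
    have h5 : ∀ x, x = s (r x) := fun x => sub_eq_zero.1 (LinearMap.congr_fun h4 x)
    rw [h5 x, h5 y, hxy]

include H in
/-- An indecomposable direct summand of an induced module is a direct summand of a module induced
from an indecomposable module. -/
lemma exists_indecomposable_isRetract [Module.Finite K L] {Z : ModuleCat.{u} L}
    [IsArtinian L Z] [IsNoetherian L Z] (hZ : IsIndecomposable Z) {X : Type u} [AddCommGroup X]
    [Module A X] [Module.Finite A X] (h : IsRetract L Z (Induced f X)) :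
    ∃ X' : ModuleCat.{u} A, IsIndecomposable X' ∧ Module.Finite A X' ∧
      IsRetract L Z (Induced f X') := by
  have := H.finite_left
  have : IsArtinianRing A := IsArtinianRing.of_finite K A
  -- a minimal submodule of `X` with `Z` as a direct summand of the induced module
  obtain ⟨N, hN, hmin⟩ := IsArtinian.set_has_minimal
    {N : Submodule A X | IsRetract L Z (Induced f N)} ⟨⊤, by
      obtain ⟨s, r, hrs⟩ := h
      refine ⟨inducedMap f (Submodule.topEquiv (R := A) (M := X)).symm.toLinearMap ∘ₗ s,
        r ∘ₗ inducedMap f (Submodule.topEquiv (R := A) (M := X)).toLinearMap, ?_⟩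
      rw [LinearMap.comp_assoc, ← LinearMap.comp_assoc s, ← Induced.map_comp,
        LinearEquiv.comp_coe, LinearEquiv.symm_trans_self, LinearEquiv.refl_toLinearMap,
        Induced.map_id, LinearMap.id_comp, hrs]⟩
  have hsub : ∀ N' : Submodule A N, IsRetract L Z (Induced f N') → N' = ⊤ := by
    intro N' h'
    have h1 : IsRetract L Z (Induced f (N'.map N.subtype)) := by
      obtain ⟨s, r, hrs⟩ := h'
      let eq : N' ≃ₗ[A] N'.map N.subtype := N'.equivMapOfInjective _ N.injective_subtype
      refine ⟨inducedMap f eq.toLinearMap ∘ₗ s, r ∘ₗ inducedMap f eq.symm.toLinearMap, ?_⟩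
      rw [LinearMap.comp_assoc, ← LinearMap.comp_assoc s, ← Induced.map_comp,
        LinearEquiv.comp_coe, LinearEquiv.self_trans_symm, LinearEquiv.refl_toLinearMap,
        Induced.map_id, LinearMap.id_comp, hrs]
    have h2 : N'.map N.subtype ≤ N := Submodule.map_subtype_le _ _
    have h3 : N'.map N.subtype = N := by
      by_contra h4
      exact hmin _ h1 (lt_of_le_of_ne h2 h4)
    exact Submodule.map_injective_of_injective N.injective_subtype
      (h3.trans (Submodule.map_subtype_top N).symm)
  refine ⟨ModuleCat.of A N, ⟨?_, fun N₁ N₂ hc => ?_⟩,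
    inferInstanceAs (Module.Finite A N), hN⟩
  · by_contra h1
    rw [not_nontrivial_iff_subsingleton] at h1
    obtain ⟨s, r, hrs⟩ := hN
    obtain ⟨z, hz⟩ := @exists_ne Z hZ.1 0
    refine hz ?_
    have h2 : s z = 0 := by
      induction s z using Induced.induction f with
      | zero => rfl
      | smul_of l x =>
        have h3 : x = 0 := h1.elim _ _
        rw [h3, map_zero, smul_zero]
      | add u v hu hv => rw [hu, hv, add_zero]
    have h3 : r (s z) = z := LinearMap.congr_fun hrs z
    rw [← h3, h2, map_zero]
  · have h1 : inducedMap f N₁.subtype ∘ₗ inducedMap f (N₁.projectionOnto N₂ hc) +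
        inducedMap f N₂.subtype ∘ₗ inducedMap f (N₂.projectionOnto N₁ hc.symm) =
          LinearMap.id := by
      rw [← Induced.map_comp, ← Induced.map_comp, ← Induced.map_add, ← Induced.map_id]
      congr 1
      exact LinearMap.ext fun x => Submodule.projection_add_projection_eq_self hc x
    obtain h2 | h2 := hZ.isRetract_or_isRetract hN h1
    · right
      have h3 := hsub N₁ h2
      exact eq_bot_of_top_isCompl (h3 ▸ hc)
    · left
      have h3 := hsub N₂ h2
      exact eq_bot_of_isCompl_top (h3 ▸ hc)

lemma _root_.SimpleGluing.isGorensteinProjective_punit (R : Type u) [Ring R] :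
    isGorensteinProjective R (ModuleCat.of R PUnit.{u + 1}) := by
  let S : CosyzygyData (ModuleCat.of R PUnit.{u + 1}) (ModuleCat.of R PUnit.{u + 1}) :=
    { I := ModuleCat.of R PUnit.{u + 1}
      ι := 0
      π := 0
      finite := inferInstanceAs (Module.Finite R PUnit.{u + 1})
      projective := inferInstanceAs (Module.Projective R PUnit.{u + 1})
      injective := fun _ _ _ => rfl
      exact := fun _ => ⟨fun _ => ⟨0, rfl⟩, fun _ => rfl⟩
      surjective := fun _ => ⟨0, rfl⟩
      extend := fun Q h _ _ => ⟨0, ModuleCat.hom_ext (LinearMap.ext fun x =>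
        (map_zero (0 : ModuleCat.of R PUnit.{u + 1} ⟶ Q).hom).trans (map_zero h.hom).symm)⟩ }
  exact isGorensteinProjective_of_closed (fun M => M = ModuleCat.of R PUnit.{u + 1})
    (fun _ h => ⟨_, rfl, ⟨h ▸ S⟩⟩) (fun _ h => ⟨_, rfl, ⟨h ▸ S⟩⟩) _ rfl

include H in
lemma isGorensteinProjective_induced [Module.Finite K L] {X : ModuleCat.{u} A}
    (hX : isGorensteinProjective A X) :
    isGorensteinProjective L (ModuleCat.of L (Induced f X)) :=
  isGorensteinProjective_of_prod
    (H.isGorensteinProjective_glue hX (isGorensteinProjective_punit B))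

include H in
/-- If `Z` is a direct summand of `L ⊗_A X` with `X` indecomposable, then `Z` is isomorphic to
`L ⊗_A X`, and `X` is a direct summand of `f(1) Z` with projective complement. -/
lemma exists_iso_induced [Module.Finite K L] {n : ℕ} (hn : localCharKer b χB ^ n = ⊥)
    {Z : ModuleCat.{u} L} (hZ : isGorensteinProjective L Z) (hZ' : IsIndecomposable Z)
    (h : IsRetract L Z (Induced f (Corner f Z))) :
    ∃ X : ModuleCat.{u} A, IsIndecomposable X ∧ isGorensteinProjective A X ∧
      Nonempty (Z ≅ ModuleCat.of L (Induced f X)) := by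
  have := finite_of_isGorensteinProjective hZ
  have : IsArtinianRing L := IsArtinianRing.of_finite K L
  have : Module.Finite A (Corner f Z) := H.finite_corner
  obtain ⟨X, hX, hfin, s, r, hrs⟩ := H.exists_indecomposable_isRetract hZ' h
  have := hZ'.1
  let eq : Induced f X ≃ₗ[L] Z := LinearEquiv.ofBijective r (H.bijective_of_isRetract hn hX hrs)
  refine ⟨X, hX, ?_, ⟨eq.symm.toModuleIso⟩⟩
  have h1 := H.isGorensteinProjective_corner (isGorensteinProjective_of_iso
    (N := ModuleCat.of L (Induced f X)) eq.symm.toModuleIso hZ)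
  let _ := fieldModule K A X
  have := fieldModule_tower K A X
  obtain ⟨h2, h3⟩ := H.finite_projective_ker_cornerRetr X
  have : Module.Finite A (H.retrKer X) := h2
  have : Module.Projective A (H.retrKer X) := h3
  exact isGorensteinProjective_of_prod (Q := H.retrKer X)
    (isGorensteinProjective_of_iso (H.cornerProdEquiv X).symm.toModuleIso h1)

include H in
/-- The indecomposable Gorenstein projective modules over the gluing are those induced from
indecomposable Gorenstein projective modules. -/
lemma isGorensteinProjective_iff_of_isIndecomposable [Module.Finite K L] {m n : ℕ}
    (hm : localCharKer a χA ^ m = ⊥) (hn : localCharKer b χB ^ n = ⊥) {Z : ModuleCat.{u} L}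
    (hZ : IsIndecomposable Z) :
    isGorensteinProjective L Z ↔
      (∃ X : ModuleCat.{u} A, IsIndecomposable X ∧ isGorensteinProjective A X ∧
        Nonempty (Z ≅ ModuleCat.of L (Induced f X))) ∨
      (∃ Y : ModuleCat.{u} B, IsIndecomposable Y ∧ isGorensteinProjective B Y ∧
        Nonempty (Z ≅ ModuleCat.of L (Induced g Y))) := by
  constructor
  · intro h
    have := finite_of_isGorensteinProjective h
    have : IsArtinianRing L := IsArtinianRing.of_finite K L
    obtain ⟨s, hs, -⟩ := H.exists_mayerVietoris_section h
    have h1 : LinearMap.inl L (Induced f (Corner f Z)) (Induced g (Corner g Z)) ∘ₗ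
        LinearMap.fst L _ _ + LinearMap.inr L _ _ ∘ₗ LinearMap.snd L _ _ = LinearMap.id := by
      ext x <;> simp
    obtain h2 | h2 := hZ.isRetract_or_isRetract ⟨s, mvRight f g Z, hs⟩ h1
    · exact Or.inl (H.exists_iso_induced hn h hZ h2)
    · exact Or.inr (H.symm.exists_iso_induced hm h hZ h2)
  · rintro (⟨X, -, hX, ⟨eq⟩⟩ | ⟨Y, -, hY, ⟨eq⟩⟩)
    · exact isGorensteinProjective_of_iso eq.symm (H.isGorensteinProjective_induced hX)
    · exact isGorensteinProjective_of_iso eq.symm (H.symm.isGorensteinProjective_induced hY)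

end IndecomposableGluing

end IsGluing

end SimpleGluing

namespace SimpleGluing

/-! ### The universal property of path algebras -/

namespace PathAlgebra

variable {K : Type u} [Field K] {V : Type u} [Quiver.{u} V]

lemma span_ofPath : Submodule.span K {x : PathAlgebra K V | ∃ (i j : V) (p : Quiver.Path i j),
    x = ofPath K p} = ⊤ := by
  rw [Submodule.eq_top_iff']
  intro x
  induction x using Finsupp.induction_linear with
  | zero => exact zero_mem _
  | add x y hx hy => exact add_mem hx hy
  | single p c =>
    have h : (Finsupp.single p c : PathAlgebra K V) = c • ofPath K p.2.2 := by
      refine Eq.symm ((Finsupp.smul_single c p (1 : K)).trans ?_)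
      rw [smul_eq_mul, mul_one]
    exact h ▸ Submodule.smul_mem _ c (Submodule.subset_span ⟨_, _, p.2.2, rfl⟩)

lemma ofPath_nil_mul_self (i : V) : ofPath K (Quiver.Path.nil : Quiver.Path i i) *
    ofPath K (Quiver.Path.nil : Quiver.Path i i) = ofPath K (Quiver.Path.nil : Quiver.Path i i) :=
  ofPath_comp _ _

section Lift

variable {E : Type u} [Ring E] [Algebra K E] (ε : V → E) (α : ∀ i j : V, (i ⟶ j) → E)

/-- The product of the values of the arrows of a path. -/
def pathValue {i : V} : ∀ {j : V}, Quiver.Path i j → E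
  | _, .nil => ε i
  | _, .cons p h => α _ _ h * pathValue p

variable {ε α}

lemma mul_pathValue (h1 : ∀ i, ε i * ε i = ε i) (h3 : ∀ i j (h : i ⟶ j), ε j * α i j h = α i j h)
    {i j : V} (p : Quiver.Path i j) : ε j * pathValue ε α p = pathValue ε α p := by
  cases p with
  | nil => exact h1 i
  | cons p h => rw [pathValue, ← mul_assoc, h3]

lemma pathValue_mul (h1 : ∀ i, ε i * ε i = ε i) {i j : V} (p : Quiver.Path i j) :
    pathValue ε α p * ε i = pathValue ε α p := by
  induction p with
  | nil => exact h1 i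
  | cons p h ih => rw [pathValue, mul_assoc, ih]

lemma pathValue_comp (h1 : ∀ i, ε i * ε i = ε i)
    (h3 : ∀ i j (h : i ⟶ j), ε j * α i j h = α i j h) {i j k : V} (q : Quiver.Path i j)
    (p : Quiver.Path j k) : pathValue ε α (q.comp p) = pathValue ε α p * pathValue ε α q := by
  induction p with
  | nil => exact (mul_pathValue h1 h3 q).symm
  | cons p h ih => rw [Quiver.Path.comp_cons, pathValue, pathValue, ih, mul_assoc]

variable [Finite V]

/-- The algebra homomorphism on a path algebra given by orthogonal idempotents with sum `1`, for
the vertices, and by elements for the arrows. -/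
lemma exists_lift (h1 : ∀ i, ε i * ε i = ε i) (h2 : ∀ i j, i ≠ j → ε i * ε j = 0)
    (hsum : letI := Fintype.ofFinite V; ∑ i, ε i = 1)
    (h3 : ∀ i j (h : i ⟶ j), ε j * α i j h = α i j h) :
    ∃ ρ : PathAlgebra K V →ₐ[K] E, ∀ {i j : V} (p : Quiver.Path i j),
      ρ (ofPath K p) = pathValue ε α p := by
  let l : PathAlgebra K V →ₗ[K] E :=
    Finsupp.linearCombination K fun p : AnyPath V => pathValue ε α p.2.2
  have hl : ∀ {i j : V} (p : Quiver.Path i j), l (ofPath K p) = pathValue ε α p := fun {i j} p =>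
    (Finsupp.linearCombination_single K (1 : K) (⟨i, j, p⟩ : AnyPath V)).trans (one_smul K _)
  have hone : l 1 = 1 := by
    let _ := Fintype.ofFinite V
    rw [one_def, map_sum, ← hsum]
    exact Finset.sum_congr rfl fun i _ => hl _
  have hmul : ∀ x y, l (x * y) = l x * l y := by
    have key : (mulLinear K (V := V)).compr₂ l = (LinearMap.mul K E).compl₁₂ l l := by
      refine linearMap_ext fun {i j} p => linearMap_ext fun {i' j'} q => ?_
      change l (ofPath K p * ofPath K q) = l (ofPath K p) * l (ofPath K q)
      rw [hl, hl]
      by_cases h : j' = i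
      · subst h
        rw [ofPath_comp, hl, pathValue_comp h1 h3]
      · rw [ofPath_mul_of_ne _ _ h, map_zero, ← pathValue_mul h1 p, ← mul_pathValue h1 h3 q,
          mul_assoc, ← mul_assoc (ε i), h2 _ _ (Ne.symm h), zero_mul, mul_zero]
    exact fun x y => congrArg (fun k => k x y) key
  exact ⟨AlgHom.ofLinearMap l hone hmul, fun p => hl p⟩

end Lift

variable [Finite V]

variable (K) in
/-- The character of the path algebra given by the simple module at a vertex. -/
lemma exists_character (a : V) : ∃ χ : PathAlgebra K V →ₐ[K] K,
    χ (ofPath K (Quiver.Path.nil : Quiver.Path a a)) = 1 ∧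
    (∀ i, i ≠ a → χ (ofPath K (Quiver.Path.nil : Quiver.Path i i)) = 0) ∧
    ∀ {i j : V} (p : Quiver.Path i j), 1 ≤ p.length → χ (ofPath K p) = 0 := by
  classical
  obtain ⟨χ, hχ⟩ := exists_lift (K := K) (E := K) (ε := fun i : V => if i = a then 1 else 0)
    (α := fun _ _ _ => 0) (fun i => by simp) (fun i j h => by
      by_cases h1 : i = a
      · simp [← h1, Ne.symm h]
      · simp [h1]) (by simp) (fun _ _ _ => mul_zero _)
  refine ⟨χ, ?_, fun i hi => ?_, fun {i j} p hp => ?_⟩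
  · rw [hχ]
    exact if_pos rfl
  · rw [hχ]
    exact if_neg hi
  · rw [hχ]
    cases p with
    | nil => exact absurd hp (by simp)
    | cons p h => exact zero_mul _

variable (K V) in
/-- The span of the paths of length at least `n`. -/
noncomputable def pathIdeal (n : ℕ) : Submodule K (PathAlgebra K V) :=
  Submodule.span K {x | ∃ (i j : V) (p : Quiver.Path i j), n ≤ p.length ∧ x = ofPath K p}

lemma ofPath_mem_pathIdeal {n : ℕ} {i j : V} (p : Quiver.Path i j) (h : n ≤ p.length) :
    ofPath K p ∈ pathIdeal K V n :=
  Submodule.subset_span ⟨i, j, p, h, rfl⟩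

lemma pathIdeal_mul_le (m n : ℕ) : pathIdeal K V m * pathIdeal K V n ≤ pathIdeal K V (m + n) := by
  rw [pathIdeal, pathIdeal, Submodule.span_mul_span, Submodule.span_le]
  rintro _ ⟨_, ⟨i, j, p, hp, rfl⟩, _, ⟨k, l, q, hq, rfl⟩, rfl⟩
  change ofPath K p * ofPath K q ∈ _
  by_cases h : l = i
  · subst h
    rw [ofPath_comp]
    refine ofPath_mem_pathIdeal _ ?_
    rw [Quiver.Path.length_comp]
    omega
  · rw [ofPath_mul_of_ne _ _ h]
    exact zero_mem _

lemma pathIdeal_pow_le (n : ℕ) : pathIdeal K V 1 ^ n ≤ pathIdeal K V n := by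
  induction n with
  | zero =>
    have h : pathIdeal K V 0 = ⊤ := by
      rw [← span_ofPath]
      simp [pathIdeal]
    rw [h]
    exact le_top
  | succ n ih =>
    rw [pow_succ]
    exact (mul_le_mul' ih le_rfl).trans (pathIdeal_mul_le n 1)

/-- The paths from `a` to `a` are the trivial one and those in the ideal of the arrows. -/
lemma corner_mem_pathIdeal {a : V} {χ : PathAlgebra K V →ₐ[K] K}
    (h1 : χ (ofPath K (Quiver.Path.nil : Quiver.Path a a)) = 1)
    (h2 : ∀ i, i ≠ a → χ (ofPath K (Quiver.Path.nil : Quiver.Path i i)) = 0)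
    (h3 : ∀ {i j : V} (p : Quiver.Path i j), 1 ≤ p.length → χ (ofPath K p) = 0)
    (x : PathAlgebra K V) :
    ofPath K (Quiver.Path.nil : Quiver.Path a a) * x *
      ofPath K (Quiver.Path.nil : Quiver.Path a a) -
        χ x • ofPath K (Quiver.Path.nil : Quiver.Path a a) ∈ pathIdeal K V 1 := by
  have hx : x ∈ Submodule.span K {x : PathAlgebra K V | ∃ (i j : V) (p : Quiver.Path i j),
    x = ofPath K p} := span_ofPath (K := K) (V := V) ▸ Submodule.mem_top
  induction hx using Submodule.span_induction with
  | zero => simp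
  | add x y _ _ hx hy =>
    rw [mul_add, add_mul, map_add, add_smul, add_sub_add_comm]
    exact add_mem hx hy
  | smul c x _ hx =>
    rw [mul_smul_comm, smul_mul_assoc, map_smul, smul_assoc, ← smul_sub]
    exact Submodule.smul_mem _ c hx
  | mem x hx =>
    obtain ⟨i, j, p, rfl⟩ := hx
    obtain hp | hp := Nat.eq_zero_or_pos p.length
    · obtain rfl := p.eq_of_length_zero hp
      rw [p.eq_nil_of_length_zero hp]
      by_cases h : i = a
      · subst h
        rw [ofPath_nil_mul_self, ofPath_nil_mul_self, h1, one_smul, sub_self]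
        exact zero_mem _
      · rw [ofPath_mul_of_ne _ _ h, h2 i h, zero_mul, zero_smul, sub_self]
        exact zero_mem _
    · rw [h3 p hp, zero_smul, sub_zero]
      by_cases h : j = a
      · subst h
        rw [ofPath_comp, Quiver.Path.comp_nil]
        by_cases h' : j = i
        · subst h'
          rw [ofPath_comp, Quiver.Path.nil_comp]
          exact ofPath_mem_pathIdeal p hp
        · rw [ofPath_mul_of_ne _ _ h']
          exact zero_mem _
      · rw [ofPath_mul_of_ne _ _ h, zero_mul]
        exact zero_mem _

end PathAlgebra

/-! ### Characters of quotients of path algebras -/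

namespace QuiverAlgebra

variable {K : Type u} [Field K] {V : Type u} [Quiver.{u} V] [Finite V]

/-- The projection from the path algebra to its quotient. -/
noncomputable abbrev mk (I : TwoSidedIdeal (PathAlgebra K V)) : PathAlgebra K V →ₐ[K] QuiverAlgebra I :=
  RingCon.mkₐ K I.ringCon

lemma mk_surjective (I : TwoSidedIdeal (PathAlgebra K V)) : Function.Surjective (mk I) :=
  RingCon.mk'_surjective _

lemma mk_eq_zero {I : TwoSidedIdeal (PathAlgebra K V)} {x : PathAlgebra K V} :
    mk I x = 0 ↔ x ∈ I := by
  rw [TwoSidedIdeal.mem_iff]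
  exact RingCon.eq _

/-- Algebra homomorphisms which vanish on the ideal descend to the quotient. -/
lemma exists_desc {I : TwoSidedIdeal (PathAlgebra K V)} {E : Type u} [Ring E] [Algebra K E]
    (ρ : PathAlgebra K V →ₐ[K] E) (h : ∀ x ∈ I, ρ x = 0) :
    ∃ ρ' : QuiverAlgebra I →ₐ[K] E, ∀ x, ρ' (mk I x) = ρ x :=
  ⟨RingCon.liftₐ I.ringCon ρ fun x y hxy => by
    have h1 := h (x - y) ((TwoSidedIdeal.rel_iff I x y).1 hxy)
    rw [map_sub, sub_eq_zero] at h1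
    exact h1, fun _ => rfl⟩

/-- The idempotent of a vertex. -/
noncomputable abbrev vertex (I : TwoSidedIdeal (PathAlgebra K V)) (i : V) : QuiverAlgebra I :=
  mk I (PathAlgebra.ofPath K (Quiver.Path.nil : Quiver.Path i i))

/-- The simple module at a vertex gives a character whose kernel on the corner algebra of the vertex
is nilpotent. -/
lemma exists_character {I : TwoSidedIdeal (PathAlgebra K V)} (hI : IsAdmissible I) (a : V) :
    ∃ χ : QuiverAlgebra I →ₐ[K] K, χ (vertex I a) = 1 ∧
      ∃ n : ℕ, localCharKer (vertex I a) χ ^ n = ⊥ := by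
  obtain ⟨χ₀, h1, h2, h3⟩ := PathAlgebra.exists_character K a
  have h0 : Submodule.span K {y : PathAlgebra K V | ∃ (i j : V) (p : Quiver.Path i j),
      2 ≤ p.length ∧ y = PathAlgebra.ofPath K p} ≤ LinearMap.ker χ₀.toLinearMap := by
    rw [Submodule.span_le]
    rintro _ ⟨i, j, p, hp, rfl⟩
    exact h3 p (by omega)
  obtain ⟨χ, hχ⟩ := exists_desc (I := I) χ₀ fun x hx => h0 (hI.le_sq x hx)
  obtain ⟨n, hn⟩ := hI.exists_length
  refine ⟨χ, (hχ _).trans h1, n, ?_⟩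
  have h4 : localCharKer (vertex I a) χ ≤
      (PathAlgebra.pathIdeal K V 1).map (mk I).toLinearMap := by
    intro x hx
    obtain ⟨hx1, hx2, hx3⟩ := mem_localCharKer.1 hx
    obtain ⟨y, rfl⟩ := mk_surjective I x
    refine ⟨_, PathAlgebra.corner_mem_pathIdeal h1 h2 h3 y, ?_⟩
    rw [← hχ, hx3, zero_smul, sub_zero]
    change mk I (_ * _ * _) = _
    rw [map_mul, map_mul, hx1, hx2]
  rw [eq_bot_iff]
  refine (pow_le_pow_left' h4 n).trans ?_
  rw [← Submodule.map_pow, Submodule.map_le_iff_le_comap]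
  refine (PathAlgebra.pathIdeal_pow_le n).trans (Submodule.span_le.2 ?_)
  rintro _ ⟨i, j, p, hp, rfl⟩
  exact mk_eq_zero.2 (hn p hp)

end QuiverAlgebra

end SimpleGluing

namespace SimpleGluing

/-! ### The gluing of two quiver algebras -/

namespace GlueVertex

variable {VA VB : Type u} {a : VA} {b : VB}

lemma eq_of_left_eq_right {i : VA} {j : VB} (h : left a b i = right a b j) : i = a ∧ j = b := by
  constructor
  · exact congrArg (Quot.lift (Sum.elim id (fun _ => a)) (by rintro _ _ ⟨rfl, rfl⟩; rfl)) h
  · exact (congrArg (Quot.lift (Sum.elim (fun _ => b) id) (by rintro _ _ ⟨rfl, rfl⟩; rfl)) h).symm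

lemma cases_vertex {p : GlueVertex a b → Prop} (h1 : ∀ i, p (left a b i))
    (h2 : ∀ j, p (right a b j)) (v : GlueVertex a b) : p v := by
  obtain ⟨i | j⟩ := v
  · exact h1 i
  · exact h2 j

lemma cases_arrow [Quiver.{u} VA] [Quiver.{u} VB] {p : ∀ v w : GlueVertex a b, (v ⟶ w) → Prop}
    (h1 : ∀ {i j : VA} (h : i ⟶ j), p _ _ ((inclLeft a b).map h))
    (h2 : ∀ {i j : VB} (h : i ⟶ j), p _ _ ((inclRight a b).map h)) {v w : GlueVertex a b}
    (h : v ⟶ w) : p v w h :=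
  match v, w, h with
  | _, _, .ofLeft h => h1 h
  | _, _, .ofRight h => h2 h

/-- Sums over the vertices of the gluing quiver, by inclusion and exclusion. -/
lemma sum_add {M : Type*} [AddCommMonoid M] [Fintype VA] [Fintype VB] [Fintype (GlueVertex a b)]
    (F : GlueVertex a b → M) :
    ∑ v, F v + F (left a b a) = ∑ i, F (left a b i) + ∑ j, F (right a b j) := by
  classical
  have h1 : (Finset.univ : Finset (GlueVertex a b)) =
      Finset.univ.image (left a b) ∪ Finset.univ.image (right a b) := by
    ext v
    induction v using cases_vertex <;> simp
  have h2 : ({left a b a} : Finset (GlueVertex a b)) =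
      Finset.univ.image (left a b) ∩ Finset.univ.image (right a b) := by
    ext v
    simp only [Finset.mem_singleton, Finset.mem_inter, Finset.mem_image, Finset.mem_univ, true_and]
    constructor
    · rintro rfl
      exact ⟨⟨a, rfl⟩, ⟨b, (left_eq_right a b).symm⟩⟩
    · rintro ⟨⟨i, rfl⟩, ⟨j, hj⟩⟩
      rw [(eq_of_left_eq_right hj.symm).1]
  have h3 := Finset.sum_union_inter (f := F) (s₁ := Finset.univ.image (left a b))
    (s₂ := Finset.univ.image (right a b))
  rw [← h1, ← h2, Finset.sum_singleton, Finset.sum_image (left_injective a b).injOn,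
    Finset.sum_image (right_injective a b).injOn] at h3
  exact h3

end GlueVertex

section QuiverGluing

open GlueVertex QuiverAlgebra

variable {K : Type u} [Field K] {VA VB : Type u} [Quiver.{u} VA] [Quiver.{u} VB]
  [Finite VA] [Finite VB] (a : VA) (b : VB)
  (IA : TwoSidedIdeal (PathAlgebra K VA)) (IB : TwoSidedIdeal (PathAlgebra K VB))

variable (K) in
/-- The trivial path at a vertex of the gluing quiver. -/
noncomputable abbrev glueVertexPath (v : GlueVertex a b) : PathAlgebra K (GlueVertex a b) :=
  PathAlgebra.ofPath K (Quiver.Path.nil : Quiver.Path v v)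

lemma map_inclLeft_one [Fintype VA] : PathAlgebra.map K (inclLeft a b) 1 =
    ∑ i : VA, glueVertexPath K a b (left a b i) := by
  rw [PathAlgebra.one_def, map_sum]
  exact Finset.sum_congr rfl fun i _ => PathAlgebra.map_ofPath _ _

lemma map_inclRight_one [Fintype VB] : PathAlgebra.map K (inclRight a b) 1 =
    ∑ j : VB, glueVertexPath K a b (right a b j) := by
  rw [PathAlgebra.one_def, map_sum]
  exact Finset.sum_congr rfl fun i _ => PathAlgebra.map_ofPath _ _

lemma leftHom_mk (x : PathAlgebra K VA) : leftHom a b IA IB (mk IA x) =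
    mk (glueIdeal a b IA IB) (PathAlgebra.map K (inclLeft a b) x) := rfl

lemma rightHom_mk (x : PathAlgebra K VB) : rightHom a b IA IB (mk IB x) =
    mk (glueIdeal a b IA IB) (PathAlgebra.map K (inclRight a b) x) := rfl

lemma map_inclLeft_add_map_inclRight :
    PathAlgebra.map K (inclLeft a b) 1 + PathAlgebra.map K (inclRight a b) 1 =
      1 + glueVertexPath K a b (left a b a) := by
  have := Fintype.ofFinite VA
  have := Fintype.ofFinite VB
  have := Fintype.ofFinite (GlueVertex a b)
  rw [map_inclLeft_one, map_inclRight_one, PathAlgebra.one_def]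
  exact (GlueVertex.sum_add (glueVertexPath K a b)).symm

lemma map_inclLeft_mul_map_inclRight :
    PathAlgebra.map K (inclLeft a b) 1 * PathAlgebra.map K (inclRight a b) 1 =
      glueVertexPath K a b (left a b a) := by
  have := Fintype.ofFinite VA
  have := Fintype.ofFinite VB
  rw [map_inclLeft_one, map_inclRight_one, Finset.sum_mul_sum, Finset.sum_eq_single a,
    Finset.sum_eq_single b]
  · rw [← left_eq_right]
    exact PathAlgebra.ofPath_nil_mul_self _
  · exact fun j _ hj => PathAlgebra.ofPath_mul_of_ne _ _
      fun h => hj (eq_of_left_eq_right h.symm).2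
  · simp
  · exact fun i _ hi => Finset.sum_eq_zero fun j _ => PathAlgebra.ofPath_mul_of_ne _ _
      fun h => hi (eq_of_left_eq_right h.symm).1
  · simp

lemma map_inclRight_mul_map_inclLeft :
    PathAlgebra.map K (inclRight a b) 1 * PathAlgebra.map K (inclLeft a b) 1 =
      glueVertexPath K a b (left a b a) := by
  have := Fintype.ofFinite VA
  have := Fintype.ofFinite VB
  rw [map_inclLeft_one, map_inclRight_one, Finset.sum_mul_sum, Finset.sum_eq_single b,
    Finset.sum_eq_single a]
  · rw [← left_eq_right]
    exact PathAlgebra.ofPath_nil_mul_self _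
  · exact fun i _ hi => PathAlgebra.ofPath_mul_of_ne _ _
      fun h => hi (eq_of_left_eq_right h).1
  · simp
  · exact fun j _ hj => Finset.sum_eq_zero fun i _ => PathAlgebra.ofPath_mul_of_ne _ _
      fun h => hj (eq_of_left_eq_right h).2
  · simp

/-- The gluing algebra is generated by the images of the two algebras. -/
lemma adjoin_range_union_range : Algebra.adjoin K (Set.range (leftHom a b IA IB) ∪
    Set.range (rightHom a b IA IB)) = ⊤ := by
  rw [Algebra.eq_top_iff]
  intro x
  obtain ⟨x, rfl⟩ := mk_surjective _ x
  let S := (Algebra.adjoin K (Set.range (leftHom a b IA IB) ∪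
    Set.range (rightHom a b IA IB))).comap (mk (glueIdeal a b IA IB))
  have hl : ∀ x, PathAlgebra.map K (inclLeft a b) x ∈ S := fun x =>
    Algebra.subset_adjoin (Or.inl ⟨mk IA x, leftHom_mk a b IA IB x⟩)
  have hr : ∀ x, PathAlgebra.map K (inclRight a b) x ∈ S := fun x =>
    Algebra.subset_adjoin (Or.inr ⟨mk IB x, rightHom_mk a b IA IB x⟩)
  have hp : ∀ {i j : GlueVertex a b} (p : Quiver.Path i j), PathAlgebra.ofPath K p ∈ S := by
    intro i j p
    induction p with
    | nil =>
      induction i using GlueVertex.cases_vertex with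
      | h1 i => exact PathAlgebra.map_ofPath (K := K) (inclLeft a b) (.nil : Quiver.Path i i) ▸ hl _
      | h2 i => exact PathAlgebra.map_ofPath (K := K) (inclRight a b) (.nil : Quiver.Path i i) ▸ hr _
    | cons p h ih =>
      have h1 : PathAlgebra.ofPath K (p.cons h) =
          PathAlgebra.ofPath K h.toPath * PathAlgebra.ofPath K p :=
        (PathAlgebra.ofPath_comp p h.toPath).symm
      rw [h1]
      refine mul_mem ?_ ih
      exact GlueVertex.cases_arrow (p := fun v w h => PathAlgebra.ofPath K h.toPath ∈ S)
        (fun h => PathAlgebra.map_ofPath (K := K) (inclLeft a b) h.toPath ▸ hl _)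
        (fun h => PathAlgebra.map_ofPath (K := K) (inclRight a b) h.toPath ▸ hr _) h
  have h2 : (⊤ : Submodule K (PathAlgebra K (GlueVertex a b))) ≤ Subalgebra.toSubmodule S := by
    rw [← PathAlgebra.span_ofPath, Submodule.span_le]
    rintro _ ⟨i, j, p, rfl⟩
    exact hp p
  exact h2 (Submodule.mem_top : x ∈ ⊤)

section Lift

variable {E : Type u} [Ring E] [Algebra K E] (φ : QuiverAlgebra IA →ₙₐ[K] E)
  (ψ : QuiverAlgebra IB →ₙₐ[K] E)

/-- The values of the vertices of the gluing quiver given by homomorphisms on the two algebras. -/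
noncomputable def glueVertexValue (h : φ (vertex IA a) = ψ (vertex IB b)) : GlueVertex a b → E :=
  Quot.lift (Sum.elim (fun i => φ (vertex IA i)) (fun j => ψ (vertex IB j)))
    (by rintro _ _ ⟨rfl, rfl⟩; exact h)

/-- The values of the arrows of the gluing quiver given by homomorphisms on the two algebras. -/
noncomputable def glueArrowValue : ∀ v w : GlueVertex a b, (v ⟶ w) → E
  | _, _, .ofLeft h => φ (mk IA (PathAlgebra.ofPath K h.toPath))
  | _, _, .ofRight h => ψ (mk IB (PathAlgebra.ofPath K h.toPath))

variable {a b IA IB φ ψ}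

lemma exists_glue_lift (h : φ (vertex IA a) = ψ (vertex IB b))
    (h1 : φ 1 * ψ 1 = φ (vertex IA a)) (h2 : ψ 1 * φ 1 = φ (vertex IA a))
    (h3 : φ 1 + ψ 1 = 1 + φ (vertex IA a)) :
    ∃ ρ : GluingAlgebra a b IA IB →ₐ[K] E, (∀ x, ρ (leftHom a b IA IB x) = φ x) ∧
      ∀ x, ρ (rightHom a b IA IB x) = ψ x := by
  let ε := glueVertexValue a b IA IB φ ψ h
  let α := glueArrowValue a b IA IB φ ψ
  have e1 : ∀ v, ε v * ε v = ε v := by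
    intro v
    induction v using GlueVertex.cases_vertex with
    | h1 i =>
      change φ _ * φ _ = φ _
      rw [← map_mul, ← map_mul, PathAlgebra.ofPath_nil_mul_self]
    | h2 i =>
      change ψ _ * ψ _ = ψ _
      rw [← map_mul, ← map_mul, PathAlgebra.ofPath_nil_mul_self]
  have orthA : ∀ i j : VA, i ≠ j → vertex IA i * vertex IA j = 0 := fun i j hij => by
    rw [← map_mul, PathAlgebra.ofPath_mul_of_ne _ _ (Ne.symm hij), map_zero]
  have orthB : ∀ i j : VB, i ≠ j → vertex IB i * vertex IB j = 0 := fun i j hij => by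
    rw [← map_mul, PathAlgebra.ofPath_mul_of_ne _ _ (Ne.symm hij), map_zero]
  have orthAB : ∀ (i : VA) (j : VB), left a b i ≠ right a b j →
      φ (vertex IA i) * ψ (vertex IB j) = 0 ∧ ψ (vertex IB j) * φ (vertex IA i) = 0 := by
    intro i j hij
    have hA : φ (vertex IA i) * ψ (vertex IB j) =
        φ (vertex IA i * vertex IA a) * ψ (vertex IB j) := by
      conv_lhs => rw [← mul_one (vertex IA i), ← one_mul (vertex IB j), map_mul, map_mul,
        mul_assoc, ← mul_assoc (φ 1), h1, ← mul_assoc, ← map_mul]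
    have hB : ψ (vertex IB j) * φ (vertex IA i) =
        ψ (vertex IB j) * φ (vertex IA a * vertex IA i) := by
      conv_lhs => rw [← one_mul (vertex IA i), ← mul_one (vertex IB j), map_mul, map_mul,
        mul_assoc, ← mul_assoc (ψ 1), h2, ← map_mul]
    rw [hA, hB]
    by_cases hi : i = a
    · subst hi
      have hj : j ≠ b := by
        rintro rfl
        exact hij (left_eq_right _ _)
      rw [map_mul, h, mul_assoc, ← map_mul, orthB _ _ hj.symm, map_zero, mul_zero, ← mul_assoc,
        ← map_mul, orthB _ _ hj, map_zero, zero_mul]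
      exact ⟨rfl, rfl⟩
    · rw [orthA _ _ hi, orthA _ _ (Ne.symm hi), map_zero, zero_mul, mul_zero]
      exact ⟨rfl, rfl⟩
  have e2 : ∀ v w, v ≠ w → ε v * ε w = 0 := by
    intro v w hvw
    induction v using GlueVertex.cases_vertex with
    | h1 i =>
      induction w using GlueVertex.cases_vertex with
      | h1 j =>
        change φ _ * φ _ = 0
        rw [← map_mul, orthA _ _ (fun hij => hvw (congrArg _ hij)), map_zero]
      | h2 j => exact (orthAB i j hvw).1
    | h2 i =>
      induction w using GlueVertex.cases_vertex with
      | h1 j => exact (orthAB j i hvw.symm).2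
      | h2 j =>
        change ψ _ * ψ _ = 0
        rw [← map_mul, orthB _ _ (fun hij => hvw (congrArg _ hij)), map_zero]
  have hsum : letI := Fintype.ofFinite (GlueVertex a b); ∑ v, ε v = 1 := by
    let _ := Fintype.ofFinite (GlueVertex a b)
    let _ := Fintype.ofFinite VA
    let _ := Fintype.ofFinite VB
    have s0 := GlueVertex.sum_add ε
    have s1 : ∑ i, ε (left a b i) = φ 1 := by
      rw [← map_one (mk IA), PathAlgebra.one_def, map_sum, map_sum]
      rfl
    have s2 : ∑ j, ε (right a b j) = ψ 1 := by
      rw [← map_one (mk IB), PathAlgebra.one_def, map_sum, map_sum]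
      rfl
    rw [s1, s2, h3] at s0
    exact add_right_cancel s0
  have e3 : ∀ (v w : GlueVertex a b) (k : v ⟶ w), ε w * α v w k = α v w k := by
    intro v w k
    refine GlueVertex.cases_arrow (p := fun v w k => ε w * α v w k = α v w k) ?_ ?_ k
    · intro i j k
      change φ (vertex IA j) * φ _ = φ _
      rw [← map_mul, ← map_mul, PathAlgebra.ofPath_comp, Quiver.Path.comp_nil]
    · intro i j k
      change ψ (vertex IB j) * ψ _ = ψ _
      rw [← map_mul, ← map_mul, PathAlgebra.ofPath_comp, Quiver.Path.comp_nil]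
  obtain ⟨ρ, hρ⟩ := PathAlgebra.exists_lift (K := K) e1 e2 hsum e3
  have hl : ∀ x, ρ (PathAlgebra.map K (inclLeft a b) x) = φ (mk IA x) := by
    have key : ρ.toLinearMap ∘ₗ PathAlgebra.map K (inclLeft a b) =
        (φ : QuiverAlgebra IA →ₗ[K] E) ∘ₗ (mk IA).toLinearMap := by
      refine PathAlgebra.linearMap_ext fun {i j} p => ?_
      change ρ (PathAlgebra.map K _ _) = φ (mk IA _)
      rw [PathAlgebra.map_ofPath, hρ]
      induction p with
      | nil => rfl
      | cons p k ih =>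
        have h4 : PathAlgebra.ofPath K (p.cons k) =
            PathAlgebra.ofPath K k.toPath * PathAlgebra.ofPath K p :=
          (PathAlgebra.ofPath_comp p k.toPath).symm
        rw [h4, map_mul, map_mul, ← ih]
        rfl
    exact fun x => LinearMap.congr_fun key x
  have hr : ∀ x, ρ (PathAlgebra.map K (inclRight a b) x) = ψ (mk IB x) := by
    have key : ρ.toLinearMap ∘ₗ PathAlgebra.map K (inclRight a b) =
        (ψ : QuiverAlgebra IB →ₗ[K] E) ∘ₗ (mk IB).toLinearMap := by
      refine PathAlgebra.linearMap_ext fun {i j} p => ?_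
      change ρ (PathAlgebra.map K _ _) = ψ (mk IB _)
      rw [PathAlgebra.map_ofPath, hρ]
      induction p with
      | nil => rfl
      | cons p k ih =>
        have h4 : PathAlgebra.ofPath K (p.cons k) =
            PathAlgebra.ofPath K k.toPath * PathAlgebra.ofPath K p :=
          (PathAlgebra.ofPath_comp p k.toPath).symm
        rw [h4, map_mul, map_mul, ← ih]
        rfl
    exact fun x => LinearMap.congr_fun key x
  have hker : glueIdeal a b IA IB ≤ TwoSidedIdeal.ker ρ := by
    refine TwoSidedIdeal.span_le.2 ?_
    rintro _ (⟨x, hx, rfl⟩ | ⟨x, hx, rfl⟩)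
    · exact (TwoSidedIdeal.mem_ker ρ).2 (by rw [hl, mk_eq_zero.2 hx, map_zero])
    · exact (TwoSidedIdeal.mem_ker ρ).2 (by rw [hr, mk_eq_zero.2 hx, map_zero])
  obtain ⟨ρ', hρ'⟩ := exists_desc ρ fun x hx => (TwoSidedIdeal.mem_ker ρ).1 (hker hx)
  refine ⟨ρ', fun x => ?_, fun x => ?_⟩
  · obtain ⟨x, rfl⟩ := mk_surjective IA x
    rw [leftHom_mk, hρ', hl]
  · obtain ⟨x, rfl⟩ := mk_surjective IB x
    rw [rightHom_mk, hρ', hr]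

end Lift

/-- The algebra of the simple gluing quiver, modulo the ideal generated by the two given ideals, is
the simple gluing of the two quiver algebras. -/
lemma isGluing {χA : QuiverAlgebra IA →ₐ[K] K} {χB : QuiverAlgebra IB →ₐ[K] K}
    (hA : χA (vertex IA a) = 1) (hB : χB (vertex IB b) = 1) :
    IsGluing (leftHom a b IA IB : QuiverAlgebra IA →ₙ+* GluingAlgebra a b IA IB)
      (rightHom a b IA IB : QuiverAlgebra IB →ₙ+* GluingAlgebra a b IA IB)
      (vertex IA a) (vertex IB b) (vertex (glueIdeal a b IA IB) (left a b a)) χA χB where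
  map_smul_left c x := map_smul (leftHom a b IA IB) c x
  map_smul_right c x := map_smul (rightHom a b IA IB) c x
  idem_left := by rw [← map_mul, PathAlgebra.ofPath_nil_mul_self]
  idem_right := by rw [← map_mul, PathAlgebra.ofPath_nil_mul_self]
  char_left := hA
  char_right := hB
  map_left := congrArg (mk _) (PathAlgebra.map_ofPath _ _)
  map_right := by
    rw [left_eq_right]
    exact congrArg (mk _) (PathAlgebra.map_ofPath _ _)
  mul_left := congrArg (mk (glueIdeal a b IA IB)) (map_inclLeft_mul_map_inclRight a b)
  mul_right := congrArg (mk (glueIdeal a b IA IB)) (map_inclRight_mul_map_inclLeft a b)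
  add_one := congrArg (mk (glueIdeal a b IA IB)) (map_inclLeft_add_map_inclRight a b)
  adjoin := adjoin_range_union_range a b IA IB
  exists_lift E _ _ φ ψ h h1 h2 h3 := exists_glue_lift h h1 h2 h3

end QuiverGluing

end SimpleGluing

theorem theorem3p14 {K : Type u} [Field K] [IsAlgClosed K]
    {VA VB : Type u} [Quiver.{u} VA] [Quiver.{u} VB] [Finite VA] [Finite VB]
    [∀ i j : VA, Finite (i ⟶ j)] [∀ i j : VB, Finite (i ⟶ j)]
    (IA : TwoSidedIdeal (PathAlgebra K VA))
    (IB : TwoSidedIdeal (PathAlgebra K VB))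
    (hIA : IsAdmissible IA) (hIB : IsAdmissible IB)
    (a : VA) (b : VB)
    (hfin : Module.Finite K (GluingAlgebra a b IA IB)) :
    (∃ (hG : ∀ P, isGorensteinProjective (GluingAlgebra a b IA IB)
          ((glueFunctor a b IA IB).obj P))
        (e : StableGProj (QuiverAlgebra IA) ×
          StableGProj (QuiverAlgebra IB) ≌
          StableGProj (GluingAlgebra a b IA IB)),
        Nonempty (((toStable _).prod (toStable _)) ⋙ e.functor ≅
          (isGorensteinProjective _).lift (glueFunctor a b IA IB) hG ⋙
            toStable _) ∧
        IsLinearFunctor K e.functor ∧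
        IsTriangleFunctor e.functor) ∧
    (∀ Z : ModuleCat.{u} (GluingAlgebra a b IA IB),
      Module.Finite (GluingAlgebra a b IA IB) Z → IsIndecomposable Z →
      (isGorensteinProjective (GluingAlgebra a b IA IB) Z ↔
        (∃ X : ModuleCat.{u} (QuiverAlgebra IA), IsIndecomposable X ∧
          isGorensteinProjective _ X ∧
          Nonempty (Z ≅ (iLambda a b IA IB).obj X)) ∨
        (∃ Y : ModuleCat.{u} (QuiverAlgebra IB), IsIndecomposable Y ∧
          isGorensteinProjective _ Y ∧
          Nonempty (Z ≅ (jLambda a b IA IB).obj Y)))) := by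
  obtain ⟨χA, hχA, m, hm⟩ := QuiverAlgebra.exists_character hIA a
  obtain ⟨χB, hχB, n, hn⟩ := QuiverAlgebra.exists_character hIB b
  have H := isGluing a b IA IB hχA hχB
  have := H.stableGlue_isEquivalence
  exact ⟨⟨fun P => H.isGorensteinProjective_glue P.1.property P.2.property,
    H.stableGlue.asEquivalence, ⟨H.toStableCompStableGlue⟩, H.stableGlue_isLinear,
    H.stableGlue_isTriangle⟩,
    fun Z _ hZ => H.isGorensteinProjective_iff_of_isIndecomposable hm hn hZ⟩
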